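/- Notation. Let $n\ge 1$. For $f\in\mathbb F_2[x]$ let $[f]\in\mathbb F_2^n$ be the coefficient vector (ascending order) of $f \bmod (x^n-1)$; for $f=\sum_{i<n}f_ix^i$ put $\bar f=f_0+f_{n-1}x+\cdots+f_1x^{n-1}$; and if $gh=x^n-1$ put $g^\perp=x^{\deg h}h(1/x)$. On $\mathbb F_2^{2n}$ use the symplectic form $\langle u,w\rangle_s=\sum_{i<n}(u_iw_{n+i}-u_{n+i}w_i)$, the symplectic weight $w_s(u)=\#\{i<n : (u_i,u_{n+i})\ne(0,0)\}$ and, for a linear code $C\subseteq\mathbb F_2^{2n}$, its symplectic dual $C^{\perp_s}$. Let $C(g_1,g_2,v)=\{([avg_1+bg_2],[ag_1+bvg_2]) : a,b\in\mathbb F_2[x]\}$. We say that $(n;g_1,g_2,v)$ is admissible if $\deg v<n$, $g_1\mid x^n-1$, $g_2\mid x^n-1$, $\gcd(g_1,g_2)=1$, $\gcd(v-1,x^n-1)=1$, $g_2\mid g_1^\perp$ and $\bar v=v$. For $a,b\in\mathbb F_2^n$ the Pauli operator $X(a)Z(b)$ on $(\mathbb C^2)^{\otimes n}$ sends $|x\rangle$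 to $(-1)^{b\cdot x}|x+a\rangle$; its weight is $w_s(a,b)$. An $[[n,k,d]]$ quantum code is a subspace $Q\subseteq(\mathbb C^2)^{\otimes n}$ of dimension $2^k$ such that $d$ is the least weight of a Pauli operator $E$ that $Q$ does not detect, where $Q$ detects $E$ if for some $c\in\mathbb C$ one has $\langle\varphi|E|\psi\rangle=c\langle\varphi|\psi\rangle$ for all $\varphi,\psi\in Q$. It is pure if $\langle\varphi|X(a)Z(b)|\psi\rangle=0$ for all $\varphi,\psi\in Q$ and all $(a,b)\ne0$ with $w_s(a,b)<d$. Polynomials are given by their coefficient strings in ascending order, with exponents for runs of equal symbols, e.g. $1\,0\,1^{3}$ is $1+x^2+x^3+x^4$. Statement. For each of the eight entries $[[n,k,d]]$, $d_0$, $g_1,g_2,v$, $w(z)$ below, the following hold with $C=C(g_1,g_2,v)$: (i) $(n;g_1,g_2,v)$ is admissible, $k=n-\deg g_1-\deg g_2$, $\dim C=n+k$, $C^{\perp_s}\subseteq C$, and the least symplectic weight of a nonzero vector of $C$ is $d$. (ii) There is a pure $[[n,k,d]]$ quantum code that is a stabilizer code of $C$, i.e. a joint eigenspace of the operators $X(a)Z(b)$,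 $(a,b)\in C^{\perp_s}$ (all vectors on which each of these operators acts as a prescribed scalar). (iii) $1+\sum_{u\in C\setminus C^{\perp_s}}z^{w_s(u)}=w(z)$, in the sense that the displayed coefficients are correct and that the coefficients of $z,\dots,z^{d-1}$ vanish. (iv) $d>d_0$, where $d_0$ is the number listed with the entry: the minimum distance (for the last six entries, an upper bound for it) that Grassl's table of best known binary quantum codes recorded for length $n$ and dimension $k$ when the codes were found. The entries are - $[[45,16,8]]$, $d_0=7$: $g_1=1^{2}\,0\,1^{2}\,0^{7}\,1^{2}$, $g_2=1^{4}\,0^{2}\,1\,0\,1\,0^{4}\,1^{2}\,0\,1$, $v=0\,1^{2}\,0\,1^{2}\,0^{34}\,1^{2}\,0\,1^{2}$, $w(z)=1+2970z^{8}+32580z^{9}+352620z^{10}+\cdots+5502836658465z^{45}$. - $[[51,26,7]]$, $d_0=6$: $g_1=1^{2}$, $g_2=1^{2}\,0^{3}\,1\,0^{2}\,1^{2}\,0^{2}\,1^{2}\,0\,1\,0\,1\,0^{2}\,1^{3}\,0\,1$, $v=0^{4}\,1^{2}\,0\,1\,0\,1\,0\,1^{2}\,0\,1^{2}\,0^{3}\,1^{2}\,0\,1\,0\,1\,0^{2}\,1\,0\,1\,0\,1^{2}\,0^{3}\,1^{2}\,0\,1^{2}\,0\,1\,0\,1\,0\,1^{2}$,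 $w(z)=1+7854z^{7}+126021z^{8}+1783827z^{9}+\cdots+64185081779884617z^{51}$. - $[[47,23,7]]$, $d_0=6$: $g_1=1\,0^{3}\,1^{2}\,0^{3}\,1^{3}\,0\,1^{2}\,0\,1^{3}\,0\,1^{4}$, $g_2=1^{2}$, $v=0^{2}\,1^{5}\,0\,1^{3}\,0^{3}\,1^{2}\,0^{16}\,1^{2}\,0^{3}\,1^{3}\,0\,1^{5}$, $w(z)=1+8131z^{7}+124221z^{8}+1609280z^{9}+\cdots+1584816838311358z^{47}$. - $[[55,25,8]]$, $d_0=7$: $g_1=1\,0\,1^{2}\,0\,1^{2}\,0\,1\,0^{2}\,1\,0\,1^{3}\,0^{2}\,1^{3}$, $g_2=1^{11}$, $v=0\,1\,0\,1\,0\,1^{4}\,0\,1\,0^{2}\,1\,0^{28}\,1\,0^{2}\,1\,0\,1^{4}\,0\,1\,0\,1$, $w(z)=1+7810z^{8}+120285z^{9}+1625580z^{10}+\cdots+162468493708434387z^{55}$. - $[[73,45,7]]$, $d_0=6$: $g_1=1^{3}\,0\,1^{3}\,0^{2}\,1\,0^{2}\,1^{3}\,0\,1^{3}$, $g_2=1^{2}\,0\,1\,0\,1\,0\,1^{4}$,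 $v=0\,1\,0\,1\,0^{2}\,1^{2}\,0^{58}\,1^{2}\,0^{2}\,1\,0\,1$, $w(z)=1+13067z^{7}+330252z^{8}+7138451z^{9}+\cdots+251774484793909182856047064z^{73}$. - $[[91,60,7]]$, $d_0=6$: $g_1=1\,0^{2}\,1^{4}\,0\,1\,0^{3}\,1$, $g_2=1^{2}\,0^{5}\,1^{4}\,0\,1\,0^{3}\,1^{2}\,0\,1$, $v=0\,1^{2}\,0^{2}\,1\,0^{80}\,1\,0^{2}\,1^{2}$, $w(z)=1+7930z^{7}+252070z^{8}+7192367z^{9}+\cdots+12192824252072319962279913005679504z^{91}$. - $[[93,63,7]]$, $d_0=6$: $g_1=1^{3}\,0\,1^{2}\,0^{4}\,1^{3}\,0\,1\,0\,1\,0\,1\,0\,1\,0\,1^{2}\,0\,1$, $g_2=1^{3}\,0\,1^{2}$, $v=0^{3}\,1\,0\,1\,0^{2}\,1\,0^{2}\,1\,0\,1\,0\,1\,0\,1^{4}\,0\,1^{2}\,0\,1\,0\,1\,0^{8}\,1\,0\,1^{2}\,0^{2}\,1^{10}\,0^{2}\,1^{2}\,0\,1\,0^{8}\,1\,0\,1\,0\,1^{2}\,0\,1^{4}\,0\,1\,0\,1\,0\,1\,0^{2}\,1\,0^{2}\,1\,0\,1$,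 $w(z)=1+20274z^{7}+619752z^{8}+17662002z^{9}+\cdots+219470836537301759730706283742251295z^{93}$. - $[[105,74,7]]$, $d_0=6$: $g_1=1^{2}\,0\,1^{3}\,0^{3}\,1\,0^{2}\,1$, $g_2=1^{2}\,0\,1\,0^{4}\,1^{3}\,0\,1^{8}$, $v=0^{2}\,1\,0\,1\,0^{4}\,1\,0^{86}\,1\,0^{4}\,1\,0\,1$, $w(z)=1+21855z^{7}+854385z^{8}+27543740z^{9}+\cdots+58317900420110092238457799326599725172775z^{105}$. Moreover, with $C_i=\{i2^s \bmod n : s\ge0\}$, there is a primitive $45$-th root of unity $\zeta$ in $\overline{\mathbb F}_2$ such that, for the first entry, $\{i\in\mathbb Z_{45}: g_1(\zeta^i)=0\}=C_0\cup C_1$ and $\{i\in\mathbb Z_{45}: g_2(\zeta^i)=0\}=C_3\cup C_5\cup C_9\cup C_{15}$; and there is a primitive $51$-st root of unity $\zeta$ such that, for the second entry, $\{i\in\mathbb Z_{51}: g_1(\zeta^i)=0\}=C_0$ and $\{i\in\mathbb Z_{51}: g_2(\zeta^i)=0\}=C_1\cup C_3\cup C_5$. -/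

import Mathlib

open Polynomial

namespace QuantumQC

/-! ### Binary polynomials and the ring of residues modulo `x ^ n - 1` -/

/-- The binary polynomial whose coefficient string, in ascending order, is given in run-length
form: the list `[(1, 2), (0, 1), (1, 3)]` stands for the string `110111`, usually abbreviated
`1^2 0 1^3`, that is, for the polynomial `1 + x + x^3 + x^4 + x^5`. -/
noncomputable def runPoly : List (ZMod 2 × ℕ) → (ZMod 2)[X]
  | [] => 0
  | (a, m) :: l => C a * (∑ i ∈ Finset.range m, X ^ i) + X ^ m * runPoly l

/-- The coefficient vector `[f]` of the residue of `f` modulo `x ^ n - 1`. -/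
noncomputable def vec (n : ℕ) : (ZMod 2)[X] →ₗ[ZMod 2] (Fin n → ZMod 2) :=
  LinearMap.pi fun i => (lcoeff (ZMod 2) (i : ℕ)) ∘ₗ (modByMonicHom (X ^ n - 1))

/-- `f_0 + f_{n-1} x + f_{n-2} x ^ 2 + ... + f_1 x ^ {n-1}`, for `f` of degree less than `n`. -/
noncomputable def bar (n : ℕ) (f : (ZMod 2)[X]) : (ZMod 2)[X] :=
  ∑ i ∈ Finset.range n, C (f.coeff i) * X ^ ((n - i) % n)

/-- `x ^ deg h * h (1 / x)`, where `g * h = x ^ n - 1`. -/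
noncomputable def perpPoly (n : ℕ) (g : (ZMod 2)[X]) : (ZMod 2)[X] :=
  ((X ^ n - 1) / g).reverse

/-- The conditions on `g₁, g₂, v` under which the two-generator quasi-cyclic code of length `2 n`
is used in the construction of a quantum code. -/
structure Conditions (n : ℕ) (g₁ g₂ v : (ZMod 2)[X]) : Prop where
  deg_v : v.degree < n
  dvd₁ : g₁ ∣ X ^ n - 1
  dvd₂ : g₂ ∣ X ^ n - 1
  coprime : IsCoprime g₁ g₂
  coprime_v : IsCoprime (v - 1) (X ^ n - 1)
  dvd_perp : g₂ ∣ perpPoly n g₁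
  bar_v : bar n v = v

/-- The `2`-cyclotomic coset of `i` modulo `n`. -/
def cyclotomicCoset (n : ℕ) (i : ZMod n) : Set (ZMod n) :=
  {j | ∃ s : ℕ, j = i * 2 ^ s}

/-- The defining set of the cyclic code of length `n` generated by `g`, with respect to the
`n`-th root of unity `ζ`. -/
def definingSet (n : ℕ) (g : (ZMod 2)[X]) (ζ : AlgebraicClosure (ZMod 2)) : Set (ZMod n) :=
  {i | aeval (ζ ^ i.val) g = 0}

/-! ### Binary codes of length `2 n` with the symplectic form -/

/-- The space of binary vectors of length `2 n`: a vector is the pair of its two halves. -/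
abbrev BinVec (n : ℕ) : Type := (Fin n → ZMod 2) × (Fin n → ZMod 2)

def sympForm {n : ℕ} (u w : BinVec n) : ZMod 2 :=
  ∑ i, (u.1 i * w.2 i - u.2 i * w.1 i)

def sympWeight {n : ℕ} (u : BinVec n) : ℕ :=
  (Finset.univ.filter fun i => (u.1 i, u.2 i) ≠ (0, 0)).card

def sympDual {n : ℕ} (C : Submodule (ZMod 2) (BinVec n)) : Submodule (ZMod 2) (BinVec n) where
  carrier := {w | ∀ u ∈ C, sympForm u w = 0}
  zero_mem' := by
    intro u _
    simp [sympForm]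
  add_mem' := by
    intro a b ha hb u hu
    have h : sympForm u (a + b) = sympForm u a + sympForm u b := by
      simp only [sympForm, Prod.fst_add, Prod.snd_add, Pi.add_apply, ← Finset.sum_add_distrib]
      exact Finset.sum_congr rfl fun i _ => by ring
    rw [h, ha u hu, hb u hu, add_zero]
  smul_mem' := by
    intro c a ha u hu
    have h : sympForm u (c • a) = c * sympForm u a := by
      simp only [sympForm, Prod.smul_fst, Prod.smul_snd, Pi.smul_apply, smul_eq_mul,
        Finset.mul_sum]
      exact Finset.sum_congr rfl fun i _ => by ring
    rw [h, ha u hu, mul_zero]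

/-- The two-generator quasi-cyclic code of length `2 n` generated by `(v g₁, g₁)` and
`(g₂, v g₂)`: the vectors `([a v g₁ + b g₂], [a g₁ + b v g₂])` for polynomials `a`, `b`. -/
noncomputable def qcCode (n : ℕ) (g₁ g₂ v : (ZMod 2)[X]) : Submodule (ZMod 2) (BinVec n) where
  carrier := {u | ∃ a b : (ZMod 2)[X],
    u = (vec n (a * (v * g₁) + b * g₂), vec n (a * g₁ + b * (v * g₂)))}
  zero_mem' := ⟨0, 0, by simp; rfl⟩
  add_mem' := by
    rintro _ _ ⟨a, b, rfl⟩ ⟨a', b', rfl⟩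
    refine ⟨a + a', b + b', ?_⟩
    rw [Prod.mk_add_mk, ← map_add, ← map_add]
    congr 2 <;> ring
  smul_mem' := by
    rintro c _ ⟨a, b, rfl⟩
    refine ⟨c • a, c • b, ?_⟩
    rw [Prod.smul_mk, ← map_smul, ← map_smul]
    simp only [smul_add, smul_mul_assoc]

/-- The coefficient of `z ^ j` in `1 + ∑ z ^ (sympWeight u)`, where `u` runs over the vectors of
`C` that are not in its symplectic dual. -/
noncomputable def weightDist {n : ℕ} (C : Submodule (ZMod 2) (BinVec n)) (j : ℕ) : ℕ :=
  (if j = 0 then 1 else 0) + Set.ncard {u | u ∈ C ∧ u ∉ sympDual C ∧ sympWeight u = j}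

/-! ### Quantum codes -/

/-- The state space of `n` qubits, the `n`-fold tensor power of `ℂ ^ 2`, with its orthonormal
computational basis indexed by the binary strings of length `n`. -/
abbrev Qubits (n : ℕ) : Type := EuclideanSpace ℂ (Fin n → ZMod 2)

/-- The Pauli operator `X(a) Z(b)` for `u = (a, b)`: it sends the basis state `|x⟩` to
`(-1) ^ (b · x) |x + a⟩`. It acts non-trivially on exactly `sympWeight u` qubits. -/
noncomputable def pauli {n : ℕ} (u : BinVec n) : Qubits n →ₗ[ℂ] Qubits n where
  toFun ψ := WithLp.toLp 2 fun x =>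
    (-1 : ℂ) ^ (∑ i, u.2 i * (x i - u.1 i)).val * ψ (x - u.1)
  map_add' φ ψ := by
    ext x
    simp [mul_add]
  map_smul' c ψ := by
    ext x
    simp [mul_left_comm]

/-- The code `Q` detects the error `E`. -/
def Detects {n : ℕ} (Q : Submodule ℂ (Qubits n)) (E : Qubits n →ₗ[ℂ] Qubits n) : Prop :=
  ∃ c : ℂ, ∀ φ ∈ Q, ∀ ψ ∈ Q, inner ℂ φ (E ψ) = c * inner ℂ φ ψ

/-- `Q` is an `[[n, k, d]]` quantum code: its dimension is `2 ^ k`, and `d` is exactly the least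
weight of a Pauli error that it does not detect. -/
def IsQuantumCode {n : ℕ} (Q : Submodule ℂ (Qubits n)) (k d : ℕ) : Prop :=
  Module.finrank ℂ Q = 2 ^ k ∧
    IsLeast {w | ∃ u : BinVec n, sympWeight u = w ∧ ¬ Detects Q (pauli u)} d

/-- Purity of a quantum code of minimum distance `d`: every non-identity Pauli error of weight
less than `d` maps the code into its orthogonal complement. -/
def IsPure {n : ℕ} (Q : Submodule ℂ (Qubits n)) (d : ℕ) : Prop :=
  ∀ u : BinVec n, u ≠ 0 → sympWeight u < d → ∀ φ ∈ Q, ∀ ψ ∈ Q, inner ℂ φ (pauli u ψ) = 0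

/-- `Q` is a stabilizer code of the symplectic dual-containing code `C`: a joint eigenspace of the
Pauli operators that belong to the symplectic dual of `C`. -/
def IsStabilizerCode {n : ℕ} (C : Submodule (ZMod 2) (BinVec n))
    (Q : Submodule ℂ (Qubits n)) : Prop :=
  ∃ χ : BinVec n → ℂ, ∀ ψ : Qubits n,
    ψ ∈ Q ↔ ∀ u ∈ sympDual C, pauli u ψ = χ u • ψ

/-- `g₁, g₂, v` satisfy the conditions of the construction and lead to a pure `[[n, k, d]]` quantum
code, where `d` is larger than `d₀`, (an upper bound for) the distance recorded for length `n` and dimension `k`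
in the code table of Grassl at the time (an external datum, given as a number). The list `W` contains pairs
`(j, A)` with `A` the number of vectors of weight `j` in the weight distribution; the coefficients
of `z, ..., z ^ (d - 1)` in it vanish. -/
structure YieldsCode (n k d d₀ : ℕ) (g₁ g₂ v : (ZMod 2)[X]) (W : List (ℕ × ℕ)) : Prop where
  conditions : Conditions n g₁ g₂ v
  degrees : k + g₁.natDegree + g₂.natDegree = n
  finrank_code : Module.finrank (ZMod 2) (qcCode n g₁ g₂ v) = n + k
  dual_containing : sympDual (qcCode n g₁ g₂ v) ≤ qcCode n g₁ g₂ v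
  min_weight : IsLeast {w | ∃ u ∈ qcCode n g₁ g₂ v, u ≠ 0 ∧ sympWeight u = w} d
  quantum_code : ∃ Q : Submodule ℂ (Qubits n),
    IsStabilizerCode (qcCode n g₁ g₂ v) Q ∧ IsQuantumCode Q k d ∧ IsPure Q d
  weight_zero : weightDist (qcCode n g₁ g₂ v) 0 = 1
  weight_small : ∀ j, 0 < j → j < d → weightDist (qcCode n g₁ g₂ v) j = 0
  weights : ∀ p ∈ W, weightDist (qcCode n g₁ g₂ v) p.1 = p.2
  exceeds : d₀ < d

end QuantumQC

open QuantumQC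

namespace QuantumQC

/-! ### Bit-sliced counting

A list of natural numbers `[p₀, p₁, ...]` is read as a family of counters: the counter with index
`x` has the binary digits `p₀.testBit x, p₁.testBit x, ...`. Adding two such families takes a few
bitwise operations on large numbers. The functions below are written with the operations that the
kernel evaluates natively. -/

/-! For a code C containing its symplectic dual D, the quantum code inherits its parameters from C.
The Pauli operators of D commute, so they have a common eigenvector; averaging them against the
eigenvalues projects onto the joint eigenspace Q. Non-identity Pauli operators have trace zero,
whence dim Q = 2^n / |D| = 2^k. An operator outside C anticommutes with some operator of D and maps
Q into its orthogonal complement; one in C but not in D preserves Q and is not scalar on it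
(`exists_quantumCode`). What remains is the dimension, the dual and the weights of one binary code.

C is too large to enumerate, but D has 2^(n-k) elements, at most 2^31 here, and the MacWilliams
identity (`macWilliams`, `card_mul_weightCard_sympDual`) turns the weights of D into those of C. D
is not derived from the divisibility conditions but certified. Two words are given whose shifts lie
in C, are orthogonal to C and provide n - k independent vectors; conversely `le_finrank_qcCode`
gives dim C ≥ n + k, because v^2 - 1 = (v - 1)^2 is invertible modulo x^n - 1. So the words span D
(`DualCert.sympDual_eq`).

D is thus a direct sum of two cyclic modules. The shift preserves weights and permutes the cosets of
the first summand, so one coset per shift orbit on the second summand is enough (`fiberCount_mulX`,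
`sum_of_coversOrbits`). The words of a coset, at most 2^23 of them, are treated simultaneously: a
number with 2^t binary digits stores one digit for each of 2^t words (`weightCount_eq`). The listed
counts are used as lower bounds, and since they add up to |D| they are exact
(`ShiftBasis.card_words_eq`).

The algebraic conditions are identities between binary polynomials, tested on numbers. A defining
set is found by exhibiting deg g roots of g as a union of Frobenius orbits (`definingSet_eq`). -/

def bit (u i : ℕ) : Bool := Nat.beq (Nat.land (Nat.shiftRight u i) 1) 1

def ones (k : ℕ) : ℕ := Nat.sub (Nat.pow 2 k) 1

/-- The sum of the words `r` in the list whose position, counted from the end, is a binary digit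
`1` of `x`. -/
def comb (x : ℕ) : List ℕ → ℕ
  | [] => 0
  | r :: rs => cond (bit x rs.length) (Nat.xor r (comb x rs)) (comb x rs)

/-- The number whose binary digit at `x` is the digit at `i` of `comb x rows`. -/
def plane (i : ℕ) : List ℕ → ℕ
  | [] => 0
  | r :: rs => cond (bit r i)
      (Nat.lor (plane i rs)
        (Nat.shiftLeft (Nat.xor (plane i rs) (ones (Nat.pow 2 rs.length))) (Nat.pow 2 rs.length)))
      (Nat.lor (plane i rs) (Nat.shiftLeft (plane i rs) (Nat.pow 2 rs.length)))

/-- Ripple-carry addition of two families of counters and a family of single digits. -/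
def addPlanes : List ℕ → List ℕ → ℕ → List ℕ
  | a :: as, b :: bs, c => Nat.xor (Nat.xor a b) c ::
      addPlanes as bs (Nat.lor (Nat.land a b) (Nat.land c (Nat.xor a b)))
  | _, _, c => [c]

/-- The counters, with `k` digits, for the sum of the first `2 ^ k - 1` numbers in the list, each
one read as a family of single digits, together with the rest of the list. -/
def sumTree : ℕ → List ℕ → List ℕ × List ℕ
  | 0, ps => ([], ps)
  | k + 1, ps =>
    (addPlanes (sumTree k ps).1 (sumTree k (sumTree k ps).2).1
      ((sumTree k (sumTree k ps).2).2.headD 0), (sumTree k (sumTree k ps).2).2.tail)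

/-- Complementing a table against `full` adds a digit of the fixed coset representative to all words
at once; the union of the two tables is the symplectic support at one position. -/
def quad (full X Z : ℕ) (a b : Bool) : ℕ :=
  cond a (cond b (Nat.lor (Nat.xor X full) (Nat.xor Z full)) (Nat.lor (Nat.xor X full) Z))
    (cond b (Nat.lor X (Nat.xor Z full)) (Nat.lor X Z))

/-- For each position `j < i`, the number whose binary digit at `x` tells whether the position
lies in the symplectic support of the sum of `h` and `comb x rows`. -/
def suppPlanes (n full : ℕ) (rows : List ℕ) (h : ℕ) : ℕ → List ℕ
  | 0 => []
  | i + 1 => quad full (plane i rows) (plane (Nat.add n i) rows) (bit h i) (bit h (Nat.add n i)) ::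
      suppPlanes n full rows h i

/-- The indices, among those in the mask `m`, at which the counter has the value `w`. -/
def indic (full : ℕ) : List ℕ → ℕ → ℕ → ℕ
  | [], _, m => m
  | p :: ps, w, m => cond (bit w 0) (indic full ps (Nat.shiftRight w 1) (Nat.land m p))
      (indic full ps (Nat.shiftRight w 1) (Nat.land m (Nat.xor p full)))

/-- The sums of the pairs of adjacent blocks of `w` binary digits of `x`, as a number with blocks
of `2 w` digits; `full` is a number of even blocks all of whose digits are `1`. -/
def foldBlocks (full w x : ℕ) : ℕ :=
  Nat.add (Nat.land x (Nat.div full (Nat.add (Nat.pow 2 w) 1)))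
    (Nat.land (Nat.shiftRight x w) (Nat.div full (Nat.add (Nat.pow 2 w) 1)))

/-- The number of binary digits `1` of `x`, a number with at most `2 ^ t` digits. -/
def popCount (t x : ℕ) : ℕ :=
  Nat.mod (foldBlocks (ones (Nat.pow 2 t)) 16 (foldBlocks (ones (Nat.pow 2 t)) 8
    (foldBlocks (ones (Nat.pow 2 t)) 4 (foldBlocks (ones (Nat.pow 2 t)) 2
      (foldBlocks (ones (Nat.pow 2 t)) 1 x))))) 4294967295

/-- The sum of the first `2 ^ t` counters. -/
def total (t : ℕ) : List ℕ → ℕ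
  | [] => 0
  | p :: ps => Nat.add (popCount t p) (Nat.mul 2 (total t ps))

/-- The number of words of symplectic weight `w` in the cosets, with representatives `hs`, of the
code spanned by the `t` words `rows`. -/
def weightCount (n t : ℕ) (rows hs : List ℕ) (w : ℕ) : ℕ :=
  total t (sumTree 7 (hs.map fun h => indic (ones (Nat.pow 2 t))
    (sumTree 7 (suppPlanes n (ones (Nat.pow 2 t)) rows h n)).1 w (ones (Nat.pow 2 t)))).1

/-! ### Correctness of the bit-sliced operations. -/

lemma bit_eq (u i : ℕ) : bit u i = u.testBit i := by
  rw [Nat.testBit_eq_decide_div_mod_eq, bit, Bool.eq_iff_iff, Nat.beq_eq, decide_eq_true_iff]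
  change (u >>> i) &&& 1 = 1 ↔ _
  rw [Nat.and_one_is_mod, Nat.shiftRight_eq_div_pow]

lemma ones_eq (k : ℕ) : ones k = 2 ^ k - 1 := rfl

lemma testBit_ones (k x : ℕ) : (ones k).testBit x = decide (x < k) := by
  rw [ones_eq, Nat.testBit_two_pow_sub_one]

lemma land_eq (a b : ℕ) : Nat.land a b = a &&& b := rfl
lemma lor_eq (a b : ℕ) : Nat.lor a b = a ||| b := rfl
lemma xor_eq (a b : ℕ) : Nat.xor a b = a ^^^ b := rfl
lemma shiftRight_eq (a b : ℕ) : Nat.shiftRight a b = a >>> b := rfl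
lemma shiftLeft_eq (a b : ℕ) : Nat.shiftLeft a b = a <<< b := rfl
lemma pow_eq (a b : ℕ) : Nat.pow a b = a ^ b := rfl

/-- The value of the counter with index `x`. -/
def counter : List ℕ → ℕ → ℕ
  | [], _ => 0
  | p :: ps, x => (p.testBit x).toNat + 2 * counter ps x

lemma comb_xor (x y : ℕ) (rows : List ℕ) : comb (x ^^^ y) rows = comb x rows ^^^ comb y rows := by
  induction rows with
  | nil => simp [comb]
  | cons r rs ih =>
    simp only [comb, bit_eq, Nat.testBit_xor, xor_eq]
    cases x.testBit rs.length <;> cases y.testBit rs.length <;>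
      simp [ih, Nat.xor_assoc, Nat.xor_left_comm r]

/-- Keeps a table disjoint from the shifted copy that forms the upper half of the next table, so
that `lor` acts as concatenation. -/
lemma plane_lt (i : ℕ) (rows : List ℕ) : plane i rows < 2 ^ 2 ^ rows.length := by
  induction rows with
  | nil => simp [plane]
  | cons r rs ih =>
    have h : 2 ^ (r :: rs).length = 2 ^ rs.length + 2 ^ rs.length := by
      simp [pow_succ, mul_two]
    have h1 : ∀ a < 2 ^ 2 ^ rs.length,
        plane i rs ||| a <<< 2 ^ rs.length < 2 ^ 2 ^ (r :: rs).length := by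
      intro a ha
      rw [h]
      refine Nat.or_lt_two_pow (ih.trans_le (Nat.pow_le_pow_right two_pos (Nat.le_add_left _ _))) ?_
      rw [Nat.shiftLeft_eq, pow_add]
      exact Nat.mul_lt_mul_of_pos_right ha (by positivity)
    simp only [plane]
    cases bit r i
    · exact h1 _ ih
    · refine h1 _ (Nat.xor_lt_two_pow ih ?_)
      rw [ones_eq]
      exact Nat.sub_lt (by positivity) one_pos

/-- The head row belongs to the top digit of the index. So the table for `r :: rs` is the table for
`rs` followed by a copy of itself, complemented if `r` has the digit `i`. -/
lemma testBit_plane (i : ℕ) (rows : List ℕ) (x : ℕ) (hx : x < 2 ^ rows.length) :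
    (plane i rows).testBit x = (comb x rows).testBit i := by
  induction rows generalizing x with
  | nil => simp [plane, comb]
  | cons r rs ih =>
    have hlt := plane_lt i rs
    have hbig : ∀ y, 2 ^ rs.length ≤ y → (plane i rs).testBit y = false := fun y hy =>
      Nat.testBit_lt_two_pow (hlt.trans_le (Nat.pow_le_pow_right two_pos hy))
    rw [List.length_cons, pow_succ] at hx
    by_cases hx' : x < 2 ^ rs.length
    · have hbx : bit x rs.length = false := by rw [bit_eq, Nat.testBit_lt_two_pow hx']
      simp only [plane, comb, hbx, cond_false]
      cases bit r i <;>
        simp [Nat.testBit_or, Nat.testBit_shiftLeft, not_le.2 hx',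
          ih x hx']
    · push Not at hx'
      obtain ⟨y, rfl⟩ := Nat.exists_eq_add_of_le hx'
      have hy : y < 2 ^ rs.length := by omega
      have hbx : bit (2 ^ rs.length + y) rs.length = true := by
        rw [bit_eq, Nat.testBit_two_pow_add_eq, Nat.testBit_lt_two_pow hy]; rfl
      have hc : comb (2 ^ rs.length + y) rs = comb y rs := by
        -- A list no longer than `rs` reads only digits below `rs.length`. Quantifying over such
        -- lists keeps the exponent fixed during the induction.
        have : ∀ l : List ℕ, l.length ≤ rs.length → comb (2 ^ rs.length + y) l = comb y l := by
          intro l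
          induction l with
          | nil => simp [comb]
          | cons a l ihl =>
            intro hl
            rw [List.length_cons] at hl
            simp only [comb, bit_eq, Nat.testBit_two_pow_add_gt (show l.length < rs.length from hl),
              ihl (by omega)]
        exact this rs le_rfl
      simp only [plane, comb, hbx, cond_true, hc]
      have h2 := hbig _ (Nat.le_add_right (2 ^ rs.length) y)
      rw [bit_eq]
      cases hr : r.testBit i <;>
        simp [Nat.testBit_or, Nat.testBit_shiftLeft,
          Nat.testBit_xor, h2, hr, ih y hy, testBit_ones, hy]

/-- At each index this is a full adder, with carry ab ∨ c(a ⊕ b). The lengths must agree because the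
recursion drops the rest of the longer list. -/
lemma counter_addPlanes (as bs : List ℕ) (h : as.length = bs.length) (c x : ℕ) :
    counter (addPlanes as bs c) x = counter as x + counter bs x + (c.testBit x).toNat := by
  induction as generalizing bs c with
  | nil =>
    obtain rfl := List.eq_nil_of_length_eq_zero h.symm
    simp [addPlanes, counter]
  | cons a as ih =>
    obtain _ | ⟨b, bs⟩ := bs
    · simp at h
    simp only [addPlanes, counter, ih bs (by simpa using h), land_eq, lor_eq, xor_eq,
      Nat.testBit_or, Nat.testBit_and, Nat.testBit_xor]
    cases a.testBit x <;> cases b.testBit x <;> cases c.testBit x <;> simp <;> ring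

lemma length_addPlanes (as bs : List ℕ) (h : as.length = bs.length) (c : ℕ) :
    (addPlanes as bs c).length = as.length + 1 := by
  induction as generalizing bs c with
  | nil => simp [addPlanes]
  | cons a as ih =>
    obtain _ | ⟨b, bs⟩ := bs
    · simp at h
    simp only [addPlanes, List.length_cons, ih bs (by simpa using h)]

lemma length_sumTree_fst (k : ℕ) (ps : List ℕ) : (sumTree k ps).1.length = k := by
  induction k generalizing ps with
  | zero => rfl
  | succ k ih => rw [sumTree, length_addPlanes _ _ (by rw [ih, ih]), ih]

lemma length_sumTree_snd (k : ℕ) (ps : List ℕ) :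
    (sumTree k ps).2.length = ps.length - (2 ^ k - 1) := by
  induction k generalizing ps with
  | zero => rfl
  | succ k ih =>
    simp only [sumTree, List.length_tail, ih]
    have := Nat.one_le_two_pow (n := k)
    rw [pow_succ]
    omega

/-- Two subtrees absorb 2^k - 1 words each and one more word enters as the incoming carry, in all
2^(k+1) - 1, the capacity of k + 1 digits. Keeping the unused words in the balance makes the
identity valid for lists of any length; a missing carry word counts as 0. -/
lemma counter_sumTree_add (k : ℕ) (ps : List ℕ) (x : ℕ) :
    counter (sumTree k ps).1 x + ((sumTree k ps).2.map fun p => (p.testBit x).toNat).sum =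
      (ps.map fun p => (p.testBit x).toNat).sum := by
  induction k generalizing ps with
  | zero => simp [sumTree, counter]
  | succ k ih =>
    have h1 := ih ps
    have h2 := ih (sumTree k ps).2
    simp only [sumTree]
    rw [counter_addPlanes _ _ (by simp only [length_sumTree_fst])]
    have h3 : ∀ l : List ℕ, ((l.headD 0).testBit x).toNat +
        (l.tail.map fun p => (p.testBit x).toNat).sum =
        (l.map fun p => (p.testBit x).toNat).sum := by
      intro l; cases l <;> simp
    have h4 := h3 (sumTree k (sumTree k ps).2).2
    omega

lemma counter_sumTree (k : ℕ) (ps : List ℕ) (h : ps.length < 2 ^ k) (x : ℕ) :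
    counter (sumTree k ps).1 x = (ps.map fun p => (p.testBit x).toNat).sum := by
  rw [← counter_sumTree_add k ps x, List.eq_nil_of_length_eq_zero (l := (sumTree k ps).2)]
  · simp
  · rw [length_sumTree_snd]; omega

/-- The symplectic weight of a word of length `2 n`, given as a binary number. -/
def natWeight (n u : ℕ) : ℕ :=
  ∑ i ∈ Finset.range n, (u.testBit i || u.testBit (n + i)).toNat

lemma testBit_quad (N X Z : ℕ) (a b : Bool) (x : ℕ) (hx : x < N) :
    (quad (ones N) X Z a b).testBit x = ((a ^^ X.testBit x) || (b ^^ Z.testBit x)) := by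
  cases a <;> cases b <;> simp [quad, testBit_ones, hx]

lemma sum_suppPlanes (n : ℕ) (rows : List ℕ) (h i x : ℕ) (hx : x < 2 ^ rows.length) :
    ((suppPlanes n (ones (2 ^ rows.length)) rows h i).map fun p => (p.testBit x).toNat).sum =
      ∑ j ∈ Finset.range i, ((h ^^^ comb x rows).testBit j ||
        (h ^^^ comb x rows).testBit (n + j)).toNat := by
  induction i with
  | zero => simp [suppPlanes]
  | succ i ih =>
    rw [suppPlanes, List.map_cons, List.sum_cons, ih, Finset.sum_range_succ, add_comm,
      testBit_quad _ _ _ _ _ _ hx, testBit_plane _ _ _ hx, testBit_plane _ _ _ hx, bit_eq, bit_eq,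
      Nat.testBit_xor, Nat.testBit_xor]
    rfl

lemma length_suppPlanes (n full : ℕ) (rows : List ℕ) (h i : ℕ) :
    (suppPlanes n full rows h i).length = i := by
  induction i with
  | zero => rfl
  | succ i ih => rw [suppPlanes, List.length_cons, ih]

/-- The comparison runs from the lowest digit upwards. Digits of `w` beyond the end of the list are
never read, which is why `w` has to be bounded. -/
lemma testBit_indic (N : ℕ) (ps : List ℕ) (w m x : ℕ) (hx : x < N) (hw : w < 2 ^ ps.length) :
    (indic (ones N) ps w m).testBit x = (m.testBit x && decide (counter ps x = w)) := by
  induction ps generalizing w m with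
  | nil =>
    obtain rfl : w = 0 := by simpa using hw
    simp [indic, counter]
  | cons p ps ih =>
    have e : w >>> 1 = w / 2 := Nat.shiftRight_eq_div_pow w 1
    have hw' : w / 2 < 2 ^ ps.length := by
      rw [List.length_cons, pow_succ] at hw
      omega
    by_cases h : w % 2 = 1
    · have hb : bit w 0 = true := by simp [bit_eq, Nat.testBit_zero, h]
      simp only [indic, hb, cond_true, shiftRight_eq, land_eq, e, ih _ _ hw', counter,
        Nat.testBit_and]
      obtain hp | hp := Bool.eq_false_or_eq_true (p.testBit x) <;>
        rw [Bool.eq_iff_iff] <;> simp [hp] <;> intro <;> omega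
    · have hb : bit w 0 = false := by simp [bit_eq, Nat.testBit_zero, h]
      simp only [indic, hb, cond_false, shiftRight_eq, land_eq, xor_eq, e, ih _ _ hw', counter,
        Nat.testBit_and, Nat.testBit_xor, testBit_ones, hx]
      obtain hp | hp := Bool.eq_false_or_eq_true (p.testBit x) <;>
        rw [Bool.eq_iff_iff] <;> simp [hp] <;> intro <;> omega

/-- The sum of the first `m` digits of `x` in base `b`. -/
def digitSum (b : ℕ) : ℕ → ℕ → ℕ
  | 0, _ => 0
  | m + 1, x => x % b + digitSum b m (x / b)

/-- Since 2^(2w) - 1 = (2^w - 1)(2^w + 1), this quotient is the mask that selects the lower half of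
every block of 2w digits; the recursion splits off the lowest block. -/
lemma ones_div (w m : ℕ) : ones (2 * w * (m + 1)) / (2 ^ w + 1) =
    (2 ^ w - 1) + 2 ^ (2 * w) * (ones (2 * w * m) / (2 ^ w + 1)) := by
  have h1 : ∀ m, 2 ^ w + 1 ∣ ones (2 * w * m) := by
    intro m
    rw [ones_eq, pow_mul, pow_mul' _ 2]
    have h2 : 2 ^ w + 1 ∣ (2 ^ w) ^ 2 - 1 := ⟨2 ^ w - 1, by rw [← Nat.sq_sub_sq]⟩
    exact h2.trans (by simpa using Nat.sub_dvd_pow_sub_pow ((2 ^ w) ^ 2) 1 m)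
  obtain ⟨c, hc⟩ := h1 m
  have hpos : 0 < 2 ^ w + 1 := by positivity
  rw [hc, Nat.mul_div_cancel_left _ hpos]
  refine Nat.div_eq_of_eq_mul_right hpos ?_
  obtain ⟨b, hb⟩ : ∃ b, 2 ^ w = b + 1 := ⟨2 ^ w - 1, by have := Nat.two_pow_pos w; omega⟩
  have h3 : 2 ^ (2 * w * m) = (2 ^ w + 1) * c + 1 := by
    rw [← hc, ones_eq, Nat.sub_add_cancel Nat.one_le_two_pow]
  rw [ones_eq, mul_add, mul_one, pow_add, h3, pow_mul' 2 2 w, hb]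
  refine Nat.sub_eq_of_eq_add ?_
  rw [Nat.add_sub_cancel]
  ring

/-- One folding step doubles the block width without changing the sum of the blocks. -/
lemma foldBlocks_spec {w : ℕ} (hw : 0 < w) (m x : ℕ) :
    foldBlocks (ones (2 * w * m)) w x < 2 ^ (2 * w * m) ∧
      digitSum (2 ^ (2 * w)) m (foldBlocks (ones (2 * w * m)) w x) =
        digitSum (2 ^ w) (2 * m) x := by
  have hdef : ∀ f x, foldBlocks f w x = (x &&& f / (2 ^ w + 1)) + (x >>> w &&& f / (2 ^ w + 1)) :=
    fun _ _ => rfl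
  induction m generalizing x with
  | zero => simp [hdef, ones_eq, digitSum]
  | succ m ih =>
    set M := ones (2 * w * m) / (2 ^ w + 1) with hM
    have hB : 2 ^ (2 * w) = 2 ^ w * 2 ^ w := by rw [two_mul, pow_add]
    have hw2 : 2 ≤ 2 ^ w := by simpa using Nat.pow_le_pow_right two_pos hw
    have hland : ∀ y, y &&& (2 ^ w - 1 + 2 ^ (2 * w) * M) =
        y % 2 ^ w + 2 ^ (2 * w) * (y / 2 ^ (2 * w) &&& M) := by
      intro y
      have hlt : 2 ^ w - 1 < 2 ^ (2 * w) :=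
        (Nat.sub_lt (by omega) one_pos).trans_le (Nat.pow_le_pow_right two_pos (by omega))
      rw [← Nat.mod_add_div (y &&& _) (2 ^ (2 * w)), Nat.and_mod_two_pow, Nat.and_div_two_pow,
        Nat.add_mul_mod_self_left, Nat.add_mul_div_left _ _ (by positivity), Nat.div_eq_of_lt hlt,
        zero_add, Nat.mod_eq_of_lt hlt, Nat.and_two_pow_sub_one_eq_mod,
        Nat.mod_mod_of_dvd _ (Dvd.intro _ hB.symm)]
    have hfold : foldBlocks (ones (2 * w * (m + 1))) w x = (x % 2 ^ w + x / 2 ^ w % 2 ^ w) +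
        2 ^ (2 * w) * foldBlocks (ones (2 * w * m)) w (x / 2 ^ (2 * w)) := by
      rw [hdef, hdef, ones_div, ← hM, hland, hland, Nat.shiftRight_eq_div_pow,
        Nat.shiftRight_eq_div_pow, Nat.div_div_eq_div_mul, Nat.div_div_eq_div_mul,
        mul_comm (2 ^ w) (2 ^ (2 * w))]
      ring
    -- No overflow into the next block: the sum of two numbers below 2^w is below 2^(2w), as w > 0.
    have hr : x % 2 ^ w + x / 2 ^ w % 2 ^ w < 2 ^ (2 * w) := by
      have h1 := Nat.mod_lt x (Nat.two_pow_pos w)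
      have h2 := Nat.mod_lt (x / 2 ^ w) (Nat.two_pow_pos w)
      rw [hB]; nlinarith
    obtain ⟨ih1, ih2⟩ := ih (x / 2 ^ (2 * w))
    refine ⟨?_, ?_⟩
    · rw [hfold, mul_add, mul_one, pow_add, mul_comm (2 ^ (2 * w * m))]
      calc _ < 2 ^ (2 * w) + 2 ^ (2 * w) * foldBlocks (ones (2 * w * m)) w (x / 2 ^ (2 * w)) := by
            omega
        _ = 2 ^ (2 * w) * (foldBlocks (ones (2 * w * m)) w (x / 2 ^ (2 * w)) + 1) := by ring
        _ ≤ _ := Nat.mul_le_mul_left _ ih1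
    · rw [digitSum, hfold, Nat.add_mul_mod_self_left, Nat.mod_eq_of_lt hr,
        Nat.add_mul_div_left _ _ (by positivity), Nat.div_eq_of_lt hr, zero_add, ih2,
        mul_add, mul_one, digitSum, digitSum, Nat.div_div_eq_div_mul, ← hB, add_assoc]

/-- Casting out nines in base b + 1, which is congruent to 1 modulo b. -/
lemma mod_pred_eq_digitSum_mod (b m x : ℕ) (hx : x < (b + 1) ^ m) :
    x % b = digitSum (b + 1) m x % b := by
  induction m generalizing x with
  | zero =>
    obtain rfl : x = 0 := by simpa using hx
    rfl
  | succ m ih =>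
    have h1 : x / (b + 1) < (b + 1) ^ m := Nat.div_lt_of_lt_mul (by rwa [pow_succ'] at hx)
    rw [digitSum, Nat.add_mod, ← ih _ h1, ← Nat.add_mod]
    conv_lhs => rw [← Nat.mod_add_div x (b + 1), add_mul, one_mul]
    rw [← add_assoc, Nat.add_right_comm, Nat.add_mul_mod_self_left]

lemma digitSum_two (m x : ℕ) :
    digitSum 2 m x = ∑ i ∈ Finset.range m, (x.testBit i).toNat := by
  induction m generalizing x with
  | zero => rfl
  | succ m ih =>
    rw [digitSum, ih, Finset.sum_range_succ', add_comm]
    congr 1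
    · exact Finset.sum_congr rfl fun i _ => by rw [Nat.testBit_succ]
    · rw [Nat.testBit_zero]
      rcases Nat.mod_two_eq_zero_or_one x with h | h <;> simp [h]

/-- Five foldings lead to blocks of 32 digits, which fit into 2^t digits as t ≥ 5. The residue
modulo 4294967295 = 2^32 - 1 is then the sum of the blocks, and t < 32 keeps that sum below the
modulus. -/
lemma popCount_eq {t : ℕ} (ht : 5 ≤ t) (ht' : t < 32) (x : ℕ) :
    popCount t x = ∑ i ∈ Finset.range (2 ^ t), (x.testBit i).toNat := by
  obtain ⟨s, rfl⟩ := Nat.exists_eq_add_of_le ht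
  have h1 := foldBlocks_spec (w := 1) one_pos (16 * 2 ^ s) x
  set x₁ := foldBlocks (ones (2 * 1 * (16 * 2 ^ s))) 1 x with hx₁
  have h2 := foldBlocks_spec (w := 2) two_pos (8 * 2 ^ s) x₁
  set x₂ := foldBlocks (ones (2 * 2 * (8 * 2 ^ s))) 2 x₁ with hx₂
  have h3 := foldBlocks_spec (w := 4) four_pos (4 * 2 ^ s) x₂
  set x₃ := foldBlocks (ones (2 * 4 * (4 * 2 ^ s))) 4 x₂ with hx₃
  have h4 := foldBlocks_spec (w := 8) (by omega) (2 * 2 ^ s) x₃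
  set x₄ := foldBlocks (ones (2 * 8 * (2 * 2 ^ s))) 8 x₃ with hx₄
  have h5 := foldBlocks_spec (w := 16) (by omega) (2 ^ s) x₄
  set x₅ := foldBlocks (ones (2 * 16 * 2 ^ s)) 16 x₄ with hx₅
  have hpop : popCount (5 + s) x = x₅ % 4294967295 := by
    have e : 2 ^ (5 + s) = 32 * 2 ^ s := by rw [pow_add]; norm_num
    change foldBlocks (ones (2 ^ (5 + s))) 16 (foldBlocks (ones (2 ^ (5 + s))) 8
      (foldBlocks (ones (2 ^ (5 + s))) 4 (foldBlocks (ones (2 ^ (5 + s))) 2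
        (foldBlocks (ones (2 ^ (5 + s))) 1 x)))) % 4294967295 = _
    rw [hx₅, hx₄, hx₃, hx₂, hx₁, e]
    norm_num [← mul_assoc]
  have hsum : digitSum (4294967295 + 1) (2 ^ s) x₅ =
      ∑ i ∈ Finset.range (2 ^ (5 + s)), (x.testBit i).toNat := by
    have e1 := h5.2
    have e2 := h4.2
    have e3 := h3.2
    have e4 := h2.2
    have e5 := h1.2
    norm_num [← mul_assoc] at e1 e2 e3 e4 e5
    rw [show 4294967295 + 1 = 4294967296 from rfl, e1, e2, e3, e4, e5, digitSum_two, pow_add]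
    norm_num
  have hlt : x₅ < (4294967295 + 1) ^ 2 ^ s := by
    have := h5.1
    rwa [pow_mul, show 2 ^ (2 * 16) = 4294967295 + 1 by norm_num] at this
  rw [hpop, mod_pred_eq_digitSum_mod _ _ _ hlt, hsum, Nat.mod_eq_of_lt]
  calc _ ≤ ∑ i ∈ Finset.range (2 ^ (5 + s)), 1 := Finset.sum_le_sum fun i _ => Bool.toNat_le _
    _ = 2 ^ (5 + s) := by simp
    _ ≤ 2 ^ 31 := Nat.pow_le_pow_right two_pos (by omega)
    _ < _ := by norm_num

lemma total_eq {t : ℕ} (ht : 5 ≤ t) (ht' : t < 32) (ps : List ℕ) :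
    total t ps = ∑ x ∈ Finset.range (2 ^ t), counter ps x := by
  induction ps with
  | nil => simp [total, counter]
  | cons p ps ih =>
    simp only [counter, Finset.sum_add_distrib, ← Finset.mul_sum, ← ih, ← popCount_eq ht ht']
    rfl

/-- The number of words of weight `w` in the coset of `h` modulo the code spanned by `rows`. -/
def cosetCount (n : ℕ) (rows : List ℕ) (w h : ℕ) : ℕ :=
  ((Finset.range (2 ^ rows.length)).filter fun x => natWeight n (h ^^^ comb x rows) = w).card

/-- Two layers of counters: the inner one adds, for a fixed coset, the support digits over the n
positions; the outer one adds the resulting indicator tables over the cosets. Each has 7 digits,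
which explains the bounds by 128. -/
theorem weightCount_eq (n t : ℕ) (rows hs : List ℕ) (w : ℕ) (ht : rows.length = t)
    (ht₅ : 5 ≤ t) (ht₃₂ : t < 32)
    (hn : n < 128) (hhs : hs.length < 128) (hw : w < 128) :
    weightCount n t rows hs w = (hs.map (cosetCount n rows w)).sum := by
  subst ht
  rw [weightCount, total_eq ht₅ ht₃₂]
  have key : ∀ h, ∀ x ∈ Finset.range (2 ^ rows.length),
      (indic (ones (2 ^ rows.length))
        (sumTree 7 (suppPlanes n (ones (2 ^ rows.length)) rows h n)).1 w
        (ones (2 ^ rows.length))).testBit x = decide (natWeight n (h ^^^ comb x rows) = w) := by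
    intro h x hx
    have hx := Finset.mem_range.1 hx
    rw [testBit_indic _ _ _ _ _ hx (by rw [length_sumTree_fst]; exact hw),
      counter_sumTree 7 _ (by rw [length_suppPlanes]; exact hn), sum_suppPlanes _ _ _ _ _ hx,
      testBit_ones]
    simp [hx, natWeight]
  rw [Finset.sum_congr rfl fun x _ => counter_sumTree 7 _ (by simpa using hhs) x]
  simp only [pow_eq, List.map_map]
  clear hhs
  induction hs with
  | nil => simp
  | cons h hs ih =>
    simp only [List.map_cons, List.sum_cons, Finset.sum_add_distrib, ih, cosetCount,
      Finset.card_filter]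
    congr 1
    refine Finset.sum_congr rfl fun x hx => ?_
    simp only [Function.comp_apply, key h x hx]
    split_ifs <;> simp_all

end QuantumQC

namespace QuantumQC

/-! ### Cyclic shifts of binary words of length `2 n` -/

def rotHalf (n u : ℕ) : ℕ :=
  Nat.lor (Nat.land (Nat.shiftLeft u 1) (ones n)) (Nat.land (Nat.shiftRight u (Nat.sub n 1)) 1)

/-- The simultaneous cyclic shift of the two halves of a word of length `2 n`. -/
def rot (n u : ℕ) : ℕ :=
  Nat.lor (rotHalf n (Nat.land u (ones n))) (Nat.shiftLeft (rotHalf n (Nat.shiftRight u n)) n)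

def rotIter (n u : ℕ) : ℕ → ℕ
  | 0 => u
  | i + 1 => rot n (rotIter n u i)

/-- The first `t` shifts of a word, the last one first. -/
def shifts (n u : ℕ) : ℕ → List ℕ
  | 0 => []
  | t + 1 => rotIter n u t :: shifts n u t

/-- Multiplication by `x` of binary polynomials modulo the polynomial `p` of degree `t`. -/
def mulX (t p x : ℕ) : ℕ :=
  cond (bit x (Nat.sub t 1)) (Nat.xor (Nat.shiftLeft x 1) p) (Nat.shiftLeft x 1)

lemma testBit_rotHalf (n u i : ℕ) (hi : i < n) :
    (rotHalf n u).testBit i = if i = 0 then u.testBit (n - 1) else u.testBit (i - 1) := by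
  simp only [rotHalf, lor_eq, land_eq, shiftLeft_eq, shiftRight_eq, Nat.testBit_or,
    Nat.testBit_and, Nat.testBit_shiftLeft, Nat.testBit_shiftRight, testBit_ones, hi]
  by_cases h : i = 0
  · simp [h]
  · rw [Nat.testBit_lt_two_pow (Nat.one_lt_two_pow h)]
    simp [h, Nat.one_le_iff_ne_zero]

lemma rotHalf_lt (n u : ℕ) (hn : 0 < n) : rotHalf n u < 2 ^ n := by
  refine Nat.or_lt_two_pow (Nat.and_lt_two_pow _ ?_) (Nat.and_lt_two_pow _ ?_)
  · rw [ones_eq]; exact Nat.sub_lt (by positivity) one_pos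
  · exact Nat.one_lt_two_pow hn.ne'

lemma testBit_rot (n u i : ℕ) (hn : 0 < n) :
    (rot n u).testBit i = if i < n then (if i = 0 then u.testBit (n - 1) else u.testBit (i - 1))
      else if i < 2 * n then (if i = n then u.testBit (2 * n - 1) else u.testBit (i - 1))
      else false := by
  simp only [rot, lor_eq, shiftLeft_eq, Nat.testBit_or, Nat.testBit_shiftLeft]
  by_cases h : i < n
  · rw [testBit_rotHalf _ _ _ h]
    simp only [land_eq, Nat.testBit_and, testBit_ones, h, not_le.2 h]
    have h1 : n - 1 < n := by omega
    have h2 : i - 1 < n := by omega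
    simp [h1, h2]
  · have h0 : (rotHalf n (Nat.land u (ones n))).testBit i = false :=
      Nat.testBit_lt_two_pow ((rotHalf_lt n _ hn).trans_le
        (Nat.pow_le_pow_right two_pos (not_lt.1 h)))
    rw [h0]
    simp only [h, if_false, Bool.false_or, not_lt.1 h, decide_true, Bool.true_and]
    by_cases h2 : i < 2 * n
    · rw [testBit_rotHalf _ _ _ (by omega)]
      simp only [shiftRight_eq, Nat.testBit_shiftRight, h2, if_true]
      by_cases h3 : i = n
      · simp [h3]; congr 1; omega
      · have : i - n ≠ 0 := by omega
        simp only [this, h3, if_false]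
        congr 1; omega
    · rw [if_neg h2]
      exact Nat.testBit_lt_two_pow ((rotHalf_lt n _ hn).trans_le
        (Nat.pow_le_pow_right two_pos (by omega)))

lemma rot_lt (n u : ℕ) (hn : 0 < n) : rot n u < 2 ^ (2 * n) := by
  refine Nat.lt_pow_two_of_testBit _ fun i hi => ?_
  rw [testBit_rot _ _ _ hn, if_neg (by omega), if_neg (by omega)]

lemma rot_xor (n u v : ℕ) (hn : 0 < n) : rot n (u ^^^ v) = rot n u ^^^ rot n v := by
  refine Nat.eq_of_testBit_eq fun i => ?_
  simp only [testBit_rot _ _ _ hn, Nat.testBit_xor]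
  split_ifs <;> simp

lemma rot_zero (n : ℕ) (hn : 0 < n) : rot n 0 = 0 := by
  refine Nat.eq_of_testBit_eq fun i => ?_
  simp [testBit_rot _ _ _ hn]

/-- Every digit below 2n can be read off the shifted word at its new position, where n - 1 wraps to
0 and 2n - 1 to n. The bounds exclude the higher digits, which the shift discards. -/
lemma rot_injOn (n : ℕ) (hn : 0 < n) {u v : ℕ} (hu : u < 2 ^ (2 * n)) (hv : v < 2 ^ (2 * n))
    (h : rot n u = rot n v) : u = v := by
  refine Nat.eq_of_testBit_eq fun i => ?_
  by_cases hi : i < 2 * n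
  · have key := fun j => congrArg (fun a => Nat.testBit a j) h
    simp only [testBit_rot _ _ _ hn] at key
    by_cases h1 : i = n - 1
    · simpa [hn, h1] using key 0
    · by_cases h2 : i = 2 * n - 1
      · have := key n
        simpa [hn, h2] using this
      · have := key (i + 1)
        by_cases h3 : i + 1 < n
        · simpa [h3] using this
        · rw [if_neg h3, if_pos (by omega), if_neg (by omega), if_neg h3, if_pos (by omega),
            if_neg (by omega)] at this
          simpa using this
  · have hle : 2 ^ (2 * n) ≤ 2 ^ i := Nat.pow_le_pow_right two_pos (by omega)
    rw [Nat.testBit_lt_two_pow (hu.trans_le hle), Nat.testBit_lt_two_pow (hv.trans_le hle)]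

lemma natWeight_rot (n u : ℕ) (hn : 0 < n) : natWeight n (rot n u) = natWeight n u := by
  obtain ⟨k, rfl⟩ := Nat.exists_eq_add_of_lt hn
  -- Position 0 is split off on the left and the last position on the right; the shift matches the
  -- remaining terms.
  rw [zero_add, natWeight, natWeight, Finset.sum_range_succ', Finset.sum_range_succ]
  simp only [testBit_rot _ _ _ k.succ_pos]
  congr 1
  · refine Finset.sum_congr rfl fun i hi => ?_
    have hi := Finset.mem_range.1 hi
    rw [if_pos (by omega), if_neg (by omega), if_neg (by omega), if_pos (by omega),
      if_neg (by omega), Nat.add_sub_cancel, ← add_assoc, Nat.add_sub_cancel]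
  · simp
    congr 3; omega

lemma length_shifts (n u t : ℕ) : (shifts n u t).length = t := by
  induction t with
  | zero => rfl
  | succ t ih => rw [shifts, List.length_cons, ih]

lemma comb_shifts_succ (n u t x : ℕ) : comb x (shifts n u (t + 1)) =
    (if x.testBit t then rotIter n u t else 0) ^^^ comb x (shifts n u t) := by
  simp only [shifts, comb, length_shifts, bit_eq, xor_eq]
  cases x.testBit t <;> simp

/-- `comb x (shifts n u t)` is the polynomial with the digits of `x`, evaluated at the shift
operator and applied to `u`. Doubling `x` multiplies that polynomial by the variable. -/
lemma comb_shifts_two_mul (n u t x : ℕ) (hn : 0 < n) :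
    comb (x <<< 1) (shifts n u (t + 1)) = rot n (comb x (shifts n u t)) := by
  induction t with
  | zero =>
    rw [comb_shifts_succ]
    simp [shifts, comb, rot_zero n hn]
  | succ t ih =>
    rw [comb_shifts_succ, ih, comb_shifts_succ, rot_xor _ _ _ hn, Nat.testBit_shiftLeft]
    cases h : x.testBit t <;> simp [h, rot_zero n hn, rotIter]

lemma comb_shifts_lt (n u t x : ℕ) (hn : 0 < n) (hu : u < 2 ^ (2 * n)) :
    comb x (shifts n u t) < 2 ^ (2 * n) := by
  induction t with
  | zero => simp [shifts, comb]
  | succ t ih =>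
    rw [comb_shifts_succ]
    refine Nat.xor_lt_two_pow ?_ ih
    split_ifs
    · cases t
      · exact hu
      · exact rot_lt _ _ hn
    · positivity

/-- A digit that is shifted into position t is cancelled by the leading digit of `p`. -/
lemma mulX_lt {t p x : ℕ} (ht : 0 < t) (hp : p.testBit t = true) (hp' : p < 2 ^ (t + 1))
    (hx : x < 2 ^ t) : mulX t p x < 2 ^ t := by
  have hx2 : x <<< 1 < 2 ^ (t + 1) := by
    rw [Nat.shiftLeft_eq, pow_succ]; omega
  have h1 : ∀ a : ℕ, a < 2 ^ (t + 1) → a.testBit t = false → a < 2 ^ t := by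
    intro a ha hb
    refine Nat.lt_pow_two_of_testBit _ fun i hi => ?_
    obtain rfl | hi := hi.eq_or_lt
    · exact hb
    · exact Nat.testBit_lt_two_pow (ha.trans_le (Nat.pow_le_pow_right two_pos hi))
  rw [mulX, bit_eq]
  change (bif x.testBit (t - 1) then x <<< 1 ^^^ p else x <<< 1) < _
  cases h : x.testBit (t - 1)
  · refine h1 _ hx2 ?_
    rw [cond_false, Nat.testBit_shiftLeft, h, Bool.and_false]
  · refine h1 (x <<< 1 ^^^ p) (Nat.xor_lt_two_pow hx2 hp') ?_
    rw [Nat.testBit_xor, hp, Nat.testBit_shiftLeft, h]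
    simpa using Nat.succ_le_of_lt ht

/-- As `p`, evaluated at the shift, annihilates `u`, reduction modulo `p` does not change the word.
The shift is therefore multiplication by x on coordinates. -/
lemma comb_mulX {n u t p x : ℕ} (hn : 0 < n) (ht : 0 < t) (hp : p.testBit t = true)
    (hp' : p < 2 ^ (t + 1)) (h0 : comb p (shifts n u (t + 1)) = 0) (hx : x < 2 ^ t) :
    comb (mulX t p x) (shifts n u t) = rot n (comb x (shifts n u t)) := by
  have h1 : comb (mulX t p x) (shifts n u t) = comb (mulX t p x) (shifts n u (t + 1)) := by
    rw [comb_shifts_succ, Nat.testBit_lt_two_pow (mulX_lt ht hp hp' hx)]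
    simp
  rw [h1, ← comb_shifts_two_mul n u t x hn, mulX]
  cases bit x (t.sub 1)
  · rfl
  · change comb (x <<< 1 ^^^ p) _ = _
    rw [comb_xor, h0, Nat.xor_zero]

/-! ### Independence -/

/-- Gaussian elimination: the highest digit of the first row is the pivot and is cleared in the
other rows. The first argument bounds the number of steps. -/
def indepAux : ℕ → List ℕ → Bool
  | 0, rows => rows.isEmpty
  | _ + 1, [] => true
  | k + 1, r :: rs => cond (Nat.beq r 0) false
      (indepAux k (rs.map fun s => cond (bit s (Nat.log2 r)) (Nat.xor s r) s))

/-- A vanishing combination of the rows gives a vanishing combination, with the same remaining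
coefficients, of the eliminated rows; the induction hypothesis applies to these. -/
lemma comb_eq_zero_of_indepAux (k : ℕ) (rows : List ℕ) (h : indepAux k rows = true) (x : ℕ)
    (hx : x < 2 ^ rows.length) (h0 : comb x rows = 0) : x = 0 := by
  induction k generalizing rows x with
  | zero =>
    obtain rfl : rows = [] := by simpa [indepAux] using h
    simpa using hx
  | succ k ih =>
    obtain _ | ⟨r, rs⟩ := rows
    · simpa using hx
    have hr : r ≠ 0 := by
      rintro rfl; simp [indepAux] at h
    have hbeq : Nat.beq r 0 = false := by
      rw [Bool.eq_false_iff]; simpa using hr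
    simp only [indepAux, hbeq, cond_false] at h
    set b := Nat.log2 r
    have hrb : r.testBit b = true := by
      rw [Nat.testBit_log2]; exact hr
    set f : ℕ → ℕ := fun s => cond (bit s b) (Nat.xor s r) s with hf
    -- Elimination commutes with combining: both a row and a combination are changed by `r` exactly
    -- when they have the pivot digit.
    have hcomb : ∀ l : List ℕ, comb x (l.map f) =
        comb x l ^^^ (if (comb x l).testBit b then r else 0) := by
      intro l
      induction l with
      | nil => simp [comb]
      | cons s l ihl =>
        have hs : f s = cond (s.testBit b) (s ^^^ r) s := by simp only [hf, bit_eq, xor_eq]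
        simp only [List.map_cons, comb, List.length_map, ihl, bit_eq, xor_eq, hs]
        cases x.testBit l.length
        · simp
        · simp only [cond_true, Nat.testBit_xor]
          cases s.testBit b <;> cases (comb x l).testBit b <;>
            simp [Nat.xor_comm r, Nat.xor_assoc]
    have hrs : comb x (rs.map f) = 0 := by
      rw [hcomb]
      simp only [comb, bit_eq, xor_eq] at h0
      cases hxb : x.testBit rs.length
      · rw [hxb, cond_false] at h0
        simp [h0]
      · rw [hxb, cond_true] at h0
        have : comb x rs = r := (Nat.xor_eq_zero_iff.1 h0).symm
        simp [this, hrb]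
    -- If `r` occurred, the induction hypothesis would make all other coefficients zero, and the
    -- combination would be `r` itself.
    have hxb : x.testBit rs.length = false := by
      by_contra hxb
      rw [Bool.not_eq_false] at hxb
      have hlow : comb (x % 2 ^ rs.length) (rs.map f) = comb x (rs.map f) := by
        have : ∀ l : List ℕ, l.length ≤ rs.length →
            comb (x % 2 ^ rs.length) l = comb x l := by
          intro l
          induction l with
          | nil => simp [comb]
          | cons a l ihl =>
            intro hl
            rw [List.length_cons] at hl
            simp only [comb, bit_eq, Nat.testBit_mod_two_pow, ihl (by omega),
              show l.length < rs.length from hl, decide_true, Bool.true_and]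
        exact this _ (by simp)
      have hz := ih (rs.map f) h _ (by
        rw [List.length_map]; exact Nat.mod_lt _ (by positivity)) (hlow.trans hrs)
      have hlow' : comb x rs = 0 := by
        have : ∀ l : List ℕ, l.length ≤ rs.length → comb x l = 0 := by
          intro l
          induction l with
          | nil => simp [comb]
          | cons a l ihl =>
            intro hl
            rw [List.length_cons] at hl
            have hb : x.testBit l.length = false := by
              have := congrArg (fun a => Nat.testBit a l.length) hz
              simpa [Nat.testBit_mod_two_pow, show l.length < rs.length from hl] using this
            simp [comb, bit_eq, hb, ihl (by omega)]
        exact this _ le_rfl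
      simp only [comb, bit_eq, hxb, cond_true, hlow', xor_eq, Nat.xor_zero] at h0
      exact hr h0
    have hx' : x < 2 ^ rs.length := by
      refine Nat.lt_pow_two_of_testBit _ fun i hi => ?_
      obtain rfl | hi := hi.eq_or_lt
      · exact hxb
      · exact Nat.testBit_lt_two_pow (hx.trans_le (Nat.pow_le_pow_right two_pos hi))
    exact ih (rs.map f) h x (by rwa [List.length_map]) hrs

end QuantumQC

namespace QuantumQC

/-! ### The weights in a sum of two cyclic modules -/

/-- The words `f` and `g` of length `2 n` generate, under cyclic shifts, spaces with the bases
formed by the first `t` shifts of `f` and by the first `m` shifts of `g`, on which the shift has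
the characteristic polynomials `p` and `q`. -/
structure ShiftBasis where
  n : ℕ
  t : ℕ
  f : ℕ
  p : ℕ
  m : ℕ
  g : ℕ
  q : ℕ

namespace ShiftBasis

variable (B : ShiftBasis)

def fRows : List ℕ := shifts B.n B.f B.t
def gRows : List ℕ := shifts B.n B.g B.m

def isValid : Bool :=
  and (and (and (Nat.blt 0 B.n) (and (and (Nat.blt 4 B.t) (Nat.blt B.t 32)) (Nat.blt 0 B.m)))
    (and (Nat.blt B.f (Nat.pow 2 (Nat.mul 2 B.n))) (Nat.blt B.g (Nat.pow 2 (Nat.mul 2 B.n)))))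
  (and (and (and (bit B.p B.t) (Nat.blt B.p (Nat.pow 2 (Nat.add B.t 1))))
      (and (bit B.q B.m) (Nat.blt B.q (Nat.pow 2 (Nat.add B.m 1)))))
    (and (and (Nat.beq (comb B.p (shifts B.n B.f (Nat.add B.t 1))) 0)
      (Nat.beq (comb B.q (shifts B.n B.g (Nat.add B.m 1))) 0))
    (indepAux (Nat.add B.m B.t) (B.gRows ++ B.fRows))))

/-- The facts about the two cyclic modules that `isValid` tests. -/
structure Valid : Prop where
  n_pos : 0 < B.n
  five_le_t : 5 ≤ B.t
  t_lt : B.t < 32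
  m_pos : 0 < B.m
  f_lt : B.f < 2 ^ (2 * B.n)
  g_lt : B.g < 2 ^ (2 * B.n)
  p_bit : B.p.testBit B.t = true
  p_lt : B.p < 2 ^ (B.t + 1)
  q_bit : B.q.testBit B.m = true
  q_lt : B.q < 2 ^ (B.m + 1)
  comb_p : comb B.p (shifts B.n B.f (B.t + 1)) = 0
  comb_q : comb B.q (shifts B.n B.g (B.m + 1)) = 0
  indep : indepAux (B.m + B.t) (B.gRows ++ B.fRows) = true

variable {B}

lemma Valid.t_pos (hB : B.Valid) : 0 < B.t := (by norm_num : 0 < 5).trans_le hB.five_le_t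

lemma valid_of_isValid (h : B.isValid = true) : B.Valid := by
  simp only [isValid, Bool.and_eq_true, Nat.blt_eq, Nat.beq_eq, bit_eq] at h
  obtain ⟨⟨⟨h1, ⟨h2, h2'⟩, h3⟩, h4, h5⟩, ⟨⟨h6, h7⟩, h8, h9⟩, ⟨h10, h11⟩, h12⟩ := h
  exact ⟨h1, h2, h2', h3, h4, h5, h6, h7, h8, h9, h10, h11, h12⟩

variable (B) in
/-- The word with the coordinates `y` and `x`. -/
def word (y x : ℕ) : ℕ := comb y B.gRows ^^^ comb x B.fRows

lemma comb_append (x : ℕ) (l l' : List ℕ) :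
    comb x (l ++ l') = comb (x >>> l'.length) l ^^^ comb x l' := by
  induction l with
  | nil => simp [comb]
  | cons a l ih =>
    simp only [List.cons_append, comb, List.length_append, ih, bit_eq, xor_eq,
      Nat.testBit_shiftRight, Nat.add_comm l'.length]
    cases x.testBit (l.length + l'.length) <;> simp [Nat.xor_assoc]

lemma comb_mod (x k : ℕ) (l : List ℕ) (h : l.length ≤ k) : comb (x % 2 ^ k) l = comb x l := by
  induction l with
  | nil => simp [comb]
  | cons a l ih =>
    rw [List.length_cons] at h
    simp only [comb, bit_eq, Nat.testBit_mod_two_pow, ih (by omega),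
      show l.length < k from h, decide_true, Bool.true_and]

@[simp] lemma length_fRows : B.fRows.length = B.t := length_shifts _ _ _
@[simp] lemma length_gRows : B.gRows.length = B.m := length_shifts _ _ _

lemma word_xor (y x y' x' : ℕ) :
    B.word y x ^^^ B.word y' x' = B.word (y ^^^ y') (x ^^^ x') := by
  rw [word, word, word, comb_xor, comb_xor]
  simp only [Nat.xor_assoc, Nat.xor_left_comm (comb x _)]

lemma word_eq_zero (hB : B.Valid) {y x : ℕ} (hy : y < 2 ^ B.m) (hx : x < 2 ^ B.t)
    (h : B.word y x = 0) : y = 0 ∧ x = 0 := by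
  have hlt : 2 ^ B.t * y + x < 2 ^ (B.m + B.t) := by
    rw [pow_add]
    calc 2 ^ B.t * y + x < 2 ^ B.t * y + 2 ^ B.t := by omega
      _ = 2 ^ B.t * (y + 1) := by ring
      _ ≤ 2 ^ B.t * 2 ^ B.m := Nat.mul_le_mul_left _ hy
      _ = _ := mul_comm _ _
  -- In the list `gRows ++ fRows` the coordinate `y` occupies the digits from position t upwards, so
  -- the pair has the index 2^t y + x.
  have h0 := comb_eq_zero_of_indepAux _ _ hB.indep (2 ^ B.t * y + x) (by simpa using hlt) (by
    rw [comb_append, length_fRows, Nat.shiftRight_eq_div_pow,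
      Nat.mul_add_div (by positivity), Nat.div_eq_of_lt hx, add_zero,
      ← comb_mod _ B.t B.fRows (by simp), Nat.mul_add_mod, Nat.mod_eq_of_lt hx]
    exact h)
  have hpos : 0 < 2 ^ B.t := by positivity
  have hy0 : 2 ^ B.t * y = 0 := by omega
  exact ⟨by simpa using hy0, by omega⟩

lemma word_lt (hB : B.Valid) (y x : ℕ) : B.word y x < 2 ^ (2 * B.n) :=
  Nat.xor_lt_two_pow (comb_shifts_lt _ _ _ _ hB.n_pos hB.g_lt)
    (comb_shifts_lt _ _ _ _ hB.n_pos hB.f_lt)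

lemma word_injective (hB : B.Valid) {y x y' x' : ℕ} (hy : y < 2 ^ B.m) (hx : x < 2 ^ B.t)
    (hy' : y' < 2 ^ B.m) (hx' : x' < 2 ^ B.t) (h : B.word y x = B.word y' x') :
    y = y' ∧ x = x' := by
  have h0 : B.word (y ^^^ y') (x ^^^ x') = 0 := by rw [← word_xor, h, Nat.xor_self]
  obtain ⟨h1, h2⟩ := word_eq_zero hB (Nat.xor_lt_two_pow hy hy') (Nat.xor_lt_two_pow hx hx') h0
  exact ⟨Nat.xor_eq_zero_iff.1 h1, Nat.xor_eq_zero_iff.1 h2⟩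

/-- In coordinates the shift is multiplication by x on the direct sum of the residue rings modulo
`q` and modulo `p`. -/
lemma word_mulX (hB : B.Valid) {y x : ℕ} (hy : y < 2 ^ B.m) (hx : x < 2 ^ B.t) :
    B.word (mulX B.m B.q y) (mulX B.t B.p x) = rot B.n (B.word y x) := by
  rw [word, word, rot_xor _ _ _ hB.n_pos, fRows, gRows,
    comb_mulX hB.n_pos hB.t_pos hB.p_bit hB.p_lt hB.comb_p hx,
    comb_mulX hB.n_pos hB.m_pos hB.q_bit hB.q_lt hB.comb_q hy]

/-- Inherited from the injectivity of the shift on words, so nothing needs to be known about the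
constant term of `p`. -/
lemma mulX_injOn (hB : B.Valid) {x x' : ℕ} (hx : x < 2 ^ B.t) (hx' : x' < 2 ^ B.t)
    (h : mulX B.t B.p x = mulX B.t B.p x') : x = x' := by
  have h0 : (0 : ℕ) < 2 ^ B.m := by positivity
  have := word_mulX hB h0 hx
  rw [h, word_mulX hB h0 hx'] at this
  exact (word_injective hB h0 hx h0 hx'
    (rot_injOn _ hB.n_pos (word_lt hB _ _) (word_lt hB _ _) this.symm)).2

variable (B) in
/-- The number of words of weight `w` whose first coordinate is `y`. -/
def fiberCount (w y : ℕ) : ℕ := cosetCount B.n B.fRows w (comb y B.gRows)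

lemma fiberCount_eq (w y : ℕ) : B.fiberCount w y =
    ((Finset.range (2 ^ B.t)).filter fun x => natWeight B.n (B.word y x) = w).card := by
  rw [fiberCount, cosetCount, length_fRows]; rfl

/-- The shift maps the words over `y` bijectively to those over `mulX B.m B.q y` and preserves the
weight. Counts are thus constant on orbits. -/
lemma fiberCount_mulX (hB : B.Valid) {y : ℕ} (hy : y < 2 ^ B.m) (w : ℕ) :
    B.fiberCount w (mulX B.m B.q y) = B.fiberCount w y := by
  have hmaps : ∀ x ∈ Finset.range (2 ^ B.t), mulX B.t B.p x ∈ Finset.range (2 ^ B.t) := by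
    intro x hx
    exact Finset.mem_range.2 (mulX_lt hB.t_pos hB.p_bit hB.p_lt (Finset.mem_range.1 hx))
  have hinj : Set.InjOn (mulX B.t B.p) (Finset.range (2 ^ B.t)) := by
    intro x hx x' hx' h
    exact mulX_injOn hB (by simpa using hx) (by simpa using hx') h
  have himg : (Finset.range (2 ^ B.t)).image (mulX B.t B.p) = Finset.range (2 ^ B.t) :=
    Finset.eq_of_subset_of_card_le (Finset.image_subset_iff.2 hmaps)
      (by rw [Finset.card_image_of_injOn hinj])
  rw [fiberCount_eq, fiberCount_eq, ← himg, Finset.filter_image, Finset.card_image_of_injOn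
    (hinj.mono (by simp [Set.subset_def]; tauto)), himg]
  congr 1
  refine Finset.filter_congr fun x hx => ?_
  rw [word_mulX hB hy (Finset.mem_range.1 hx), natWeight_rot _ _ hB.n_pos]

end ShiftBasis

/-! ### Orbits of the multiplication by `x` -/

def orbitMask (m q : ℕ) : ℕ → ℕ → ℕ
  | 0, _ => 0
  | e + 1, y => Nat.lor (Nat.shiftLeft 1 y) (orbitMask m q e (mulX m q y))

def orbitsMask (m q e : ℕ) : List ℕ → ℕ
  | [] => 0
  | y :: ys => Nat.lor (orbitMask m q e y) (orbitsMask m q e ys)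

/-- The orbits, of length `e`, of the numbers in the list exhaust `1, ..., 2 ^ m - 1`, and are no
longer than necessary. -/
def coversOrbits (m q e : ℕ) (ys : List ℕ) : Bool :=
  and (Nat.beq (Nat.mul ys.length e) (Nat.sub (Nat.pow 2 m) 1))
    (and (Nat.beq (orbitsMask m q e ys) (Nat.sub (Nat.pow 2 (Nat.pow 2 m)) 2))
      (ys.all fun y => Nat.blt y (Nat.pow 2 m)))

def orbitList (m q : ℕ) : ℕ → ℕ → List ℕ
  | 0, _ => []
  | e + 1, y => y :: orbitList m q e (mulX m q y)

lemma mem_orbitList_of_testBit (m q e y z : ℕ) (h : (orbitMask m q e y).testBit z = true) :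
    z ∈ orbitList m q e y := by
  induction e generalizing y with
  | zero => simp [orbitMask] at h
  | succ e ih =>
    rw [orbitMask, lor_eq, shiftLeft_eq, Nat.testBit_or, Nat.one_shiftLeft,
      Nat.testBit_two_pow, Bool.or_eq_true, decide_eq_true_iff] at h
    rw [orbitList, List.mem_cons]
    exact h.imp Eq.symm (ih _)

lemma length_orbitList (m q e y : ℕ) : (orbitList m q e y).length = e := by
  induction e generalizing y with
  | zero => rfl
  | succ e ih => rw [orbitList, List.length_cons, ih]

/-- Pigeonhole: the concatenated orbit lists have 2^m - 1 entries and contain every number from 1 to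
2^m - 1, so no entry is repeated and the sum can be taken list by list. That each list is a full
orbit is not needed. -/
theorem sum_of_coversOrbits {m q e : ℕ} {ys : List ℕ} (h : coversOrbits m q e ys = true)
    (F : ℕ → ℕ) (hF : ∀ y < 2 ^ m, F (mulX m q y) = F y)
    (hlt : ∀ y < 2 ^ m, mulX m q y < 2 ^ m) :
    ∑ y ∈ Finset.range (2 ^ m), F y = F 0 + e * (ys.map F).sum := by
  simp only [coversOrbits, Bool.and_eq_true, Nat.beq_eq, List.all_eq_true, Nat.blt_eq] at h
  obtain ⟨hlen, hmask, hys⟩ := h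
  replace hlen : ys.length * e = 2 ^ m - 1 := hlen
  replace hmask : orbitsMask m q e ys = 2 ^ 2 ^ m - 2 := hmask
  have hsum : ∀ e, ∀ y < 2 ^ m, ((orbitList m q e y).map F).sum = e * F y := by
    intro e
    induction e with
    | zero => simp [orbitList]
    | succ e ih =>
      intro y hy
      rw [orbitList, List.map_cons, List.sum_cons, ih _ (hlt y hy), hF y hy]
      ring
  set O := ys.flatMap (orbitList m q e) with hO
  have hOlen : O.length = 2 ^ m - 1 := by
    rw [hO, List.length_flatMap, ← hlen]
    simp [length_orbitList]
  have hOsum : (O.map F).sum = e * (ys.map F).sum := by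
    rw [hO]
    clear hO hOlen hmask hlen O
    induction ys with
    | nil => simp
    | cons y ys ih =>
      rw [List.flatMap_cons, List.map_append, List.sum_append, ih fun z hz => hys z (by simp [hz]),
        hsum _ _ (hys y (by simp)), List.map_cons, List.sum_cons, mul_add]
  have hmem : ∀ z, (orbitsMask m q e ys).testBit z = true → z ∈ O := by
    rw [hO]
    clear hO hOlen hmask hlen hOsum O hys
    intro z hz
    induction ys with
    | nil => simp [orbitsMask] at hz
    | cons y ys ih =>
      rw [orbitsMask, lor_eq, Nat.testBit_or, Bool.or_eq_true] at hz
      rw [List.flatMap_cons, List.mem_append]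
      exact hz.imp (mem_orbitList_of_testBit _ _ _ _ _) ih
  have hpos : 1 ≤ 2 ^ m := Nat.one_le_two_pow
  have hsub : Finset.Ico 1 (2 ^ m) ⊆ O.toFinset := by
    intro z hz
    obtain ⟨hz1, hz2⟩ := Finset.mem_Ico.1 hz
    refine List.mem_toFinset.2 (hmem z ?_)
    obtain ⟨k, hk⟩ : ∃ k, 2 ^ m = k + 1 := ⟨2 ^ m - 1, by omega⟩
    -- The expected mask has the digit 1 precisely at the positions 1, ..., 2^m - 1.
    have e1 : 2 ^ 2 ^ m - 2 = (2 ^ k - 1) <<< 1 := by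
      rw [hk, Nat.shiftLeft_eq, pow_succ]; omega
    rw [hmask, e1, Nat.testBit_shiftLeft, Nat.testBit_two_pow_sub_one]
    simp only [ge_iff_le, hz1, decide_true, Bool.true_and, decide_eq_true_iff]
    omega
  have hcard : O.toFinset.card ≤ (Finset.Ico 1 (2 ^ m)).card := by
    rw [Nat.card_Ico, ← hOlen]; exact List.toFinset_card_le O
  have heq := Finset.eq_of_subset_of_card_le hsub hcard
  have hnodup : O.Nodup := by
    rw [← Multiset.coe_nodup, ← Multiset.toFinset_card_eq_card_iff_nodup]
    change O.toFinset.card = O.length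
    rw [← heq, Nat.card_Ico, hOlen]
  rw [← hOsum, ← List.sum_toFinset F hnodup, ← heq, Finset.range_eq_Ico,
    Finset.sum_eq_sum_Ico_succ_bot (by omega)]

/-! ### The weight distribution -/

def allEq (f : ℕ → ℕ) : List (ℕ × ℕ) → Bool
  | [] => true
  | p :: l => cond (Nat.beq (f p.1) p.2) (allEq f l) false

/-- The value listed for `w`, or `0`. -/
def listed : List (ℕ × ℕ) → ℕ → ℕ
  | [], _ => 0
  | p :: l, w => cond (Nat.beq p.1 w) p.2 (listed l w)

/-- Only a lower bound: weights absent from the list are never evaluated and contribute 0.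
Comparison of the totals later turns the bounds into equalities. -/
lemma listed_le {f : ℕ → ℕ} {l : List (ℕ × ℕ)} (h : allEq f l = true) (w : ℕ) :
    listed l w ≤ f w := by
  induction l with
  | nil => simp [listed]
  | cons p l ih =>
    rw [allEq] at h
    cases hp : Nat.beq (f p.1) p.2 with
    | false => simp [hp] at h
    | true =>
      rw [hp, cond_true] at h
      rw [listed]
      cases hw : Nat.beq p.1 w with
      | false => exact ih h
      | true =>
        rw [Nat.beq_eq] at hp hw
        rw [cond_true, ← hp, hw]

namespace ShiftBasis

variable {B : ShiftBasis}

variable (B) in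
/-- The list contains the numbers of words of given weights whose first coordinate is in `ys`. -/
def countsEq (ys : List ℕ) (l : List (ℕ × ℕ)) : Bool :=
  allEq (weightCount B.n B.t B.fRows (ys.map fun y => comb y B.gRows)) l

/-- The total of the counts for the weight `w` in a list of groups of orbits. -/
def groupTotal (w : ℕ) : List (List ℕ × List (ℕ × ℕ)) → ℕ
  | [] => 0
  | G :: Gs => Nat.add (listed G.2 w) (groupTotal w Gs)

def weightList (l₀ : List (ℕ × ℕ)) (e : ℕ) (Gs : List (List ℕ × List (ℕ × ℕ))) : ℕ → List ℕ
  | 0 => []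
  | w + 1 => weightList l₀ e Gs w ++ [Nat.add (listed l₀ w) (Nat.mul e (groupTotal w Gs))]

lemma length_weightList (l₀ : List (ℕ × ℕ)) (e : ℕ) (Gs : List (List ℕ × List (ℕ × ℕ))) (k : ℕ) :
    (weightList l₀ e Gs k).length = k := by
  induction k with
  | zero => rfl
  | succ k ih => simp [weightList, ih]

lemma getD_weightList (l₀ : List (ℕ × ℕ)) (e : ℕ) (Gs : List (List ℕ × List (ℕ × ℕ))) (k w : ℕ)
    (hw : w < k) :
    (weightList l₀ e Gs k).getD w 0 = listed l₀ w + e * groupTotal w Gs := by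
  induction k with
  | zero => simp at hw
  | succ k ih =>
    rw [weightList]
    obtain hw | rfl := Nat.lt_succ_iff_lt_or_eq.1 hw
    · rw [List.getD_append _ _ _ _ (by rwa [length_weightList]), ih hw]
    · rw [List.getD_append_right _ _ _ _ (by rw [length_weightList]), length_weightList]
      simp

lemma natWeight_le (n u : ℕ) : natWeight n u ≤ n := by
  calc natWeight n u ≤ ∑ i ∈ Finset.range n, 1 :=
        Finset.sum_le_sum fun i _ => Bool.toNat_le _
    _ = n := by simp

lemma le_fiberCount_sum (hB : B.Valid) {ys : List ℕ} {l : List (ℕ × ℕ)} (hn : B.n < 128)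
    (hys : ys.length < 128) (h : B.countsEq ys l = true) {w : ℕ} (hw : w < 128) :
    listed l w ≤ (ys.map (B.fiberCount w)).sum := by
  refine (listed_le h w).trans_eq ?_
  rw [weightCount_eq _ _ _ _ _ length_fRows hB.five_le_t hB.t_lt hn (by simpa using hys) hw, List.map_map]
  rfl

/-- The weight distribution of the sum of the two cyclic modules, from the counts for the words
with first coordinate `0` and for groups of representatives of the orbits of the shift on the
second module. -/
theorem card_words_eq (hB : B.Valid) (hn : B.n < 128) {e : ℕ} {l₀ : List (ℕ × ℕ)}
    {Gs : List (List ℕ × List (ℕ × ℕ))} (h₀ : B.countsEq [0] l₀ = true)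
    (hGs : ∀ G ∈ Gs, G.1.length < 128 ∧ B.countsEq G.1 G.2 = true)
    (hcov : coversOrbits B.m B.q e (Gs.flatMap Prod.fst) = true)
    (htot : (weightList l₀ e Gs (B.n + 1)).sum = 2 ^ (B.m + B.t)) (w : ℕ) (hw : w ≤ B.n) :
    ((Finset.range (2 ^ B.m) ×ˢ Finset.range (2 ^ B.t)).filter fun a =>
      natWeight B.n (B.word a.1 a.2) = w).card = (weightList l₀ e Gs (B.n + 1)).getD w 0 := by
  set N : ℕ → ℕ := fun w => ((Finset.range (2 ^ B.m) ×ˢ Finset.range (2 ^ B.t)).filter fun a =>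
      natWeight B.n (B.word a.1 a.2) = w).card with hN
  have hNf : ∀ w, N w = ∑ y ∈ Finset.range (2 ^ B.m), B.fiberCount w y := by
    intro w
    simp only [hN, fiberCount_eq, Finset.card_filter, Finset.sum_product]
  have hle : ∀ w ∈ Finset.range (B.n + 1),
      (weightList l₀ e Gs (B.n + 1)).getD w 0 ≤ N w := by
    intro w hw
    have hw := Finset.mem_range.1 hw
    rw [getD_weightList _ _ _ _ _ hw, hNf, sum_of_coversOrbits hcov _
      (fun y hy => fiberCount_mulX hB hy w) (fun y hy => mulX_lt hB.m_pos hB.q_bit hB.q_lt hy)]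
    refine Nat.add_le_add ?_ (Nat.mul_le_mul_left _ ?_)
    · simpa using le_fiberCount_sum hB hn (by simp) h₀ (show w < 128 by omega)
    · clear hcov htot
      induction Gs with
      | nil => simp [groupTotal]
      | cons G Gs ih =>
        rw [groupTotal, List.flatMap_cons, List.map_append, List.sum_append]
        obtain ⟨h1, h2⟩ := hGs G (by simp)
        exact Nat.add_le_add (le_fiberCount_sum hB hn h1 h2 (by omega))
          (ih fun G' hG' => hGs G' (by simp [hG']))
  have hsumN : ∑ w ∈ Finset.range (B.n + 1), N w = 2 ^ (B.m + B.t) := by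
    rw [← Finset.card_eq_sum_card_fiberwise, Finset.card_product, Finset.card_range,
      Finset.card_range, pow_add]
    intro a _
    have := natWeight_le B.n (B.word a.1 a.2)
    simp; omega
  have hsumL : ∑ w ∈ Finset.range (B.n + 1), (weightList l₀ e Gs (B.n + 1)).getD w 0 =
      2 ^ (B.m + B.t) := by
    rw [← htot, ← Fin.sum_univ_eq_sum_range, ← Fin.sum_univ_getElem]
    refine (Fin.sum_congr' _ (length_weightList l₀ e Gs (B.n + 1))).symm.trans ?_
    refine Finset.sum_congr rfl fun i _ => ?_
    simp
  -- Termwise lower bounds with the same total as the true counts are equal to them.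
  exact ((Finset.sum_eq_sum_iff_of_le hle).1 (hsumL.trans hsumN.symm) w
    (Finset.mem_range.2 (by omega))).symm

end ShiftBasis

end QuantumQC

namespace QuantumQC

/-! ### The symplectic dual -/

variable {n : ℕ}

lemma sympForm_add_left (u u' w : BinVec n) :
    sympForm (u + u') w = sympForm u w + sympForm u' w := by
  simp only [sympForm, Prod.fst_add, Prod.snd_add, Pi.add_apply, ← Finset.sum_add_distrib]
  exact Finset.sum_congr rfl fun i _ => by ring

lemma sympForm_smul_left (c : ZMod 2) (u w : BinVec n) :
    sympForm (c • u) w = c * sympForm u w := by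
  simp only [sympForm, Prod.smul_fst, Prod.smul_snd, Pi.smul_apply, smul_eq_mul, Finset.mul_sum]
  exact Finset.sum_congr rfl fun i _ => by ring

lemma sympForm_neg_comm (u w : BinVec n) : sympForm u w = -sympForm w u := by
  simp only [sympForm, ← Finset.sum_neg_distrib]
  exact Finset.sum_congr rfl fun i _ => by ring

lemma sympForm_comm (u w : BinVec n) : sympForm u w = sympForm w u := by
  rw [sympForm_neg_comm, ZMod.neg_eq_self_mod_two]

lemma sympForm_add_right (u w w' : BinVec n) :
    sympForm u (w + w') = sympForm u w + sympForm u w' := by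
  rw [sympForm_comm, sympForm_add_left, sympForm_comm w, sympForm_comm w']

lemma sympForm_smul_right (c : ZMod 2) (u w : BinVec n) :
    sympForm u (c • w) = c * sympForm u w := by
  rw [sympForm_comm, sympForm_smul_left, sympForm_comm w]

/-- The symplectic form as a bilinear form. -/
def sympBilin (n : ℕ) : LinearMap.BilinForm (ZMod 2) (BinVec n) :=
  LinearMap.mk₂ (ZMod 2) sympForm sympForm_add_left sympForm_smul_left sympForm_add_right
    sympForm_smul_right

lemma sympBilin_apply (u w : BinVec n) : sympBilin n u w = sympForm u w := rfl

lemma sympBilin_isRefl : (sympBilin n).IsRefl := by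
  intro u w h
  rwa [sympBilin_apply, sympForm_comm]

lemma eq_zero_of_sympForm_eq_zero (u : BinVec n) (h : ∀ w, sympForm u w = 0) : u = 0 := by
  refine Prod.ext (funext fun i => ?_) (funext fun i => ?_)
  · have := h (0, Pi.single i 1)
    simpa [sympForm, Pi.single_apply] using this
  · have := h (Pi.single i 1, 0)
    simpa [sympForm, Pi.single_apply] using this

lemma sympBilin_nondegenerate : (sympBilin n).Nondegenerate :=
  ⟨fun u h => eq_zero_of_sympForm_eq_zero u h,
    fun u h => eq_zero_of_sympForm_eq_zero u fun w => by rw [sympForm_comm]; exact h w⟩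

lemma sympDual_eq_orthogonal (C : Submodule (ZMod 2) (BinVec n)) :
    sympDual C = (sympBilin n).orthogonal C := by
  ext w; rfl

/-- Allows the code to be treated as the dual of its small dual, both in the MacWilliams identity
and for stabilizers. -/
lemma sympDual_sympDual (C : Submodule (ZMod 2) (BinVec n)) : sympDual (sympDual C) = C := by
  rw [sympDual_eq_orthogonal, sympDual_eq_orthogonal,
    LinearMap.BilinForm.orthogonal_orthogonal sympBilin_nondegenerate sympBilin_isRefl]

lemma finrank_add_finrank_sympDual (C : Submodule (ZMod 2) (BinVec n)) :
    Module.finrank (ZMod 2) C + Module.finrank (ZMod 2) (sympDual C) = 2 * n := by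
  have h : Module.finrank (ZMod 2) (BinVec n) = 2 * n := by
    rw [Module.finrank_prod, Module.finrank_fin_fun, two_mul]
  rw [sympDual_eq_orthogonal, LinearMap.BilinForm.finrank_orthogonal sympBilin_nondegenerate, h]
  have := Submodule.finrank_le C
  omega

/-! ### The MacWilliams identity -/

/-- The number of vectors of weight `j` in `C`. -/
noncomputable def weightCard (C : Submodule (ZMod 2) (BinVec n)) (j : ℕ) : ℕ :=
  Set.ncard {u | u ∈ C ∧ sympWeight u = j}

/-- The nontrivial additive character of `ZMod 2`. -/
def sgn (a : ZMod 2) : ℤ := if a = 0 then 1 else -1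

lemma sgn_add (a b : ZMod 2) : sgn (a + b) = sgn a * sgn b := by
  revert a b; decide

lemma sgn_sum {ι : Type*} (s : Finset ι) (f : ι → ZMod 2) :
    sgn (∑ i ∈ s, f i) = ∏ i ∈ s, sgn (f i) := by
  classical
  induction s using Finset.induction_on with
  | empty => simp [sgn]
  | insert i s hi ih => rw [Finset.sum_insert hi, Finset.prod_insert hi, sgn_add, ih]

-- Orthogonality of characters: if some `u₀` in `D` is not orthogonal to `w`, translation by `u₀`
-- changes the sign of the sum.
open Classical in
lemma sum_sgn (D : Submodule (ZMod 2) (BinVec n)) (w : BinVec n) :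
    ∑ u : D, sgn (sympForm u.1 w) = if w ∈ sympDual D then (Nat.card D : ℤ) else 0 := by
  split_ifs with h
  · have h1 : ∀ u : D, sgn (sympForm u.1 w) = 1 := by
      intro u; rw [h u.1 u.2]; rfl
    simp [h1, Nat.card_eq_fintype_card]
  · have h' : ∃ u₀ : D, sympForm u₀.1 w ≠ 0 := by
      by_contra hcon
      push Not at hcon
      exact h fun u hu => hcon ⟨u, hu⟩
    obtain ⟨u₀, hu₀⟩ := h'
    have h1 : sgn (sympForm u₀.1 w) = -1 := if_neg hu₀
    have h2 : ∑ u : D, sgn (sympForm u.1 w) = ∑ u : D, sgn (sympForm (u + u₀ : D).1 w) :=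
      (Equiv.sum_comp (Equiv.addRight u₀) fun u : D => sgn (sympForm u.1 w)).symm
    simp only [Submodule.coe_add, sympForm_add_left, sgn_add, h1, mul_neg, mul_one,
      Finset.sum_neg_distrib] at h2
    linarith

lemma X_pow_sympWeight (u : BinVec n) : (X : ℤ[X]) ^ sympWeight u =
    ∏ i, if (u.1 i, u.2 i) = (0, 0) then 1 else X := by
  rw [sympWeight, ← Finset.prod_const, Finset.prod_filter]
  exact Finset.prod_congr rfl fun i _ => by split_ifs <;> simp_all

/-- Character and weight are both products over the n positions, so the sum factors into sums over
single pairs of bits. -/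
lemma sum_sgn_X_pow (u : BinVec n) :
    ∑ w : BinVec n, (C (sgn (sympForm u w)) : ℤ[X]) * X ^ sympWeight w =
      (1 - X) ^ sympWeight u * (1 + 3 * X) ^ (n - sympWeight u) := by
  have h1 : ∀ w : BinVec n, (C (sgn (sympForm u w)) : ℤ[X]) * X ^ sympWeight w =
      ∏ i, (C (sgn (u.1 i * w.2 i - u.2 i * w.1 i)) *
        if (w.1 i, w.2 i) = (0, 0) then 1 else X) := by
    intro w
    rw [sympForm, sgn_sum, X_pow_sympWeight, map_prod, Finset.prod_mul_distrib]
  -- The trivial character of the four pairs gives 1 + 3X, a nontrivial one 1 + X - 2X = 1 - X.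
  have h2 : ∀ a b : ZMod 2, ∑ c : ZMod 2 × ZMod 2, ((C (sgn (a * c.2 - b * c.1)) : ℤ[X]) *
      if c = (0, 0) then 1 else X) = if (a, b) ≠ (0, 0) then 1 - X else 1 + 3 * X := by
    intro a b
    rw [Fintype.sum_prod_type]
    have h01 : ∀ x : ZMod 2, x = 0 ∨ x = 1 := by decide
    obtain rfl | rfl := h01 a <;> obtain rfl | rfl := h01 b <;>
      simp [sgn, show (Finset.univ : Finset (ZMod 2)) = {0, 1} from rfl] <;> ring
  rw [Finset.sum_congr rfl fun w _ => h1 w]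
  rw [← Equiv.sum_comp (Equiv.arrowProdEquivProdArrow (Fin n) (fun _ => ZMod 2) fun _ => ZMod 2)]
  have h3 := Finset.prod_univ_sum (fun _ : Fin n => (Finset.univ : Finset (ZMod 2 × ZMod 2)))
    fun i c => (C (sgn (u.1 i * c.2 - u.2 i * c.1)) : ℤ[X]) * if c = (0, 0) then 1 else X
  rw [Fintype.piFinset_univ] at h3
  refine h3.symm.trans ?_
  rw [Finset.prod_congr rfl fun i _ => h2 _ _, Finset.prod_ite, Finset.prod_const,
    Finset.prod_const]
  have h4 := Finset.card_filter_add_card_filter_not (s := (Finset.univ : Finset (Fin n)))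
    fun i => (u.1 i, u.2 i) ≠ (0, 0)
  rw [Finset.card_univ, Fintype.card_fin] at h4
  rw [sympWeight, ← Nat.sub_eq_of_eq_add' h4.symm]

lemma sympWeight_le (u : BinVec n) : sympWeight u ≤ n :=
  (Finset.card_le_univ _).trans_eq (Fintype.card_fin n)

open Classical in
lemma weightCard_eq_card (C : Submodule (ZMod 2) (BinVec n)) (j : ℕ) :
    weightCard C j = (Finset.univ.filter fun u : BinVec n => u ∈ C ∧ sympWeight u = j).card := by
  rw [weightCard, ← Set.ncard_coe_finset]
  congr 1; ext u; simp

-- The character sums over `D × BinVec n` are evaluated in both orders: summing over `D` first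
-- leaves the dual, summing over all vectors first gives the transform.
open Classical in
theorem macWilliams (D : Submodule (ZMod 2) (BinVec n)) :
    (Nat.card D : ℤ[X]) * ∑ w ∈ Finset.univ.filter (· ∈ sympDual D), X ^ sympWeight w =
      ∑ j ∈ Finset.range (n + 1),
        (weightCard D j : ℤ[X]) * ((1 - X) ^ j * (1 + 3 * X) ^ (n - j)) := by
  have h1 : (Nat.card D : ℤ[X]) * ∑ w ∈ Finset.univ.filter (· ∈ sympDual D), X ^ sympWeight w =
      ∑ w : BinVec n, ∑ u : D, (C (sgn (sympForm u.1 w)) : ℤ[X]) * X ^ sympWeight w := by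
    rw [Finset.mul_sum, Finset.sum_filter]
    refine Finset.sum_congr rfl fun w _ => ?_
    rw [← Finset.sum_mul, ← map_sum, sum_sgn]
    split_ifs <;> simp
  rw [h1, Finset.sum_comm, Finset.sum_congr rfl fun u _ => sum_sgn_X_pow _]
  have h2 : ∑ u : D, ((1 - X) ^ sympWeight u.1 * (1 + 3 * X) ^ (n - sympWeight u.1) : ℤ[X]) =
      ∑ u ∈ Finset.univ.filter (· ∈ D),
        (1 - X) ^ sympWeight u * (1 + 3 * X) ^ (n - sympWeight u) := by
    rw [Finset.sum_subtype (Finset.univ.filter (· ∈ D)) (p := (· ∈ D)) (by simp)]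
  rw [h2, ← Finset.sum_fiberwise_of_maps_to (g := sympWeight) (t := Finset.range (n + 1))
    fun u _ => Finset.mem_range.2 (Nat.lt_succ_of_le (sympWeight_le u))]
  refine Finset.sum_congr rfl fun j _ => ?_
  rw [Finset.sum_congr rfl (g := fun _ => (1 - X) ^ j * (1 + 3 * X) ^ (n - j)), Finset.sum_const,
    nsmul_eq_mul, weightCard_eq_card, Finset.filter_filter]
  intro u hu
  rw [(Finset.mem_filter.1 hu).2]

/-! ### Evaluation of the MacWilliams transform -/

/-- The transform of the weight distribution given by a list. -/
noncomputable def macPoly : List ℕ → ℤ[X]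
  | [] => 0
  | b :: bs => (b : ℤ[X]) * (1 + 3 * X) ^ bs.length + (1 - X) * macPoly bs

/-- The recursion is a Horner scheme in 1 - X; the exponent of 1 + 3X is the number of entries that
follow. -/
lemma macPoly_eq (bs : List ℕ) : macPoly bs = ∑ j ∈ Finset.range bs.length,
    (bs.getD j 0 : ℤ[X]) * ((1 - X) ^ j * (1 + 3 * X) ^ (bs.length - 1 - j)) := by
  induction bs with
  | nil => rfl
  | cons b bs ih =>
    rw [macPoly, ih, List.length_cons, Finset.sum_range_succ', Finset.mul_sum, add_comm]
    refine congrArg₂ (· + ·) ?_ ?_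
    · refine Finset.sum_congr rfl fun j _ => ?_
      rw [List.getD_cons_succ, pow_succ, show bs.length + 1 - 1 - (j + 1) = bs.length - 1 - j by
        omega]
      ring
    · simp

theorem card_mul_weightCard_sympDual {D : Submodule (ZMod 2) (BinVec n)} {bs : List ℕ}
    (hlen : bs.length = n + 1) (hbs : ∀ j ≤ n, weightCard D j = bs.getD j 0) (j : ℕ) :
    (Nat.card D : ℤ) * weightCard (sympDual D) j = (macPoly bs).coeff j := by
  classical
  have h1 : macPoly bs = ∑ j ∈ Finset.range (n + 1),
      (weightCard D j : ℤ[X]) * ((1 - X) ^ j * (1 + 3 * X) ^ (n - j)) := by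
    rw [macPoly_eq, hlen]
    refine Finset.sum_congr rfl fun j hj => ?_
    rw [hbs j (Nat.lt_succ_iff.1 (Finset.mem_range.1 hj)), Nat.add_sub_cancel]
  rw [h1, ← macWilliams, ← C_eq_natCast, coeff_C_mul, finsetSum_coeff, weightCard_eq_card,
    ← Finset.filter_filter, Finset.card_filter]
  push_cast
  simp only [coeff_X_pow, eq_comm]

/-- Multiplication by `1 + c x`, for the list of the first coefficients. -/
def mulLinear (c : ℤ) (l : List ℤ) : List ℤ :=
  List.zipWith (fun a b => a + c * b) l (0 :: l)

/-- The first coefficients of `macPoly bs` and of `(1 + 3 x) ^ bs.length`. -/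
def macCoeffs (k : ℕ) : List ℕ → List ℤ × List ℤ
  | [] => (List.replicate k 0, 1 :: List.replicate (k - 1) 0)
  | b :: bs => (List.zipWith (fun a c => (b : ℤ) * a + c) (macCoeffs k bs).2
      (mulLinear (-1) (macCoeffs k bs).1), mulLinear 3 (macCoeffs k bs).2)

lemma length_mulLinear (c : ℤ) (l : List ℤ) : (mulLinear c l).length = l.length := by
  simp [mulLinear]

lemma getD_mulLinear {c : ℤ} {l : List ℤ} {p : ℤ[X]} (h : ∀ j < l.length, l.getD j 0 = p.coeff j)
    {j : ℕ} (hj : j < l.length) : (mulLinear c l).getD j 0 = ((1 + (C c) * X) * p).coeff j := by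
  have hj' : j < (mulLinear c l).length := by rwa [length_mulLinear]
  rw [List.getD_eq_getElem _ _ hj', add_mul, one_mul, coeff_add, mul_assoc, coeff_C_mul]
  simp only [mulLinear, List.getElem_zipWith]
  cases j with
  | zero =>
    rw [← h 0 hj, List.getD_eq_getElem _ _ hj]
    simp
  | succ j =>
    rw [← h _ hj, List.getD_eq_getElem _ _ hj, coeff_X_mul, ← h j (by omega),
      List.getD_eq_getElem _ _ (by omega)]
    simp

/-- Multiplication by a linear factor determines the first k coefficients from the first k, so
truncation loses nothing. For k = 0 the list that stands for the constant 1 would be too long. -/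
lemma macCoeffs_spec {k : ℕ} (hk : 0 < k) (bs : List ℕ) :
    ((macCoeffs k bs).1.length = k ∧ (macCoeffs k bs).2.length = k) ∧
    (∀ j < k, (macCoeffs k bs).1.getD j 0 = (macPoly bs).coeff j) ∧
    ∀ j < k, (macCoeffs k bs).2.getD j 0 = ((1 + 3 * X : ℤ[X]) ^ bs.length).coeff j := by
  induction bs with
  | nil =>
    refine ⟨⟨by simp [macCoeffs], by simp [macCoeffs]; omega⟩, fun j hj => ?_, fun j hj => ?_⟩
    · simp [macCoeffs, macPoly, hj]
    · cases j with
      | zero => simp [macCoeffs]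
      | succ j =>
        have : j < k - 1 := by omega
        simp [macCoeffs, coeff_one, this]
  | cons b bs ih =>
    obtain ⟨⟨h1, h2⟩, h3, h4⟩ := ih
    have hA : ∀ j < k, (mulLinear (-1) (macCoeffs k bs).1).getD j 0 =
        ((1 - X) * macPoly bs).coeff j := by
      intro j hj
      rw [getD_mulLinear (p := macPoly bs) (by rwa [h1]) (by rwa [h1]),
        show (1 + C (-1) * X : ℤ[X]) = 1 - X by simp [sub_eq_add_neg]]
    have hB : ∀ j < k, (mulLinear 3 (macCoeffs k bs).2).getD j 0 =
        ((1 + 3 * X : ℤ[X]) ^ (bs.length + 1)).coeff j := by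
      intro j hj
      rw [getD_mulLinear (p := (1 + 3 * X : ℤ[X]) ^ bs.length) (by rwa [h2]) (by rwa [h2]),
        pow_succ', show (1 + C 3 * X : ℤ[X]) = 1 + 3 * X from rfl]
    refine ⟨⟨by simp [macCoeffs, length_mulLinear, h1, h2],
      by simp [macCoeffs, length_mulLinear, h2]⟩, fun j hj => ?_, hB⟩
    have e2 := h4 j hj
    have e1 := hA j hj
    rw [List.getD_eq_getElem _ _ (by rwa [h2])] at e2
    rw [List.getD_eq_getElem _ _ (by rwa [length_mulLinear, h1])] at e1
    rw [macPoly, coeff_add, ← C_eq_natCast, coeff_C_mul, ← e1, ← e2,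
      List.getD_eq_getElem _ _ (by simp [macCoeffs, length_mulLinear, h1, h2, hj])]
    simp [macCoeffs]

/-- The leading coefficient of the transform. -/
def macTop : List ℕ → ℤ
  | [] => 0
  | b :: bs => (b : ℤ) * 3 ^ bs.length - macTop bs

lemma natDegree_three_mul_X_le : (1 + 3 * X : ℤ[X]).natDegree ≤ 1 := by compute_degree

/-- The leading coefficient of (1 - X)^j (1 + 3X)^(n-j) is (-1)^j 3^(n-j). This yields the number of
words of full weight without the intermediate coefficients. -/
lemma macTop_spec (b : ℕ) (bs : List ℕ) :
    (∀ j > bs.length, (macPoly (b :: bs)).coeff j = 0) ∧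
      (macPoly (b :: bs)).coeff bs.length = macTop (b :: bs) := by
  have hpow : ∀ m, ((1 + 3 * X : ℤ[X]) ^ m).natDegree ≤ m := fun m =>
    (natDegree_pow_le_of_le m natDegree_three_mul_X_le).trans_eq (mul_one m)
  have h13 : (1 + 3 * X : ℤ[X]).coeff 1 = 3 := by
    rw [show (1 + 3 * X : ℤ[X]) = 1 + C 3 * X from rfl, coeff_add, coeff_C_mul, coeff_X_one,
      coeff_one]
    simp
  have hlead : ∀ m, ((1 + 3 * X : ℤ[X]) ^ m).coeff m = 3 ^ m := fun m => by
    have := coeff_pow_of_natDegree_le natDegree_three_mul_X_le (m := m)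
    rw [mul_one] at this
    rw [this, h13]
  induction bs generalizing b with
  | nil =>
    refine ⟨fun j hj => ?_, ?_⟩
    · simp only [macPoly, List.length_nil, pow_zero, mul_one, mul_zero, add_zero]
      rw [← C_eq_natCast, coeff_C_of_ne_zero (by simpa using hj.ne')]
    · simp [macPoly, macTop]
  | cons c bs ih =>
    obtain ⟨h1, h2⟩ := ih c
    have hX : ∀ j, ((1 - X) * macPoly (c :: bs)).coeff (j + 1) =
        (macPoly (c :: bs)).coeff (j + 1) - (macPoly (c :: bs)).coeff j := by
      intro j; rw [sub_mul, one_mul, coeff_sub, coeff_X_mul]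
    refine ⟨fun j hj => ?_, ?_⟩
    · obtain ⟨j, rfl⟩ : ∃ i, j = i + 1 := ⟨j - 1, by simp at hj; omega⟩
      simp only [List.length_cons] at hj
      rw [macPoly, coeff_add, hX, h1 _ (by omega), h1 _ (by omega), ← C_eq_natCast, coeff_C_mul,
        coeff_eq_zero_of_natDegree_lt ((hpow _).trans_lt (by simpa using hj))]
      simp
    · rw [macPoly, coeff_add, List.length_cons, hX, h1 _ (by omega), h2, ← C_eq_natCast,
        coeff_C_mul, hlead]
      simp [macTop, sub_eq_add_neg]

end QuantumQC

namespace QuantumQC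

/-! ### Pauli operators -/

variable {n : ℕ}

/-- The nontrivial additive character of `ZMod 2`, with complex values. -/
def csgn (a : ZMod 2) : ℂ := (-1) ^ a.val

lemma csgn_add (a b : ZMod 2) : csgn (a + b) = csgn a * csgn b := by
  have h : ∀ x : ZMod 2, x = 0 ∨ x = 1 := by decide
  obtain rfl | rfl := h a <;> obtain rfl | rfl := h b <;>
    simp [csgn, ZMod.val_one, show (1 : ZMod 2) + 1 = 0 from rfl]

lemma csgn_zero : csgn 0 = 1 := by simp [csgn]

lemma csgn_of_ne_zero {a : ZMod 2} (h : a ≠ 0) : csgn a = -1 := by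
  have h' : ∀ x : ZMod 2, x = 0 ∨ x = 1 := by decide
  obtain rfl := (h' a).resolve_left h
  simp [csgn, ZMod.val_one]

lemma csgn_mul_self (a : ZMod 2) : csgn a * csgn a = 1 := by
  rw [← csgn_add, CharTwo.add_self_eq_zero, csgn_zero]

lemma conj_csgn (a : ZMod 2) : (starRingEnd ℂ) (csgn a) = csgn a := by
  simp [csgn]

lemma pauli_apply (u : BinVec n) (ψ : Qubits n) (x : Fin n → ZMod 2) :
    pauli u ψ x = csgn (u.2 ⬝ᵥ (x - u.1)) * ψ (x - u.1) := rfl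

lemma pauli_zero (ψ : Qubits n) : pauli 0 ψ = ψ := by
  ext x
  simp [pauli_apply, csgn_zero]

/-- The sign comes from moving a phase operator past a bit flip. Because of it a Pauli operator may
have square -1, and eigenvalues may be imaginary. -/
lemma pauli_pauli (u w : BinVec n) (ψ : Qubits n) :
    pauli u (pauli w ψ) = csgn (u.2 ⬝ᵥ w.1) • pauli (u + w) ψ := by
  ext x
  have h1 : x - (u + w).1 = x - u.1 - w.1 := by rw [Prod.fst_add, sub_sub]
  have h2 : u.2 ⬝ᵥ (x - u.1) = u.2 ⬝ᵥ w.1 + u.2 ⬝ᵥ (x - u.1 - w.1) := by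
    rw [← dotProduct_add]; congr 1; abel
  simp only [pauli_apply, PiLp.smul_apply, smul_eq_mul, h1, Prod.snd_add, add_dotProduct, csgn_add,
    h2]
  ring

lemma sympForm_eq_dotProduct (u w : BinVec n) :
    sympForm u w = u.2 ⬝ᵥ w.1 + w.2 ⬝ᵥ u.1 := by
  simp only [sympForm, dotProduct, ← Finset.sum_add_distrib]
  refine Finset.sum_congr rfl fun i _ => ?_
  rw [CharTwo.sub_eq_add]
  ring

lemma pauli_comm (u w : BinVec n) (ψ : Qubits n) :
    pauli u (pauli w ψ) = csgn (sympForm u w) • pauli w (pauli u ψ) := by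
  rw [pauli_pauli, pauli_pauli, smul_smul, sympForm_eq_dotProduct, csgn_add, mul_assoc,
    csgn_mul_self, mul_one, add_comm u]

lemma inner_pauli_pauli (u : BinVec n) (φ ψ : Qubits n) :
    inner ℂ (pauli u φ) (pauli u ψ) = inner ℂ φ ψ := by
  simp only [PiLp.inner_apply, pauli_apply]
  rw [← Equiv.sum_comp (Equiv.subRight u.1) fun x => inner ℂ (φ x) (ψ x)]
  refine Finset.sum_congr rfl fun x _ => ?_
  simp only [RCLike.inner_apply, map_mul, conj_csgn, Equiv.subRight_apply]
  have := csgn_mul_self (u.2 ⬝ᵥ (x - u.1))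
  linear_combination (ψ (x - u.1) * (starRingEnd ℂ) (φ (x - u.1))) * this

lemma pauli_eq_zero {u : BinVec n} {ψ : Qubits n} (h : pauli u ψ = 0) : ψ = 0 := by
  rw [← inner_self_eq_zero (𝕜 := ℂ), ← inner_pauli_pauli u, h, inner_zero_left]

lemma sum_csgn {b : Fin n → ZMod 2} (hb : b ≠ 0) :
    ∑ x : Fin n → ZMod 2, csgn (b ⬝ᵥ x) = 0 := by
  obtain ⟨i, hi⟩ := Function.ne_iff.1 hb
  have h1 := Equiv.sum_comp (Equiv.addRight (Pi.single i 1 : Fin n → ZMod 2))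
    fun x => csgn (b ⬝ᵥ x)
  simp only [Equiv.coe_addRight, dotProduct_add, csgn_add, dotProduct_single, mul_one,
    csgn_of_ne_zero hi, mul_neg, Finset.sum_neg_distrib] at h1
  have h2 : (2 : ℂ) * ∑ x : Fin n → ZMod 2, csgn (b ⬝ᵥ x) = 0 := by linear_combination -h1
  simpa using h2

/-- With a nonzero flip part the diagonal vanishes; otherwise the trace is the sum of a nontrivial
character. -/
lemma trace_pauli {u : BinVec n} (hu : u ≠ 0) : LinearMap.trace ℂ (Qubits n) (pauli u) = 0 := by
  rw [LinearMap.trace_eq_sum_inner _ (EuclideanSpace.basisFun (Fin n → ZMod 2) ℂ)]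
  have h1 : ∀ x, inner ℂ (EuclideanSpace.basisFun (Fin n → ZMod 2) ℂ x)
      (pauli u (EuclideanSpace.basisFun (Fin n → ZMod 2) ℂ x)) =
      if u.1 = 0 then csgn (u.2 ⬝ᵥ x) else 0 := by
    intro x
    rw [EuclideanSpace.basisFun_inner, pauli_apply, EuclideanSpace.basisFun_apply]
    split_ifs with h
    · simp [h]
    · have : x - u.1 ≠ x := by simpa [sub_eq_self] using h
      simp [this]
  rw [Finset.sum_congr rfl fun x _ => h1 x]
  split_ifs with h
  · exact sum_csgn fun h2 => hu (Prod.ext h h2)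
  · simp

lemma trace_pauli_zero : LinearMap.trace ℂ (Qubits n) (pauli 0) = 2 ^ n := by
  have : (pauli 0 : Qubits n →ₗ[ℂ] Qubits n) = LinearMap.id := LinearMap.ext pauli_zero
  rw [this, LinearMap.trace_id, finrank_euclideanSpace]
  simp [ZMod.card]

/-! ### Stabilizer codes -/

/-- The operators commute, since `D` is isotropic, and are added one at a time: a common eigenvector
is projected to an eigenspace of the new operator without leaving the old ones. -/
lemma exists_joint_eigenvector {D : Submodule (ZMod 2) (BinVec n)} (hD : D ≤ sympDual D) :
    ∃ ψ : Qubits n, ψ ≠ 0 ∧ ∀ u ∈ D, ∃ c : ℂ, pauli u ψ = c • ψ := by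
  classical
  suffices h : ∀ S : Finset (BinVec n), (∀ u ∈ S, u ∈ D) →
      ∃ ψ : Qubits n, ψ ≠ 0 ∧ ∀ u ∈ S, ∃ c : ℂ, pauli u ψ = c • ψ by
    obtain ⟨ψ, h0, h1⟩ := h (Finset.univ.filter (· ∈ D)) (by simp)
    exact ⟨ψ, h0, fun u hu => h1 u (by simp [hu])⟩
  intro S
  induction S using Finset.induction_on with
  | empty =>
    intro _
    exact ⟨EuclideanSpace.single 0 1, by simp, by simp⟩
  | insert w S _ ih =>
    intro hS
    obtain ⟨ψ, h0, h1⟩ := ih fun u hu => hS u (Finset.mem_insert_of_mem hu)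
    have hw : w ∈ D := hS w (Finset.mem_insert_self _ _)
    -- The new operator P has square ±1; `c` is a square root of that sign, so P^2 = c^2 and c^4 =
    -- 1.
    obtain ⟨c, hc⟩ := IsAlgClosed.exists_eq_mul_self (csgn (w.2 ⬝ᵥ w.1))
    have hww : pauli w (pauli w ψ) = (c * c) • ψ := by
      rw [pauli_pauli, show w + w = 0 by ext i <;> exact CharTwo.add_self_eq_zero _, pauli_zero,
        hc]
    have hcc : c * c * (c * c) = 1 := by rw [← hc, csgn_mul_self]
    have hS' : ∀ a : ℂ, ∀ u ∈ S, ∃ b : ℂ, pauli u (ψ + a • pauli w ψ) = b • (ψ + a • pauli w ψ) := by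
      intro a u hu
      obtain ⟨b, hb⟩ := h1 u hu
      have huw : sympForm u w = 0 := hD hw u (hS u (Finset.mem_insert_of_mem hu))
      refine ⟨b, ?_⟩
      rw [map_add, map_smul, pauli_comm, huw, csgn_zero, one_smul, hb, map_smul, smul_add,
        smul_comm]
    -- From a^2 = c^2 and c^4 = 1 it follows that ψ + aPψ, if nonzero, is an eigenvector of P with
    -- eigenvalue ac^2.
    have key : ∀ a : ℂ, a * a = c * c → ψ + a • pauli w ψ ≠ 0 →
        ∃ ψ : Qubits n, ψ ≠ 0 ∧ ∀ u ∈ insert w S, ∃ c : ℂ, pauli u ψ = c • ψ := by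
      intro a ha hne
      refine ⟨_, hne, fun u hu => ?_⟩
      obtain rfl | hu := Finset.mem_insert.1 hu
      · refine ⟨a * (c * c), ?_⟩
        rw [map_add, map_smul, hww, smul_add, smul_smul, smul_smul, mul_right_comm, ha, hcc,
          one_smul, add_comm]
      · exact hS' a u hu
    -- The vectors for a = c and a = -c add up to 2ψ, so they cannot both be zero.
    by_cases hne : ψ + c • pauli w ψ = 0
    · refine key (-c) (by ring) fun hne' => h0 ?_
      have h2 : (2 : ℂ) • ψ = (ψ + c • pauli w ψ) + (ψ + (-c) • pauli w ψ) := by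
        rw [two_smul, neg_smul]; abel
      rw [hne, hne', add_zero] at h2
      simpa using h2
    · exact key c rfl hne

/-- The joint eigenspace of the operators `pauli u`, for `u` in `D`, with eigenvalues `χ u`. -/
noncomputable def jointEigenspace (D : Submodule (ZMod 2) (BinVec n)) (χ : BinVec n → ℂ) :
    Submodule ℂ (Qubits n) where
  carrier := {ψ | ∀ u ∈ D, pauli u ψ = χ u • ψ}
  zero_mem' u _ := by simp
  add_mem' hφ hψ u hu := by rw [map_add, hφ u hu, hψ u hu, smul_add]
  smul_mem' c ψ hψ u hu := by rw [map_smul, hψ u hu, smul_comm]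

variable {D : Submodule (ZMod 2) (BinVec n)} {χ : BinVec n → ℂ} {ψ₀ : Qubits n}

lemma conj_mul_eigenvalue (h0 : ψ₀ ≠ 0) (hψ₀ : ψ₀ ∈ jointEigenspace D χ) {u : BinVec n}
    (hu : u ∈ D) : (starRingEnd ℂ) (χ u) * χ u = 1 := by
  have h1 := inner_pauli_pauli u ψ₀ ψ₀
  rw [hψ₀ u hu, inner_smul_left, inner_smul_right, ← mul_assoc] at h1
  exact mul_right_cancel₀ (inner_self_ne_zero.2 h0) (h1.trans (one_mul _).symm)

lemma eigenvalue_ne_zero (h0 : ψ₀ ≠ 0) (hψ₀ : ψ₀ ∈ jointEigenspace D χ) {u : BinVec n}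
    (hu : u ∈ D) : χ u ≠ 0 := by
  intro h; simpa [h] using conj_mul_eigenvalue h0 hψ₀ hu

/-- The eigenvalues form a character of `D` up to the sign that occurs in the product of Pauli
operators. -/
lemma eigenvalue_mul (h0 : ψ₀ ≠ 0) (hψ₀ : ψ₀ ∈ jointEigenspace D χ) {u w : BinVec n}
    (hu : u ∈ D) (hw : w ∈ D) : χ u * χ w = csgn (u.2 ⬝ᵥ w.1) * χ (u + w) := by
  have h1 := pauli_pauli u w ψ₀
  rw [hψ₀ w hw, map_smul, hψ₀ u hu, hψ₀ _ (D.add_mem hu hw), smul_smul, smul_smul] at h1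
  rw [mul_comm, ← sub_eq_zero]
  rw [← sub_eq_zero, ← sub_smul] at h1
  exact (smul_eq_zero.1 h1).resolve_right h0

open Classical in
/-- The projection onto the joint eigenspace. -/
noncomputable def eigenProj (D : Submodule (ZMod 2) (BinVec n)) (χ : BinVec n → ℂ) :
    Qubits n →ₗ[ℂ] Qubits n :=
  (Nat.card D : ℂ)⁻¹ • ∑ u : D, (χ u)⁻¹ • pauli (u : BinVec n)

open Classical in
lemma eigenProj_apply (ψ : Qubits n) : eigenProj D χ ψ =
    (Nat.card D : ℂ)⁻¹ • ∑ u : D, (χ u)⁻¹ • pauli (u : BinVec n) ψ := by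
  simp [eigenProj, LinearMap.sum_apply]

lemma natCard_ne_zero (D : Submodule (ZMod 2) (BinVec n)) : (Nat.card D : ℂ) ≠ 0 :=
  Nat.cast_ne_zero.2 Nat.card_pos.ne'

-- Applying an operator of `D` permutes the terms of the average, and the twisted multiplicativity
-- of `χ` absorbs the signs.
open Classical in
lemma isProj_eigenProj (h0 : ψ₀ ≠ 0) (hψ₀ : ψ₀ ∈ jointEigenspace D χ) :
    LinearMap.IsProj (jointEigenspace D χ) (eigenProj D χ) where
  map_mem ψ w hw := by
    rw [eigenProj_apply, map_smul, map_sum, smul_comm]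
    congr 1
    rw [Finset.smul_sum, ← Equiv.sum_comp (Equiv.addLeft (⟨w, hw⟩ : D))
      fun u : D => χ w • (χ u)⁻¹ • pauli (u : BinVec n) ψ]
    refine Finset.sum_congr rfl fun u _ => ?_
    rw [map_smul, pauli_pauli, smul_smul, Equiv.coe_addLeft, Submodule.coe_add, smul_smul]
    congr 1
    have h1 := eigenvalue_mul h0 hψ₀ hw u.2
    have h2 := eigenvalue_ne_zero h0 hψ₀ u.2
    have h3 := eigenvalue_ne_zero h0 hψ₀ (D.add_mem hw u.2)
    have h4 := csgn_mul_self (w.2 ⬝ᵥ u.1.1)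
    field_simp
    linear_combination -h1
  map_id ψ hψ := by
    rw [eigenProj_apply, Finset.sum_congr rfl (g := fun _ => ψ), Finset.sum_const,
      ← Nat.cast_smul_eq_nsmul ℂ, smul_smul, Finset.card_univ, ← Nat.card_eq_fintype_card,
      inv_mul_cancel₀ (natCard_ne_zero D), one_smul]
    intro u _
    rw [hψ u u.2, smul_smul, inv_mul_cancel₀ (eigenvalue_ne_zero h0 hψ₀ u.2), one_smul]

lemma eigenvalue_zero (h0 : ψ₀ ≠ 0) (hψ₀ : ψ₀ ∈ jointEigenspace D χ) : χ 0 = 1 := by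
  have h1 := hψ₀ 0 D.zero_mem
  rw [pauli_zero, eq_comm, ← sub_eq_zero] at h1
  nth_rewrite 2 [← one_smul ℂ ψ₀] at h1
  rw [← sub_smul] at h1
  exact sub_eq_zero.1 ((smul_eq_zero.1 h1).resolve_right h0)

/-- The dimension is the trace of the projection, to which only the identity operator contributes.
-/
lemma finrank_jointEigenspace (h0 : ψ₀ ≠ 0) (hψ₀ : ψ₀ ∈ jointEigenspace D χ) :
    (Module.finrank ℂ (jointEigenspace D χ) : ℂ) = (Nat.card D : ℂ)⁻¹ * 2 ^ n := by
  rw [← (isProj_eigenProj h0 hψ₀).trace, eigenProj, map_smul, map_sum, smul_eq_mul]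
  congr 1
  rw [Finset.sum_eq_single (0 : D)]
  · rw [map_smul, Submodule.coe_zero, trace_pauli_zero, eigenvalue_zero h0 hψ₀]; simp
  · intro u _ hu
    rw [map_smul, trace_pauli (by simpa using hu), smul_zero]
  · simp

-- Such an operator preserves the eigenspace; if it were detected it would act there as a scalar
-- `c`. Composed with the projection it has trace zero, because `u + w` is never 0 for `w` in `D`.
-- Hence `c = 0`, contradicting injectivity.
open Classical in
lemma not_detects (h0 : ψ₀ ≠ 0) (hψ₀ : ψ₀ ∈ jointEigenspace D χ) {u : BinVec n}
    (hu : u ∈ sympDual D) (hu' : u ∉ D) : ¬ Detects (jointEigenspace D χ) (pauli u) := by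
  rintro ⟨c, hc⟩
  have hmem : ∀ ψ ∈ jointEigenspace D χ, pauli u ψ ∈ jointEigenspace D χ := by
    intro ψ hψ w hw
    rw [pauli_comm, hu w hw, csgn_zero, one_smul, hψ w hw, map_smul]
  -- The difference of the two sides lies in the eigenspace and is orthogonal to it.
  have hscal : ∀ ψ ∈ jointEigenspace D χ, pauli u ψ = c • ψ := by
    intro ψ hψ
    set Q := jointEigenspace D χ
    have hφ : pauli u ψ - c • ψ ∈ Q := Q.sub_mem (hmem ψ hψ) (Q.smul_mem c hψ)
    rw [← sub_eq_zero, ← inner_self_eq_zero (𝕜 := ℂ)]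
    rw [inner_sub_right, hc _ hφ _ hψ, inner_smul_right, sub_self]
  have htr : LinearMap.trace ℂ (Qubits n) (pauli u ∘ₗ eigenProj D χ) = 0 := by
    have : pauli u ∘ₗ eigenProj D χ = (Nat.card D : ℂ)⁻¹ •
        ∑ w : D, ((χ w)⁻¹ * csgn (u.2 ⬝ᵥ w.1.1)) • pauli (u + w.1) := by
      ext1 ψ
      simp only [LinearMap.comp_apply, eigenProj_apply, map_smul, map_sum, LinearMap.smul_apply,
        LinearMap.sum_apply, pauli_pauli, smul_smul]
    rw [this, map_smul, map_sum, Finset.sum_eq_zero, smul_zero]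
    intro w _
    rw [map_smul, trace_pauli, smul_zero]
    intro hw
    refine hu' ?_
    have h1 : u = -w.1 := eq_neg_of_add_eq_zero_left hw
    rw [h1]; exact D.neg_mem w.2
  have htr' : pauli u ∘ₗ eigenProj D χ = c • eigenProj D χ := by
    ext1 ψ
    exact hscal _ ((isProj_eigenProj h0 hψ₀).map_mem ψ)
  rw [htr', map_smul, (isProj_eigenProj h0 hψ₀).trace, finrank_jointEigenspace h0 hψ₀,
    smul_eq_mul] at htr
  have hc0 : c = 0 := by
    exact (mul_eq_zero.1 htr).resolve_right (mul_ne_zero (inv_ne_zero (natCard_ne_zero D))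
      (pow_ne_zero _ two_ne_zero))
  have h1 := hscal ψ₀ hψ₀
  rw [hc0, zero_smul] at h1
  exact h0 (pauli_eq_zero h1)

/-- The error anticommutes with some operator of `D`, which is unitary and acts on both vectors by
the same scalar of modulus 1; so the inner product equals its own negative. -/
lemma inner_pauli_eq_zero (h0 : ψ₀ ≠ 0) (hψ₀ : ψ₀ ∈ jointEigenspace D χ) {u : BinVec n}
    (hu : u ∉ sympDual D) {φ ψ : Qubits n} (hφ : φ ∈ jointEigenspace D χ)
    (hψ : ψ ∈ jointEigenspace D χ) : inner ℂ φ (pauli u ψ) = 0 := by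
  have h' : ∃ w ∈ D, sympForm w u ≠ 0 := by
    by_contra hcon
    push Not at hcon
    exact hu hcon
  obtain ⟨w, hw, hwu⟩ := h'
  have h1 := inner_pauli_pauli w φ (pauli u ψ)
  rw [pauli_comm, csgn_of_ne_zero hwu, hφ w hw, hψ w hw, map_smul, inner_smul_left,
    inner_smul_right, inner_smul_right] at h1
  have h2 := conj_mul_eigenvalue h0 hψ₀ hw
  have h3 : (2 : ℂ) * inner ℂ φ (pauli u ψ) = 0 := by
    linear_combination -h1 - inner ℂ φ (pauli u ψ) * h2
  simpa using h3

/-- A pure quantum code from a binary code that contains its symplectic dual and has no shorter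
vectors than outside of the dual. -/
theorem exists_quantumCode {C : Submodule (ZMod 2) (BinVec n)} {k d : ℕ} (hC : sympDual C ≤ C)
    (hcard : Nat.card (sympDual C) * 2 ^ k = 2 ^ n)
    (hmin : ∀ u ∈ C, u ≠ 0 → d ≤ sympWeight u)
    (hd : ∃ u ∈ C, u ∉ sympDual C ∧ sympWeight u = d) :
    ∃ Q : Submodule ℂ (Qubits n), IsStabilizerCode C Q ∧ IsQuantumCode Q k d ∧ IsPure Q d := by
  have hCC := sympDual_sympDual C
  obtain ⟨ψ₀, h0, hev⟩ := exists_joint_eigenvector (D := sympDual C) (by rwa [hCC])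
  choose! χ hχ using hev
  have hψ₀ : ψ₀ ∈ jointEigenspace (sympDual C) χ := hχ
  refine ⟨jointEigenspace (sympDual C) χ, ⟨χ, fun ψ => Iff.rfl⟩, ⟨?_, ?_, ?_⟩, ?_⟩
  · have h1 := finrank_jointEigenspace h0 hψ₀
    have h2 : (Nat.card (sympDual C) : ℂ) * 2 ^ k = 2 ^ n := by exact_mod_cast hcard
    rw [← h2, inv_mul_cancel_left₀ (natCard_ne_zero _)] at h1
    exact_mod_cast h1
  · obtain ⟨u, hu, hu', hw⟩ := hd
    exact ⟨u, hw, not_detects h0 hψ₀ (by rwa [hCC]) hu'⟩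
  · rintro _ ⟨u, rfl, hu⟩
    -- The identity is detected with constant 1, so an undetected error in `C` is nonzero; an error
    -- outside `C` is detected with constant 0.
    by_cases huC : u ∈ C
    · refine hmin u huC ?_
      rintro rfl
      exact hu ⟨1, fun φ _ ψ _ => by rw [pauli_zero, one_mul]⟩
    · refine absurd ⟨0, fun φ hφ ψ hψ => ?_⟩ hu
      rw [inner_pauli_eq_zero h0 hψ₀ (by rwa [hCC]) hφ hψ, zero_mul]
  · intro u hu0 hlt φ hφ ψ hψ
    refine inner_pauli_eq_zero h0 hψ₀ (fun huC => ?_) hφ hψ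
    rw [hCC] at huC
    exact absurd (hmin u huC hu0) (by omega)

end QuantumQC

namespace QuantumQC

/-! ### Binary polynomials as natural numbers -/

def b2z (b : Bool) : ZMod 2 := cond b 1 0

lemma b2z_xor (a b : Bool) : b2z (a ^^ b) = b2z a + b2z b := by
  cases a <;> cases b <;> rfl

lemma b2z_and (a b : Bool) : b2z (a && b) = b2z a * b2z b := by
  cases a <;> cases b <;> rfl

lemma b2z_injective : Function.Injective b2z := by
  intro a b; cases a <;> cases b <;> simp [b2z]

/-- The binary polynomial whose coefficients are the binary digits of `u`. -/
noncomputable def toPoly (u : ℕ) : (ZMod 2)[X] :=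
  ∑ i ∈ Finset.range u.size, C (b2z (u.testBit i)) * X ^ i

lemma coeff_toPoly (u i : ℕ) : (toPoly u).coeff i = b2z (u.testBit i) := by
  rw [toPoly, finsetSum_coeff]
  simp only [coeff_C_mul, coeff_X_pow, mul_ite, mul_one, mul_zero]
  rw [Finset.sum_ite_eq, ite_eq_left_iff]
  intro h
  rw [Finset.mem_range, not_lt] at h
  rw [Nat.testBit_lt_two_pow (Nat.size_le.1 h)]; rfl

lemma toPoly_zero : toPoly 0 = 0 := by
  ext i; simp [coeff_toPoly, b2z]

lemma toPoly_xor (u v : ℕ) : toPoly (u ^^^ v) = toPoly u + toPoly v := by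
  ext i
  rw [coeff_add, coeff_toPoly, coeff_toPoly, coeff_toPoly, Nat.testBit_xor, b2z_xor]

lemma toPoly_two_pow (k : ℕ) : toPoly (2 ^ k) = X ^ k := by
  ext i
  rw [coeff_toPoly, coeff_X_pow, Nat.testBit_two_pow]
  by_cases h : k = i
  · simp [h, b2z]
  · simp [h, b2z, Ne.symm h]

lemma toPoly_one : toPoly 1 = 1 := by simpa using toPoly_two_pow 0

lemma toPoly_shiftLeft (u k : ℕ) : toPoly (u <<< k) = X ^ k * toPoly u := by
  ext i
  rw [coeff_toPoly, coeff_X_pow_mul', coeff_toPoly, Nat.testBit_shiftLeft]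
  split_ifs with h <;> simp [h, b2z]

lemma toPoly_bit (u : ℕ) : toPoly u = C (b2z (u.testBit 0)) + X * toPoly (u >>> 1) := by
  ext i
  rw [coeff_add, coeff_C]
  cases i with
  | zero => simp [coeff_toPoly]
  | succ i =>
    rw [coeff_X_mul, coeff_toPoly, coeff_toPoly, Nat.testBit_shiftRight]
    simp [add_comm]

lemma toPoly_two_pow_xor_one (n : ℕ) : toPoly (2 ^ n ^^^ 1) = X ^ n - 1 := by
  rw [toPoly_xor, toPoly_two_pow, toPoly_one, CharTwo.sub_eq_add]

lemma degree_toPoly_lt {u n : ℕ} (h : u < 2 ^ n) : (toPoly u).degree < n := by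
  rw [degree_lt_iff_coeff_zero]
  intro i hi
  rw [coeff_toPoly, Nat.testBit_lt_two_pow (h.trans_le (Nat.pow_le_pow_right two_pos hi))]; rfl

lemma natDegree_toPoly {u : ℕ} (h : u ≠ 0) : (toPoly u).natDegree = u.log2 := by
  refine natDegree_eq_of_le_of_coeff_ne_zero ?_ ?_
  · rw [natDegree_le_iff_coeff_eq_zero]
    intro i hi
    rw [coeff_toPoly, Nat.testBit_lt_two_pow, b2z, cond_false]
    exact Nat.lt_log2_self.trans_le (Nat.pow_le_pow_right two_pos hi)
  · rw [coeff_toPoly, Nat.testBit_log2 h]; decide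

/-- Multiplication of binary polynomials. -/
def clmul : ℕ → ℕ → ℕ → ℕ
  | 0, _, _ => 0
  | k + 1, a, b => Nat.xor (cond (bit a 0) b 0)
      (Nat.shiftLeft (clmul k (Nat.shiftRight a 1) b) 1)

lemma toPoly_clmul (k a b : ℕ) (h : a < 2 ^ k) :
    toPoly (clmul k a b) = toPoly a * toPoly b := by
  induction k generalizing a with
  | zero =>
    obtain rfl : a = 0 := by simpa using h
    simp [clmul, toPoly_zero]
  | succ k ih =>
    have h' : a >>> 1 < 2 ^ k := by
      rw [Nat.shiftRight_eq_div_pow, pow_one]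
      rw [pow_succ] at h
      omega
    rw [clmul, xor_eq, shiftRight_eq, shiftLeft_eq, toPoly_xor, toPoly_shiftLeft, ih _ h',
      toPoly_bit a, bit_eq]
    cases a.testBit 0 <;> simp [b2z, toPoly_zero] <;> ring

/-- The number with the binary digits given in run-length form. -/
def runNat : List (ZMod 2 × ℕ) → ℕ
  | [] => 0
  | (a, m) :: l => Nat.xor (cond (Nat.beq a.val 0) 0 (ones m)) (Nat.shiftLeft (runNat l) m)

lemma toPoly_ones (m : ℕ) : toPoly (ones m) = ∑ i ∈ Finset.range m, X ^ i := by
  ext i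
  rw [coeff_toPoly, testBit_ones, finsetSum_coeff]
  simp [coeff_X_pow, b2z, Bool.cond_decide]

lemma runPoly_eq (l : List (ZMod 2 × ℕ)) : runPoly l = toPoly (runNat l) := by
  induction l with
  | nil => simp [runPoly, runNat, toPoly_zero]
  | cons p l ih =>
    obtain ⟨a, m⟩ := p
    rw [runPoly, runNat, xor_eq, shiftLeft_eq, toPoly_xor, toPoly_shiftLeft, ih]
    have h : a = 0 ∨ a = 1 := by revert a; decide
    obtain rfl | rfl := h
    · simp [toPoly_zero]
    · rw [show Nat.beq (1 : ZMod 2).val 0 = false from rfl, cond_false, toPoly_ones, map_one,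
        one_mul]

/-! ### Residues modulo `x ^ n - 1` -/

variable {n : ℕ}

lemma monic_X_pow_sub_one (hn : 0 < n) : (X ^ n - 1 : (ZMod 2)[X]).Monic :=
  monic_X_pow_sub_C 1 hn.ne'

lemma degree_X_pow_sub_one (hn : 0 < n) : (X ^ n - 1 : (ZMod 2)[X]).degree = n :=
  degree_X_pow_sub_C hn 1

lemma vec_eq_vec_iff (hn : 0 < n) {f g : (ZMod 2)[X]} : vec n f = vec n g ↔ X ^ n - 1 ∣ f - g := by
  have h1 := monic_X_pow_sub_one hn
  rw [← modByMonic_eq_zero_iff_dvd h1, sub_modByMonic, sub_eq_zero]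
  constructor
  · intro h
    ext i
    by_cases hi : i < n
    · exact congrFun h ⟨i, hi⟩
    · have hz : ∀ f : (ZMod 2)[X], (f %ₘ (X ^ n - 1)).coeff i = 0 := by
        intro f
        refine coeff_eq_zero_of_degree_lt ((degree_modByMonic_lt f h1).trans_le ?_)
        rw [degree_X_pow_sub_one hn]
        exact_mod_cast not_lt.1 hi
      rw [hz, hz]
  · intro h
    funext i
    exact congrArg (fun p => coeff p i) h

lemma vec_apply_of_degree_lt (hn : 0 < n) {f : (ZMod 2)[X]} (hf : f.degree < n) (i : Fin n) :
    vec n f i = f.coeff i := by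
  change (f %ₘ (X ^ n - 1)).coeff i = _
  rw [(modByMonic_eq_self_iff (monic_X_pow_sub_one hn)).2 (by rwa [degree_X_pow_sub_one hn])]

lemma vec_X_pow_mul (hn : 0 < n) (f : (ZMod 2)[X]) (j : ℕ) :
    vec n (X ^ (j + n) * f) = vec n (X ^ j * f) := by
  rw [vec_eq_vec_iff hn]
  exact ⟨X ^ j * f, by ring⟩

/-- The vector whose two halves are formed by the binary digits of `u`. -/
def toVec (n u : ℕ) : BinVec n :=
  (fun i => b2z (u.testBit i), fun i => b2z (u.testBit (n + i)))

lemma toVec_xor (u w : ℕ) : toVec n (u ^^^ w) = toVec n u + toVec n w := by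
  refine Prod.ext (funext fun i => ?_) (funext fun i => ?_) <;>
    simp [toVec, Nat.testBit_xor, b2z_xor]

lemma toVec_zero : toVec n 0 = 0 := by
  refine Prod.ext (funext fun i => ?_) (funext fun i => ?_) <;> simp [toVec, b2z]

lemma toVec_injOn {u w : ℕ} (hu : u < 2 ^ (2 * n)) (hw : w < 2 ^ (2 * n))
    (h : toVec n u = toVec n w) : u = w := by
  refine Nat.eq_of_testBit_eq fun i => ?_
  by_cases h1 : i < n
  · exact b2z_injective (congrFun (congrArg Prod.fst h) ⟨i, h1⟩)
  · by_cases h2 : i < 2 * n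
    · have := b2z_injective (congrFun (congrArg Prod.snd h) ⟨i - n, by omega⟩)
      simpa [Nat.add_sub_cancel' (not_lt.1 h1)] using this
    · have hle : 2 ^ (2 * n) ≤ 2 ^ i := Nat.pow_le_pow_right two_pos (by omega)
      rw [Nat.testBit_lt_two_pow (hu.trans_le hle), Nat.testBit_lt_two_pow (hw.trans_le hle)]

lemma sympWeight_toVec (u : ℕ) : sympWeight (toVec n u) = natWeight n u := by
  rw [sympWeight, natWeight, Finset.card_filter,
    ← Fin.sum_univ_eq_sum_range fun i => (u.testBit i || u.testBit (n + i)).toNat]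
  refine Finset.sum_congr rfl fun i _ => ?_
  simp only [toVec]
  obtain h1 | h1 := Bool.eq_false_or_eq_true (u.testBit i) <;>
    obtain h2 | h2 := Bool.eq_false_or_eq_true (u.testBit (n + i)) <;> simp [h1, h2, b2z]

lemma val_finRotate (i : Fin n) :
    (finRotate n i : ℕ) = if (i : ℕ) + 1 = n then 0 else (i : ℕ) + 1 := by
  obtain _ | k := n
  · exact i.elim0
  · rw [coe_finRotate]
    simp [Fin.ext_iff]

lemma toVec_rot (u : ℕ) (i : Fin n) : (toVec n (rot n u)).1 (finRotate n i) = (toVec n u).1 i ∧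
    (toVec n (rot n u)).2 (finRotate n i) = (toVec n u).2 i := by
  have hi := i.2
  have hn : 0 < n := by omega
  simp only [toVec, testBit_rot _ _ _ hn, val_finRotate]
  by_cases h1 : (i : ℕ) + 1 = n
  · have h2 : (i : ℕ) = n - 1 := by omega
    have h3 : n + (n - 1) = 2 * n - 1 := by omega
    rw [if_pos h1, if_pos hn, if_pos rfl, if_neg (by omega), if_pos (by omega),
      if_pos (add_zero n), h2, h3]
    exact ⟨rfl, rfl⟩
  · rw [if_neg h1, if_pos (by omega), if_neg (by omega), if_neg (by omega), if_pos (by omega),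
      if_neg (by omega), Nat.add_sub_cancel, ← add_assoc, Nat.add_sub_cancel]
    exact ⟨rfl, rfl⟩

lemma sympForm_rot (u w : ℕ) :
    sympForm (toVec n (rot n u)) (toVec n (rot n w)) = sympForm (toVec n u) (toVec n w) := by
  refine (Fintype.sum_equiv (finRotate n) _ _ fun i => ?_).symm
  rw [(toVec_rot u i).1, (toVec_rot u i).2, (toVec_rot w i).1, (toVec_rot w i).2]

/-- The multiples of a pair of polynomials, as vectors. -/
noncomputable def pairVec (n : ℕ) (f g : (ZMod 2)[X]) : BinVec n := (vec n f, vec n g)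

lemma vec_X_mul (hn : 0 < n) (f : (ZMod 2)[X]) (i : Fin n) :
    vec n (X * f) (finRotate n i) = vec n f i := by
  set r := f %ₘ (X ^ n - 1) with hr
  have h1 := monic_X_pow_sub_one hn
  have hdeg : r.degree < n := by
    rw [← degree_X_pow_sub_one hn]; exact degree_modByMonic_lt f h1
  have hfr : X ^ n - 1 ∣ f - r := by
    rw [← modByMonic_add_div f (X ^ n - 1), ← hr]
    exact ⟨f /ₘ (X ^ n - 1), by ring⟩
  -- Removing the overflow of the top coefficient makes x times the residue reduced again.
  have e1 : vec n (X * f) = vec n (X * r - C (r.coeff (n - 1)) * (X ^ n - 1)) := by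
    rw [vec_eq_vec_iff hn]
    obtain ⟨q, hq⟩ := hfr
    exact ⟨X * q + C (r.coeff (n - 1)), by linear_combination X * hq⟩
  have hdeg' : (X * r - C (r.coeff (n - 1)) * (X ^ n - 1)).degree < (n : WithBot ℕ) := by
    rw [degree_lt_iff_coeff_zero]
    intro j hj
    obtain ⟨k, rfl⟩ : ∃ k, j = k + 1 := ⟨j - 1, by omega⟩
    rw [coeff_sub, coeff_X_mul, coeff_C_mul, coeff_sub, coeff_X_pow, coeff_one]
    obtain h | h := hj.eq_or_lt
    · have h' : r.coeff k = r.coeff (n - 1) := by congr 1; omega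
      rw [if_pos h.symm, if_neg (Nat.succ_ne_zero k), h', sub_zero, mul_one, sub_self]
    · rw [coeff_eq_zero_of_degree_lt (hdeg.trans_le (by exact_mod_cast (by omega : n ≤ k)))]
      simp [h.ne']
  rw [e1, vec_apply_of_degree_lt hn hdeg', val_finRotate]
  change _ = r.coeff i
  have hi := i.2
  split_ifs with h
  · have : (i : ℕ) = n - 1 := by omega
    rw [this, coeff_sub, mul_coeff_zero, coeff_X_zero, coeff_C_mul, coeff_sub, coeff_X_pow,
      if_neg hn.ne, coeff_one_zero]
    ring
  · rw [coeff_sub, coeff_X_mul, coeff_C_mul, coeff_sub, coeff_X_pow, coeff_one]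
    simp [h]

lemma pairVec_X_mul (hn : 0 < n) {f g : (ZMod 2)[X]} {u : ℕ} (h : pairVec n f g = toVec n u) :
    pairVec n (X * f) (X * g) = toVec n (rot n u) := by
  refine Prod.ext (funext fun i => ?_) (funext fun i => ?_) <;>
    obtain ⟨i, rfl⟩ := (finRotate n).surjective i
  · rw [(toVec_rot u i).1, ← h]; exact vec_X_mul hn f i
  · rw [(toVec_rot u i).2, ← h]; exact vec_X_mul hn g i

lemma pairVec_X_pow_mul (hn : 0 < n) {f g : (ZMod 2)[X]} {u : ℕ} (h : pairVec n f g = toVec n u)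
    (j : ℕ) : pairVec n (X ^ j * f) (X ^ j * g) = toVec n (rotIter n u j) := by
  induction j with
  | zero => simpa [rotIter] using h
  | succ j ih =>
    rw [rotIter, ← pairVec_X_mul hn ih, pow_succ', mul_assoc, mul_assoc]

lemma pairVec_add (f g f' g' : (ZMod 2)[X]) :
    pairVec n (f + f') (g + g') = pairVec n f g + pairVec n f' g' := by
  simp [pairVec]

/-- The link between the two pictures: multiplication by a polynomial modulo x^n - 1 is `comb` on
the list of shifts. -/
lemma pairVec_toPoly_mul (hn : 0 < n) {f g : (ZMod 2)[X]} {u : ℕ} (h : pairVec n f g = toVec n u)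
    (t a : ℕ) (ha : a < 2 ^ t) :
    pairVec n (toPoly a * f) (toPoly a * g) = toVec n (comb a (shifts n u t)) := by
  -- Truncating `a` to t digits removes the bound on `a` from the induction.
  have key : ∀ t, pairVec n (toPoly (a % 2 ^ t) * f) (toPoly (a % 2 ^ t) * g) =
      toVec n (comb a (shifts n u t)) := by
    intro t
    induction t with
    | zero => simp [Nat.mod_one, toPoly_zero, shifts, comb, toVec_zero, pairVec]
    | succ t ih =>
      have e : toPoly (a % 2 ^ (t + 1)) = C (b2z (a.testBit t)) * X ^ t + toPoly (a % 2 ^ t) := by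
        ext i
        rw [coeff_add, coeff_C_mul, coeff_X_pow, coeff_toPoly, coeff_toPoly,
          Nat.testBit_mod_two_pow, Nat.testBit_mod_two_pow]
        obtain h | rfl | h := lt_trichotomy i t
        · simp [h, h.ne, h.trans (Nat.lt_succ_self t)]
        · simp [b2z]
        · simp [h.ne', not_lt.2 h.le, show ¬ i < t + 1 by omega, b2z]
      rw [comb_shifts_succ, e, add_mul, add_mul, pairVec_add, ih, toVec_xor]
      congr 1
      cases a.testBit t
      · simp [b2z, toVec_zero, pairVec]
      · simpa [b2z] using pairVec_X_pow_mul hn h t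
  rw [← key, Nat.mod_eq_of_lt ha]

lemma pairVec_of_lt (hn : 0 < n) {a b : ℕ} (ha : a < 2 ^ n) (hb : b < 2 ^ n) :
    pairVec n (toPoly a) (toPoly b) = toVec n (a ||| b <<< n) := by
  refine Prod.ext (funext fun i => ?_) (funext fun i => ?_)
  · refine (vec_apply_of_degree_lt hn (degree_toPoly_lt ha) i).trans ?_
    simp [toVec, coeff_toPoly, Nat.testBit_or, Nat.testBit_shiftLeft, not_le.2 i.2]
  · refine (vec_apply_of_degree_lt hn (degree_toPoly_lt hb) i).trans ?_
    have : a.testBit (n + i) = false :=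
      Nat.testBit_lt_two_pow (ha.trans_le (Nat.pow_le_pow_right two_pos (by omega)))
    simp [toVec, coeff_toPoly, Nat.testBit_or, Nat.testBit_shiftLeft, this]

/-! ### Evaluation of the symplectic form -/

/-- The parity of the first `2 ^ t` binary digits. -/
def parity : ℕ → ℕ → Bool
  | 0, u => bit u 0
  | t + 1, u => parity t (Nat.xor u (Nat.shiftRight u (Nat.pow 2 t)))

/-- Adding the upper half of the digits to the lower half preserves the parity of their sum. -/
lemma b2z_parity (t u : ℕ) : b2z (parity t u) = ∑ i ∈ Finset.range (2 ^ t), b2z (u.testBit i) := by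
  induction t generalizing u with
  | zero => simp [parity, bit_eq]
  | succ t ih =>
    rw [parity, ih, pow_succ, mul_two, Finset.sum_range_add, ← Finset.sum_add_distrib]
    refine Finset.sum_congr rfl fun i _ => ?_
    rw [xor_eq, Nat.testBit_xor, b2z_xor, shiftRight_eq, Nat.testBit_shiftRight]
    rfl

/-- The symplectic form for words of length `2 n`, with `n ≤ 128`. -/
def natSymp (n u w : ℕ) : Bool :=
  parity 8 (Nat.land u (Nat.lor (Nat.shiftRight w n) (Nat.shiftLeft (Nat.land w (ones n)) n)))

/-- Exchanging the halves of `w` turns the form into the parity of a bitwise product; 2^8 digits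
cover 2n as n ≤ 128. -/
lemma sympForm_toVec {u w : ℕ} (hn : n ≤ 128) (hu : u < 2 ^ (2 * n)) (hw : w < 2 ^ (2 * n)) :
    sympForm (toVec n u) (toVec n w) = b2z (natSymp n u w) := by
  have hsplit : ∀ F : ℕ → ZMod 2, (∀ i, 2 * n ≤ i → F i = 0) →
      ∑ i ∈ Finset.range (2 ^ 8), F i =
        ∑ i ∈ Finset.range n, F i + ∑ i ∈ Finset.range n, F (n + i) := by
    intro F hF
    rw [← Finset.sum_range_add, ← Finset.sum_subset (s₁ := Finset.range (n + n))]
    · intro i; simp only [Finset.mem_range]; omega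
    · intro i _ hi
      refine hF i ?_
      simp only [Finset.mem_range] at hi; omega
  have hbig : ∀ i, 2 * n ≤ i → u.testBit i = false := fun i hi =>
    Nat.testBit_lt_two_pow (hu.trans_le (Nat.pow_le_pow_right two_pos hi))
  rw [natSymp, b2z_parity, hsplit, sympForm, ← Finset.sum_add_distrib,
    ← Fin.sum_univ_eq_sum_range (fun i => _) n]
  · refine Finset.sum_congr rfl fun i _ => ?_
    have hi := i.2
    have hwi : w.testBit (n + (n + i)) = false :=
      Nat.testBit_lt_two_pow (hw.trans_le (Nat.pow_le_pow_right two_pos (by omega)))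
    simp only [land_eq, lor_eq, shiftLeft_eq, shiftRight_eq, Nat.testBit_and, Nat.testBit_or,
      Nat.testBit_shiftLeft, Nat.testBit_shiftRight, testBit_ones, toVec, CharTwo.sub_eq_add, hwi]
    rw [b2z_and, b2z_and]
    simp [hi, not_le.2 hi]
  · intro i hi
    rw [land_eq, Nat.testBit_and, hbig i hi]; rfl

end QuantumQC

namespace QuantumQC

/-! ### Two-generator quasi-cyclic codes -/

variable {n : ℕ} {g₁ g₂ v : (ZMod 2)[X]}

lemma pairVec_mem_qcCode (a b : (ZMod 2)[X]) :
    pairVec n (a * (v * g₁) + b * g₂) (a * g₁ + b * (v * g₂)) ∈ qcCode n g₁ g₂ v :=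
  ⟨a, b, rfl⟩

lemma toVec_rot_mem (hn : 0 < n) {u : ℕ} (h : toVec n u ∈ qcCode n g₁ g₂ v) :
    toVec n (rot n u) ∈ qcCode n g₁ g₂ v := by
  obtain ⟨a, b, hab⟩ := h
  rw [← pairVec_X_mul hn (f := a * (v * g₁) + b * g₂) (g := a * g₁ + b * (v * g₂)) hab.symm]
  convert pairVec_mem_qcCode (n := n) (g₁ := g₁) (g₂ := g₂) (v := v) (X * a) (X * b) using 2 <;>
    ring

lemma toVec_comb_shifts_mem {S : Submodule (ZMod 2) (BinVec n)} {u : ℕ}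
    (h : ∀ i, toVec n (rotIter n u i) ∈ S) (t x : ℕ) : toVec n (comb x (shifts n u t)) ∈ S := by
  induction t with
  | zero => simp [shifts, comb, toVec_zero]
  | succ t ih =>
    rw [comb_shifts_succ, toVec_xor]
    refine S.add_mem ?_ ih
    split_ifs
    · exact h t
    · rw [toVec_zero]; exact S.zero_mem

lemma toVec_rotIter_mem (hn : 0 < n) {u : ℕ} (h : toVec n u ∈ qcCode n g₁ g₂ v) (i : ℕ) :
    toVec n (rotIter n u i) ∈ qcCode n g₁ g₂ v := by
  induction i with
  | zero => exact h
  | succ i ih => exact toVec_rot_mem hn ih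

/-- The linear functional that a vector defines on the multiples of a pair of polynomials. -/
noncomputable def pairForm (n : ℕ) (f g : (ZMod 2)[X]) (w : BinVec n) :
    (ZMod 2)[X] →ₗ[ZMod 2] ZMod 2 where
  toFun a := sympForm (pairVec n (a * f) (a * g)) w
  map_add' a b := by rw [add_mul, add_mul, pairVec_add, sympForm_add_left]
  map_smul' c a := by
    rw [RingHom.id_apply, smul_eq_mul, ← sympForm_smul_left]
    congr 1
    simp [pairVec]

/-- Multiplication by x^n is the identity on residues, so a functional on the multiples is
determined by n powers of x. -/
lemma pairForm_eq_zero (hn : 0 < n) {f g : (ZMod 2)[X]} {w : BinVec n}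
    (h : ∀ j < n, sympForm (pairVec n (X ^ j * f) (X ^ j * g)) w = 0) (a : (ZMod 2)[X]) :
    sympForm (pairVec n (a * f) (a * g)) w = 0 := by
  have h' : ∀ j, sympForm (pairVec n (X ^ j * f) (X ^ j * g)) w = 0 := by
    intro j
    induction j using Nat.strong_induction_on with
    | _ j ih =>
      by_cases hj : j < n
      · exact h j hj
      · obtain ⟨i, rfl⟩ := Nat.exists_eq_add_of_le (not_lt.1 hj)
        rw [add_comm, pairVec, vec_X_pow_mul hn, vec_X_pow_mul hn]
        exact ih i (by omega)
  have : pairForm n f g w = 0 := by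
    ext j
    have := h' j
    rw [X_pow_eq_monomial] at this
    simpa [pairForm] using this
  exact congrArg (fun F => F a) this

lemma mem_sympDual_qcCode (w : BinVec n)
    (h₁ : ∀ a, sympForm (pairVec n (a * (v * g₁)) (a * g₁)) w = 0)
    (h₂ : ∀ b, sympForm (pairVec n (b * g₂) (b * (v * g₂))) w = 0) :
    w ∈ sympDual (qcCode n g₁ g₂ v) := by
  rintro u ⟨a, b, rfl⟩
  have := pairVec_add (n := n) (a * (v * g₁)) (a * g₁) (b * g₂) (b * (v * g₂))
  rw [← pairVec, this, sympForm_add_left, h₁, h₂, add_zero]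

def orthCheck (n u w : ℕ) : ℕ → Bool
  | 0 => true
  | i + 1 => cond (natSymp n (rotIter n u i) w) false (orthCheck n u w i)

lemma natSymp_of_orthCheck {u w k : ℕ} (h : orthCheck n u w k = true) {j : ℕ} (hj : j < k) :
    natSymp n (rotIter n u j) w = false := by
  induction k with
  | zero => omega
  | succ k ih =>
    rw [orthCheck] at h
    cases hk : natSymp n (rotIter n u k) w with
    | true => rw [hk] at h; exact absurd h (by simp)
    | false =>
      rw [hk, cond_false] at h
      obtain hj | rfl := Nat.lt_succ_iff_lt_or_eq.1 hj
      · exact ih h hj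
      · exact hk

lemma rotIter_lt (hn : 0 < n) {u : ℕ} (hu : u < 2 ^ (2 * n)) (i : ℕ) :
    rotIter n u i < 2 ^ (2 * n) := by
  cases i with
  | zero => exact hu
  | succ i => exact rot_lt _ _ hn

/-- The form is invariant under simultaneous shifts, so it suffices to test the unshifted `w`
against the n shifts of the generator. -/
lemma sympForm_multiples_rotIter (hn : 0 < n) (hn' : n ≤ 128) {f g : (ZMod 2)[X]} {u w : ℕ}
    (hfg : pairVec n f g = toVec n u) (hu : u < 2 ^ (2 * n)) (hw : w < 2 ^ (2 * n))
    (h : orthCheck n u w n = true) (i : ℕ) (a : (ZMod 2)[X]) :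
    sympForm (pairVec n (a * f) (a * g)) (toVec n (rotIter n w i)) = 0 := by
  induction i generalizing a with
  | zero =>
    refine pairForm_eq_zero hn (fun j hj => ?_) a
    rw [pairVec_X_pow_mul hn hfg, rotIter, sympForm_toVec hn' (rotIter_lt hn hu j) hw,
      natSymp_of_orthCheck h hj]
    rfl
  | succ i ih =>
    have hshift : ∀ j, sympForm (pairVec n (X ^ (j + 1) * f) (X ^ (j + 1) * g))
        (toVec n (rotIter n w (i + 1))) = 0 := by
      intro j
      rw [pairVec_X_pow_mul hn hfg, rotIter, rotIter, sympForm_rot, ← pairVec_X_pow_mul hn hfg]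
      exact ih _
    refine pairForm_eq_zero hn (fun j _ => ?_) a
    -- Modulo x^n - 1 the power x^j equals x^(j+n), whose exponent is positive, so the shift
    -- invariance covers j = 0 as well.
    have := hshift (j + n - 1)
    rwa [show j + n - 1 + 1 = j + n by omega, pairVec, vec_X_pow_mul hn, vec_X_pow_mul hn] at this

/-! ### The dimension of the code -/

/-- With deg a < n - deg g₁ and deg b < n - deg g₂ the pair (a, b) is determined by its codeword,
giving 2n - deg g₁ - deg g₂ = n + k dimensions. The opposite bound comes from the certified dual. -/
lemma le_finrank_qcCode (hn : 0 < n) (h₁ : g₁ ≠ 0) (h₂ : g₂ ≠ 0)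
    (hv : IsCoprime (v - 1) (X ^ n - 1)) {k : ℕ}
    (hdeg : k + g₁.natDegree + g₂.natDegree = n) :
    n + k ≤ Module.finrank (ZMod 2) (qcCode n g₁ g₂ v) := by
  let φ : (degreeLT (ZMod 2) (n - g₁.natDegree) × degreeLT (ZMod 2) (n - g₂.natDegree)) →ₗ[ZMod 2]
      qcCode n g₁ g₂ v :=
    { toFun := fun p => ⟨_, pairVec_mem_qcCode p.1.1 p.2.1⟩
      map_add' := fun p q => Subtype.ext (by
        simp only [Submodule.coe_add, Prod.fst_add, Prod.snd_add, ← pairVec_add]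
        congr 1 <;> ring)
      map_smul' := fun c p => Subtype.ext (by
        simp only [Submodule.coe_smul, Prod.smul_fst, Prod.smul_snd, RingHom.id_apply,
          smul_mul_assoc, ← smul_add, pairVec, map_smul, Prod.smul_mk]) }
  have hsmall : ∀ {g a : (ZMod 2)[X]}, g ≠ 0 → g.natDegree ≤ n →
      a ∈ degreeLT (ZMod 2) (n - g.natDegree) → X ^ n - 1 ∣ a * g → a = 0 := by
    intro g a hg hgn ha hdvd
    by_contra hne
    have h0 : a * g ≠ 0 := mul_ne_zero hne hg
    have h1 := degree_le_of_dvd hdvd h0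
    rw [degree_X_pow_sub_one hn, degree_eq_natDegree h0, natDegree_mul hne hg] at h1
    rw [mem_degreeLT, degree_eq_natDegree hne] at ha
    have h1 : n ≤ a.natDegree + g.natDegree := by exact_mod_cast h1
    have h2 : a.natDegree < n - g.natDegree := by exact_mod_cast ha
    omega
  -- In characteristic 2, v^2 - 1 = (v - 1)^2.
  have hcop : IsCoprime (X ^ n - 1) (v * v - 1) := by
    have e : v * v - 1 = (v - 1) * (v - 1) := by
      have h2 : (2 : (ZMod 2)[X]) = 0 := CharTwo.two_eq_zero
      linear_combination (v - 1) * h2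
    rw [e]
    exact (hv.symm).mul_right hv.symm
  have hφ : Function.Injective φ := by
    rw [← LinearMap.ker_eq_bot, LinearMap.ker_eq_bot']
    rintro ⟨⟨a, ha⟩, b, hb⟩ h
    have h := congrArg Subtype.val h
    have e1 : vec n (a * (v * g₁) + b * g₂) = vec n 0 :=
      (congrArg Prod.fst h).trans (map_zero _).symm
    have e2 : vec n (a * g₁ + b * (v * g₂)) = vec n 0 :=
      (congrArg Prod.snd h).trans (map_zero _).symm
    rw [vec_eq_vec_iff hn, sub_zero] at e1 e2
    -- Elimination of b: v times the first congruence minus the second.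
    have d1 : X ^ n - 1 ∣ (v * v - 1) * (a * g₁) := by
      have := dvd_sub (dvd_mul_of_dvd_right e1 v) e2
      convert this using 1; ring
    have d2 : X ^ n - 1 ∣ (v * v - 1) * (b * g₂) := by
      have := dvd_sub (dvd_mul_of_dvd_right e2 v) e1
      convert this using 1; ring
    have ha0 := hsmall h₁ (by omega) ha (hcop.dvd_of_dvd_mul_left d1)
    have hb0 := hsmall h₂ (by omega) hb (hcop.dvd_of_dvd_mul_left d2)
    subst ha0; subst hb0; rfl
  have h1 := LinearMap.finrank_le_finrank_of_injective hφ
  have hfin : ∀ m, Module.finrank (ZMod 2) (degreeLT (ZMod 2) m) = m := by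
    intro m
    rw [(degreeLTEquiv (ZMod 2) m).finrank_eq, Module.finrank_fin_fun]
  rw [Module.finrank_prod, hfin, hfin] at h1
  omega

/-! ### Certificates for the conditions -/

/-- Numbers that stand for binary polynomials: the data `g₁, g₂, v` of a code, the cofactors
`h₁, h₂` of `g₁, g₂` in `x ^ n - 1`, Bézout coefficients for `g₁, g₂` and for `v - 1, x ^ n - 1`,
the reverse of `h₁` and its cofactor. -/
structure PolyCert where
  g₁ : ℕ
  g₂ : ℕ
  v : ℕ
  h₁ : ℕ
  h₂ : ℕ
  a₁ : ℕ
  a₂ : ℕ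
  b₁ : ℕ
  b₂ : ℕ
  r : ℕ
  s : ℕ

def symCheck (n v : ℕ) : ℕ → Bool
  | 0 => true
  | i + 1 => cond (Bool.xor (bit v i) (bit v (Nat.mod (Nat.sub n i) n))) false (symCheck n v i)

def revCheck (h r m : ℕ) : ℕ → Bool
  | 0 => true
  | i + 1 => cond (Bool.xor (bit r i) (bit h (Nat.sub m i))) false (revCheck h r m i)

lemma symCheck_spec {v k : ℕ} (h : symCheck n v k = true) {i : ℕ} (hi : i < k) :
    v.testBit i = v.testBit ((n - i) % n) := by
  induction k with
  | zero => omega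
  | succ k ih =>
    rw [symCheck] at h
    cases hk : Bool.xor (bit v k) (bit v (Nat.mod (Nat.sub n k) n)) with
    | true => rw [hk] at h; exact absurd h (by simp)
    | false =>
      rw [hk, cond_false] at h
      obtain hi | rfl := Nat.lt_succ_iff_lt_or_eq.1 hi
      · exact ih h hi
      · rw [bit_eq, bit_eq] at hk
        exact bne_eq_false_iff_eq.1 hk

lemma revCheck_spec {h r m k : ℕ} (hc : revCheck h r m k = true) {i : ℕ} (hi : i < k) :
    r.testBit i = h.testBit (m - i) := by
  induction k with
  | zero => omega
  | succ k ih =>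
    rw [revCheck] at hc
    cases hk : Bool.xor (bit r k) (bit h (Nat.sub m k)) with
    | true => rw [hk] at hc; exact absurd hc (by simp)
    | false =>
      rw [hk, cond_false] at hc
      obtain hi | rfl := Nat.lt_succ_iff_lt_or_eq.1 hi
      · exact ih hc hi
      · rw [bit_eq, bit_eq] at hk
        exact bne_eq_false_iff_eq.1 hk

namespace PolyCert

def check (c : PolyCert) (n : ℕ) : Bool :=
  and (and (and (and (Nat.blt 0 c.g₁) (Nat.blt c.g₁ (Nat.pow 2 n)))
        (and (Nat.blt 0 c.g₂) (Nat.blt c.g₂ (Nat.pow 2 n))))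
      (and (and (Nat.blt 0 c.h₁) (Nat.blt c.r (Nat.pow 2 (Nat.add (Nat.log2 c.h₁) 1))))
        (Nat.blt c.v (Nat.pow 2 n))))
    (and (and (and (Nat.beq (clmul n c.g₁ c.h₁) (Nat.xor (Nat.pow 2 n) 1))
          (Nat.beq (clmul n c.g₂ c.h₂) (Nat.xor (Nat.pow 2 n) 1)))
        (and (Nat.beq (Nat.xor (clmul n c.g₁ c.a₁) (clmul n c.g₂ c.a₂)) 1)
          (Nat.beq (Nat.xor (clmul (Nat.add n 1) (Nat.xor c.v 1) c.b₁)
            (clmul (Nat.add n 1) (Nat.xor (Nat.pow 2 n) 1) c.b₂)) 1)))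
      (and (and (Nat.beq (clmul n c.g₂ c.s) c.r)
          (revCheck c.h₁ c.r (Nat.log2 c.h₁) (Nat.add (Nat.log2 c.h₁) 1)))
        (symCheck n c.v n)))

lemma reverse_toPoly {h r : ℕ} (hh : h ≠ 0) (hr : r < 2 ^ (h.log2 + 1))
    (hc : revCheck h r h.log2 (h.log2 + 1) = true) : (toPoly h).reverse = toPoly r := by
  ext i
  rw [coeff_reverse, natDegree_toPoly hh, coeff_toPoly]
  by_cases hi : i ≤ h.log2
  · rw [revAt_le hi, coeff_toPoly, revCheck_spec hc (Nat.lt_succ_of_le hi)]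
  · rw [revAt_eq_self_of_lt (not_le.1 hi), coeff_toPoly, Nat.testBit_lt_two_pow, Nat.testBit_lt_two_pow]
    · exact hr.trans_le (Nat.pow_le_pow_right two_pos (by omega))
    · exact Nat.lt_log2_self.trans_le (Nat.pow_le_pow_right two_pos (by omega))

lemma bar_toPoly {v : ℕ} (hn : 0 < n) (hv : v < 2 ^ n) (hc : symCheck n v n = true) :
    bar n (toPoly v) = toPoly v := by
  have hinv : ∀ i < n, (n - (n - i) % n) % n = i := by
    intro i hi
    obtain rfl | h0 := Nat.eq_zero_or_pos i
    · simp
    · rw [Nat.mod_eq_of_lt (show n - i < n by omega), Nat.sub_sub_self hi.le, Nat.mod_eq_of_lt hi]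
  have h1 : bar n (toPoly v) = ∑ i ∈ Finset.range n, C ((toPoly v).coeff i) * X ^ i := by
    rw [bar]
    refine Finset.sum_nbij' (fun i => (n - i) % n) (fun i => (n - i) % n) ?_ ?_ ?_ ?_ ?_
    · intro i _; exact Finset.mem_range.2 (Nat.mod_lt _ hn)
    · intro i _; exact Finset.mem_range.2 (Nat.mod_lt _ hn)
    · intro i hi; exact hinv i (Finset.mem_range.1 hi)
    · intro i hi; exact hinv i (Finset.mem_range.1 hi)
    · intro i hi
      rw [coeff_toPoly, coeff_toPoly, symCheck_spec hc (Finset.mem_range.1 hi)]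
  rw [h1]
  have h2 : (toPoly v).natDegree < n ∨ toPoly v = 0 := by
    by_cases h0 : toPoly v = 0
    · exact Or.inr h0
    · exact Or.inl ((natDegree_lt_iff_degree_lt h0).2 (degree_toPoly_lt hv))
  obtain h2 | h2 := h2
  · exact (as_sum_range_C_mul_X_pow' (toPoly v) h2).symm
  · simp [h2]

theorem conditions {c : PolyCert} (hn : 0 < n) (h : c.check n = true) :
    Conditions n (toPoly c.g₁) (toPoly c.g₂) (toPoly c.v) := by
  simp only [check, Bool.and_eq_true, Nat.beq_eq, Nat.blt_eq, xor_eq, pow_eq] at h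
  obtain ⟨⟨⟨⟨_, hg1⟩, _, hg2⟩, ⟨hh, hr⟩, hv⟩, ⟨⟨hd1, hd2⟩, hc1, hc2⟩, ⟨hs, hrev⟩, hsym⟩ := h
  have e1 : toPoly c.g₁ * toPoly c.h₁ = X ^ n - 1 := by
    rw [← toPoly_clmul _ _ _ hg1, hd1, toPoly_two_pow_xor_one]
  have e2 : toPoly c.g₂ * toPoly c.h₂ = X ^ n - 1 := by
    rw [← toPoly_clmul _ _ _ hg2, hd2, toPoly_two_pow_xor_one]
  have hlt : ∀ a < 2 ^ n, a ^^^ 1 < 2 ^ (n + 1) := fun a ha =>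
    Nat.xor_lt_two_pow (ha.trans (Nat.pow_lt_pow_right one_lt_two n.lt_succ_self))
      (Nat.one_lt_two_pow n.succ_ne_zero)
  have hn2 : 2 ^ n ^^^ 1 < 2 ^ (n + 1) :=
    Nat.xor_lt_two_pow (Nat.pow_lt_pow_right one_lt_two n.lt_succ_self)
      (Nat.one_lt_two_pow n.succ_ne_zero)
  refine ⟨degree_toPoly_lt hv, ⟨_, e1.symm⟩, ⟨_, e2.symm⟩, ⟨toPoly c.a₁, toPoly c.a₂, ?_⟩,
    ⟨toPoly c.b₁, toPoly c.b₂, ?_⟩, ?_, bar_toPoly hn hv hsym⟩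
  · rw [mul_comm, mul_comm (toPoly c.a₂), ← toPoly_clmul _ _ _ hg1, ← toPoly_clmul _ _ _ hg2,
      ← toPoly_xor, hc1, toPoly_one]
  · rw [mul_comm, mul_comm (toPoly c.b₂), ← toPoly_two_pow_xor_one, CharTwo.sub_eq_add,
      ← toPoly_one, ← toPoly_xor, ← toPoly_clmul _ _ _ (hlt _ hv), ← toPoly_clmul _ _ _ hn2,
      ← toPoly_xor]
    exact congrArg toPoly hc2
  · have hg0 : toPoly c.g₁ ≠ 0 := by
      intro h0
      rw [h0, zero_mul] at e1
      exact (monic_X_pow_sub_one hn).ne_zero e1.symm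
    -- The quotient of x^n - 1 by g₁ is the certified cofactor h₁, and `r` is its reverse.
    rw [perpPoly, ← e1, mul_div_cancel_left₀ _ hg0, reverse_toPoly hh.ne' hr hrev]
    refine ⟨toPoly c.s, ?_⟩
    rw [← toPoly_clmul _ _ _ hg2, hs]

/-- The generators of the code, as words of length `2 n`. -/
def gen₁ (c : PolyCert) (n : ℕ) : ℕ :=
  Nat.lor (Nat.land (comb c.v (shifts n c.g₁ n)) (ones n)) (Nat.shiftLeft c.g₁ n)

def gen₂ (c : PolyCert) (n : ℕ) : ℕ :=
  Nat.lor c.g₂ (Nat.shiftLeft (Nat.land (comb c.v (shifts n c.g₂ n)) (ones n)) n)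

lemma and_ones_lt (u : ℕ) : u &&& ones n < 2 ^ n :=
  by
  rw [ones_eq]
  exact Nat.and_lt_two_pow _ (Nat.sub_lt (Nat.two_pow_pos n) one_pos)

/-- The factor `g` is regarded as a word of length 2n with zero second half, which the shifts
preserve; the mask only makes the bound 2^n evident. -/
lemma vec_mul (hn : 0 < n) {v g : ℕ} (hv : v < 2 ^ n) (hg : g < 2 ^ n) :
    vec n (toPoly v * toPoly g) = vec n (toPoly (comb v (shifts n g n) &&& ones n)) := by
  have h1 : pairVec n (toPoly g) (toPoly 0) = toVec n g := by
    rw [pairVec_of_lt hn hg (by positivity)]; simp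
  have h2 := congrArg Prod.fst (pairVec_toPoly_mul hn h1 n v hv)
  refine h2.trans (funext fun i => ?_)
  rw [vec_apply_of_degree_lt hn (degree_toPoly_lt (and_ones_lt _)), coeff_toPoly, Nat.testBit_and,
    testBit_ones]
  simp [toVec]

lemma pairVec_gen₁ {c : PolyCert} (hn : 0 < n) (hv : c.v < 2 ^ n) (hg : c.g₁ < 2 ^ n) :
    pairVec n (toPoly c.v * toPoly c.g₁) (toPoly c.g₁) = toVec n (c.gen₁ n) := by
  rw [pairVec, vec_mul hn hv hg]
  exact pairVec_of_lt hn (and_ones_lt _) hg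

lemma pairVec_gen₂ {c : PolyCert} (hn : 0 < n) (hv : c.v < 2 ^ n) (hg : c.g₂ < 2 ^ n) :
    pairVec n (toPoly c.g₂) (toPoly c.v * toPoly c.g₂) = toVec n (c.gen₂ n) := by
  rw [pairVec, vec_mul hn hv hg]
  exact pairVec_of_lt hn hg (and_ones_lt _)

lemma or_shiftLeft_lt {a b : ℕ} (ha : a < 2 ^ n) (hb : b < 2 ^ n) :
    a ||| b <<< n < 2 ^ (2 * n) := by
  refine Nat.or_lt_two_pow (ha.trans_le (Nat.pow_le_pow_right two_pos (by omega))) ?_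
  rw [Nat.shiftLeft_eq, two_mul, pow_add]
  exact Nat.mul_lt_mul_of_pos_right hb (by positivity)

end PolyCert

end QuantumQC

namespace QuantumQC

variable {n : ℕ}

/-! ### Certificates for the dual code and for the weights -/

/-- A basis of the symplectic dual of a code in the form of two cyclic modules, with the
polynomials that express its generators by the generators of the code. -/
structure DualCert extends ShiftBasis where
  a₁ : ℕ
  a₂ : ℕ
  b₁ : ℕ
  b₂ : ℕ

namespace PolyCert

/-- The code that belongs to a certificate. -/
noncomputable def code (c : PolyCert) (n : ℕ) : Submodule (ZMod 2) (BinVec n) :=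
  qcCode n (toPoly c.g₁) (toPoly c.g₂) (toPoly c.v)

variable {c : PolyCert}

lemma toVec_gen₁_mem (hn : 0 < n) (hv : c.v < 2 ^ n) (hg : c.g₁ < 2 ^ n) :
    toVec n (c.gen₁ n) ∈ c.code n := by
  rw [← pairVec_gen₁ hn hv hg]
  exact ⟨1, 0, by simp [pairVec]⟩

lemma toVec_gen₂_mem (hn : 0 < n) (hv : c.v < 2 ^ n) (hg : c.g₂ < 2 ^ n) :
    toVec n (c.gen₂ n) ∈ c.code n := by
  rw [← pairVec_gen₂ hn hv hg]
  exact ⟨0, 1, by simp [pairVec]⟩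

lemma gen₁_lt (hg : c.g₁ < 2 ^ n) : c.gen₁ n < 2 ^ (2 * n) :=
  or_shiftLeft_lt (and_ones_lt _) hg

lemma gen₂_lt (hg : c.g₂ < 2 ^ n) : c.gen₂ n < 2 ^ (2 * n) :=
  or_shiftLeft_lt hg (and_ones_lt _)

/-- The word `a` times the first generator plus `b` times the second one. -/
def combGens (c : PolyCert) (n a b : ℕ) : ℕ :=
  Nat.xor (comb a (shifts n (c.gen₁ n) n)) (comb b (shifts n (c.gen₂ n) n))

lemma toVec_combGens_mem (hn : 0 < n) (hv : c.v < 2 ^ n) (hg₁ : c.g₁ < 2 ^ n) (hg₂ : c.g₂ < 2 ^ n)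
    (a b : ℕ) : toVec n (c.combGens n a b) ∈ c.code n := by
  rw [combGens, xor_eq, toVec_xor]
  exact Submodule.add_mem _
    (toVec_comb_shifts_mem (toVec_rotIter_mem hn (toVec_gen₁_mem hn hv hg₁)) _ _)
    (toVec_comb_shifts_mem (toVec_rotIter_mem hn (toVec_gen₂_mem hn hv hg₂)) _ _)

/-- Both generators are orthogonal to the shifts of the word `w`. -/
def orth (c : PolyCert) (n w : ℕ) : Bool :=
  and (orthCheck n (c.gen₁ n) w n) (orthCheck n (c.gen₂ n) w n)

lemma toVec_rotIter_mem_sympDual (hn : 0 < n) (hn' : n ≤ 128) (hv : c.v < 2 ^ n)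
    (hg₁ : c.g₁ < 2 ^ n) (hg₂ : c.g₂ < 2 ^ n) {w : ℕ} (hw : w < 2 ^ (2 * n))
    (h : c.orth n w = true) (i : ℕ) : toVec n (rotIter n w i) ∈ sympDual (c.code n) := by
  obtain ⟨h1, h2⟩ := Bool.and_eq_true_iff.1 h
  exact mem_sympDual_qcCode _
    (sympForm_multiples_rotIter hn hn' (pairVec_gen₁ hn hv hg₁) (gen₁_lt hg₁) hw h1 i)
    (sympForm_multiples_rotIter hn hn' (pairVec_gen₂ hn hv hg₂) (gen₂_lt hg₂) hw h2 i)

lemma lt_of_check (h : c.check n = true) : c.v < 2 ^ n ∧ c.g₁ < 2 ^ n ∧ c.g₂ < 2 ^ n ∧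
    c.g₁ ≠ 0 ∧ c.g₂ ≠ 0 := by
  simp only [check, Bool.and_eq_true, Nat.blt_eq, pow_eq] at h
  obtain ⟨⟨⟨⟨h1, h2⟩, h3, h4⟩, _, h5⟩, _⟩ := h
  exact ⟨h5, h2, h4, h1.ne', h3.ne'⟩

end PolyCert

namespace DualCert

def check (b : DualCert) (c : PolyCert) : Bool :=
  and (and b.isValid (Nat.blt b.n 128))
    (and (and (c.orth b.n b.f) (c.orth b.n b.g))
      (and (Nat.beq b.f (c.combGens b.n b.a₁ b.a₂)) (Nat.beq b.g (c.combGens b.n b.b₁ b.b₂))))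

variable {b : DualCert} {c : PolyCert}

/-- The certified basis spans the symplectic dual, and the dual lies in the code. -/
theorem sympDual_eq (hc : c.check b.n = true) (hb : b.check c = true) {k : ℕ}
    (hdeg : k + c.g₁.log2 + c.g₂.log2 = b.n) (hk : b.m + b.t + k = b.n) :
    (∀ u, u ∈ sympDual (c.code b.n) ↔
      ∃ a ∈ Finset.range (2 ^ b.m) ×ˢ Finset.range (2 ^ b.t), toVec b.n (b.word a.1 a.2) = u) ∧
    Nat.card (sympDual (c.code b.n)) = 2 ^ (b.m + b.t) ∧
    sympDual (c.code b.n) ≤ c.code b.n ∧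
    Module.finrank (ZMod 2) (c.code b.n) = b.n + k := by
  classical
  simp only [check, Bool.and_eq_true, Nat.beq_eq, Nat.blt_eq] at hb
  obtain ⟨⟨hB, hn'⟩, ⟨ho₁, ho₂⟩, hf, hg⟩ := hb
  have hB := ShiftBasis.valid_of_isValid hB
  obtain ⟨hv, hg₁, hg₂, h0₁, h0₂⟩ := PolyCert.lt_of_check hc
  have hn := hB.n_pos
  set D := sympDual (c.code b.n) with hD
  have hword : ∀ y x, toVec b.n (b.word y x) ∈ D := fun y x => by
    rw [ShiftBasis.word, toVec_xor]
    exact D.add_mem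
      (toVec_comb_shifts_mem
        (PolyCert.toVec_rotIter_mem_sympDual hn hn'.le hv hg₁ hg₂ hB.g_lt ho₂) _ _)
      (toVec_comb_shifts_mem
        (PolyCert.toVec_rotIter_mem_sympDual hn hn'.le hv hg₁ hg₂ hB.f_lt ho₁) _ _)
  have hwordC : ∀ y x, toVec b.n (b.word y x) ∈ c.code b.n := fun y x => by
    have h1 : ∀ a a', toVec b.n (c.combGens b.n a a') ∈ c.code b.n :=
      PolyCert.toVec_combGens_mem hn hv hg₁ hg₂
    rw [ShiftBasis.word, toVec_xor]
    exact Submodule.add_mem _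
      (toVec_comb_shifts_mem (toVec_rotIter_mem hn (hg ▸ h1 _ _)) _ _)
      (toVec_comb_shifts_mem (toVec_rotIter_mem hn (hf ▸ h1 _ _)) _ _)
  set S := Finset.range (2 ^ b.m) ×ˢ Finset.range (2 ^ b.t)
  have hinj : Set.InjOn (fun a : ℕ × ℕ => toVec b.n (b.word a.1 a.2)) S := by
    rintro ⟨y, x⟩ h ⟨y', x'⟩ h' he
    simp only [S, Finset.coe_product, Set.mem_prod, Finset.mem_coe, Finset.mem_range] at h h'
    obtain ⟨rfl, rfl⟩ := ShiftBasis.word_injective hB h.1 h.2 h'.1 h'.2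
      (toVec_injOn (ShiftBasis.word_lt hB _ _) (ShiftBasis.word_lt hB _ _) he)
    rfl
  have hcardI : (S.image fun a : ℕ × ℕ => toVec b.n (b.word a.1 a.2)).card = 2 ^ (b.m + b.t) := by
    rw [Finset.card_image_of_injOn hinj, Finset.card_product, Finset.card_range, Finset.card_range,
      pow_add]
  have hsub : (S.image fun a : ℕ × ℕ => toVec b.n (b.word a.1 a.2)) ⊆
      Finset.univ.filter (· ∈ D) := by
    intro u hu
    obtain ⟨a, _, rfl⟩ := Finset.mem_image.1 hu
    exact Finset.mem_filter.2 ⟨Finset.mem_univ _, hword _ _⟩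
  have hcardD : (Finset.univ.filter (· ∈ D)).card = 2 ^ Module.finrank (ZMod 2) D := by
    rw [← Fintype.card_subtype, ← Nat.card_eq_fintype_card]
    have := Module.natCard_eq_pow_finrank (K := ZMod 2) (V := D)
    rwa [Nat.card_zmod] at this
  have hfin := finrank_add_finrank_sympDual (c.code b.n)
  have hle := le_finrank_qcCode (k := k) hn
    (g₁ := toPoly c.g₁) (g₂ := toPoly c.g₂) (v := toPoly c.v)
    (fun h => by
      have := (PolyCert.conditions hn hc).dvd₁
      rw [h, zero_dvd_iff] at this
      exact (monic_X_pow_sub_one hn).ne_zero this)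
    (fun h => by
      have := (PolyCert.conditions hn hc).dvd₂
      rw [h, zero_dvd_iff] at this
      exact (monic_X_pow_sub_one hn).ne_zero this)
    (PolyCert.conditions hn hc).coprime_v
    (by rw [natDegree_toPoly h0₁, natDegree_toPoly h0₂, hdeg])
  change b.n + k ≤ Module.finrank (ZMod 2) (c.code b.n) at hle
  rw [← hD] at hfin
  -- A squeeze: independent words in the dual give dim D ≥ m + t, while dim C ≥ n + k gives dim D ≤
  -- n - k = m + t. Both bounds are attained.
  have h2 : 2 ^ (b.m + b.t) ≤ 2 ^ Module.finrank (ZMod 2) D := by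
    rw [← hcardI, ← hcardD]; exact Finset.card_le_card hsub
  have h3 := (Nat.pow_le_pow_iff_right (le_refl 2)).1 h2
  have h4 : Module.finrank (ZMod 2) D = b.m + b.t := by omega
  have heq := Finset.eq_of_subset_of_card_le hsub (by rw [hcardI, hcardD, h4])
  have hmem : ∀ u, u ∈ D ↔ ∃ a ∈ S, toVec b.n (b.word a.1 a.2) = u := by
    intro u
    rw [← Finset.mem_image, heq]; simp
  refine ⟨hmem, ?_, ?_, by omega⟩
  · rw [Nat.card_eq_fintype_card, Fintype.card_subtype, hcardD, h4]
  · intro u hu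
    obtain ⟨a, _, rfl⟩ := (hmem u).1 hu
    exact hwordC _ _

theorem weightCard_sympDual (hc : c.check b.n = true) (hb : b.check c = true) {k : ℕ}
    (hdeg : k + c.g₁.log2 + c.g₂.log2 = b.n) (hk : b.m + b.t + k = b.n) {e : ℕ}
    {l₀ : List (ℕ × ℕ)} {Gs : List (List ℕ × List (ℕ × ℕ))} (h₀ : b.countsEq [0] l₀ = true)
    (hGs : ∀ G ∈ Gs, G.1.length < 128 ∧ b.countsEq G.1 G.2 = true)
    (hcov : coversOrbits b.m b.q e (Gs.flatMap Prod.fst) = true)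
    (htot : (ShiftBasis.weightList l₀ e Gs (b.n + 1)).sum = 2 ^ (b.m + b.t)) (w : ℕ)
    (hw : w ≤ b.n) :
    weightCard (sympDual (c.code b.n)) w =
      (ShiftBasis.weightList l₀ e Gs (b.n + 1)).getD w 0 := by
  classical
  have hmem := (sympDual_eq hc hb hdeg hk).1
  simp only [check, Bool.and_eq_true, Nat.blt_eq] at hb
  have hB := ShiftBasis.valid_of_isValid hb.1.1
  rw [weightCard_eq_card, ← ShiftBasis.card_words_eq hB hb.1.2 h₀ hGs hcov htot w hw]
  symm
  refine Finset.card_bij (fun a _ => toVec b.n (b.word a.1 a.2)) ?_ ?_ ?_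
  · intro a ha
    rw [Finset.mem_filter] at ha
    exact Finset.mem_filter.2 ⟨Finset.mem_univ _, (hmem _).2 ⟨a, ha.1, rfl⟩,
      (sympWeight_toVec _).trans ha.2⟩
  · rintro ⟨y, x⟩ h ⟨y', x'⟩ h' he
    simp only [Finset.mem_filter, Finset.mem_product, Finset.mem_range] at h h'
    obtain ⟨rfl, rfl⟩ := ShiftBasis.word_injective hB h.1.1 h.1.2 h'.1.1 h'.1.2
      (toVec_injOn (ShiftBasis.word_lt hB _ _) (ShiftBasis.word_lt hB _ _) he)
    rfl
  · intro u hu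
    obtain ⟨_, h1, h2⟩ := Finset.mem_filter.1 hu
    obtain ⟨a, ha, rfl⟩ := (hmem u).1 h1
    exact ⟨a, Finset.mem_filter.2 ⟨ha, (sympWeight_toVec _).symm.trans h2⟩, rfl⟩

end DualCert

/-! ### The weights of the code -/

/-- The test that a code of length `2 n` whose symplectic dual has `M` elements and the weight
distribution `bs` has no weights between `0` and `d`, and `A` vectors of weight `j` outside of the
dual for `(j, A)` in `W`. -/
def weightsCheck (n d M : ℕ) (bs : List ℕ) (W : List (ℕ × ℕ)) : Bool :=
  (List.range d).all (fun j => j == 0 || (macCoeffs (d + 3) bs).1.getD j 0 == 0) &&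
  W.all fun p => p.1 != 0 &&
    (decide (p.1 < d + 3) && (macCoeffs (d + 3) bs).1.getD p.1 0 == (M * (p.2 + bs.getD p.1 0) : ℕ)
      || p.1 == n && macTop bs == (M * (p.2 + bs.getD n 0) : ℕ))

lemma sympWeight_eq_zero {u : BinVec n} : sympWeight u = 0 ↔ u = 0 := by
  simp [sympWeight, Finset.filter_eq_empty_iff, Prod.ext_iff, funext_iff, forall_and]

/-- The case j = 0 is excluded because of the extra 1 in `weightDist`. -/
lemma weightDist_add {C : Submodule (ZMod 2) (BinVec n)} (hC : sympDual C ≤ C) {j : ℕ}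
    (hj : j ≠ 0) : weightDist C j + weightCard (sympDual C) j = weightCard C j := by
  have h1 : {u | u ∈ sympDual C ∧ sympWeight u = j} ⊆ {u | u ∈ C ∧ sympWeight u = j} :=
    fun u hu => ⟨hC hu.1, hu.2⟩
  have h2 : {u | u ∈ C ∧ u ∉ sympDual C ∧ sympWeight u = j} =
      {u | u ∈ C ∧ sympWeight u = j} \ {u | u ∈ sympDual C ∧ sympWeight u = j} := by
    ext u; simp only [Set.mem_ofPred_eq, Set.mem_sdiff]; tauto
  rw [weightDist, if_neg hj, zero_add, h2, weightCard, weightCard]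
  exact Set.ncard_sdiff_add_ncard_of_subset h1 (Set.toFinite _)

/-- All hypotheses up to `hW` can be evaluated. Positivity of `A` ensures that the weight `d` occurs
outside the dual. -/
theorem yieldsCode_of_certificate {b : DualCert} {c : PolyCert} {k d d₀ : ℕ} {W : List (ℕ × ℕ)}
    {e : ℕ} {l₀ : List (ℕ × ℕ)} {Gs : List (List ℕ × List (ℕ × ℕ))} {A : ℕ}
    (hc : c.check b.n = true) (hb : b.check c = true)
    (hdeg : k + c.g₁.log2 + c.g₂.log2 = b.n) (hk : b.m + b.t + k = b.n)
    (h₀ : b.countsEq [0] l₀ = true)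
    (hGs : ∀ G ∈ Gs, G.1.length < 128 ∧ b.countsEq G.1 G.2 = true)
    (hcov : coversOrbits b.m b.q e (Gs.flatMap Prod.fst) = true)
    (htot : (ShiftBasis.weightList l₀ e Gs (b.n + 1)).sum = 2 ^ (b.m + b.t))
    (hW : weightsCheck b.n d (2 ^ (b.m + b.t)) (ShiftBasis.weightList l₀ e Gs (b.n + 1)) W = true)
    (hd : (d, A) ∈ W) (hA : 0 < A) (hd₀ : d₀ < d) :
    YieldsCode b.n k d d₀ (toPoly c.g₁) (toPoly c.g₂) (toPoly c.v) W := by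
  obtain ⟨-, hcard, hle, hfin⟩ := DualCert.sympDual_eq hc hb hdeg hk
  have hbs := DualCert.weightCard_sympDual hc hb hdeg hk h₀ hGs hcov htot
  have hlen := ShiftBasis.length_weightList l₀ e Gs (b.n + 1)
  set bs := ShiftBasis.weightList l₀ e Gs (b.n + 1)
  -- The identity is applied to the dual, whose own dual is the code, so the transform yields the
  -- weights of the code.
  have hmac := card_mul_weightCard_sympDual hlen hbs
  rw [hcard, sympDual_sympDual] at hmac
  have hM : (0 : ℤ) < (2 ^ (b.m + b.t) : ℕ) := by positivity
  have hn : 0 < b.n := by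
    simp only [DualCert.check, Bool.and_eq_true] at hb
    exact (ShiftBasis.valid_of_isValid hb.1.1).n_pos
  obtain ⟨hv, hg₁, hg₂, h0₁, h0₂⟩ := PolyCert.lt_of_check hc
  have hcs := (macCoeffs_spec (show 0 < d + 3 by omega) bs).2.1
  have htop : macTop bs = (macPoly bs).coeff b.n := by
    clear_value bs
    obtain _ | ⟨x, xs⟩ := bs
    · simp at hlen
    · rw [← (macTop_spec x xs).2, Nat.succ_injective hlen]
  simp only [weightsCheck, Bool.and_eq_true, List.all_eq_true, List.mem_range, Bool.or_eq_true,
    beq_iff_eq, bne_iff_ne, decide_eq_true_eq] at hW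
  obtain ⟨hW0, hW⟩ := hW
  have hzero : ∀ j, 0 < j → j < d → weightCard (c.code b.n) j = 0 := by
    intro j h0 hj
    have h1 := (hW0 j hj).resolve_left h0.ne'
    rw [hcs j (by omega), ← hmac] at h1
    exact_mod_cast (mul_eq_zero.1 h1).resolve_left hM.ne'
  have hval : ∀ p ∈ W, p.1 ≠ 0 ∧ weightDist (c.code b.n) p.1 = p.2 := by
    intro p hp
    obtain ⟨h0, h1⟩ := hW p hp
    refine ⟨h0, ?_⟩
    have hpn : p.1 ≤ b.n ∨ b.n < p.1 := le_or_gt _ _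
    have key : (macPoly bs).coeff p.1 = (2 ^ (b.m + b.t) * (p.2 + bs.getD p.1 0) : ℕ) := by
      obtain ⟨h1, h2⟩ | ⟨h1, h2⟩ := h1
      · rw [← hcs _ h1, h2]
      · rw [h1, ← htop, h2]
    rw [← hmac, Nat.cast_mul] at key
    have key := mul_left_cancel₀ hM.ne' key
    have key : weightCard (c.code b.n) p.1 = p.2 + bs.getD p.1 0 := by exact_mod_cast key
    have hadd := weightDist_add hle h0
    have hD : weightCard (sympDual (c.code b.n)) p.1 = bs.getD p.1 0 := by
      -- Beyond n the list returns its default 0, and there are no vectors of such a weight.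
      obtain hpn | hpn := hpn
      · exact hbs _ hpn
      · rw [List.getD_eq_default _ _ (by omega), weightCard, Set.ncard_eq_zero (Set.toFinite _),
          Set.eq_empty_iff_forall_notMem]
        rintro u ⟨-, hu⟩
        have := sympWeight_le u
        omega
    omega
  have hmin : ∀ u ∈ c.code b.n, u ≠ 0 → d ≤ sympWeight u := by
    intro u hu h0
    by_contra! hlt
    have h1 := hzero (sympWeight u) (Nat.pos_of_ne_zero fun h => h0 (sympWeight_eq_zero.1 h)) hlt
    rw [weightCard, Set.ncard_eq_zero (Set.toFinite _)] at h1
    exact (Set.eq_empty_iff_forall_notMem.1 h1) u ⟨hu, rfl⟩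
  -- One vector serves twice: it attains the minimum weight of the code and is an undetected error
  -- of weight d.
  have hex : ∃ u ∈ c.code b.n, u ∉ sympDual (c.code b.n) ∧ sympWeight u = d := by
    obtain ⟨h0, h1⟩ := hval _ hd
    rw [weightDist, if_neg h0, zero_add] at h1
    obtain ⟨u, hu⟩ := Set.nonempty_of_ncard_ne_zero (h1.trans_ne hA.ne')
    exact ⟨u, hu⟩
  refine ⟨PolyCert.conditions hn hc, ?_, hfin, hle, ?_, ?_, ?_, ?_, fun p hp => (hval p hp).2, hd₀⟩
  · rw [natDegree_toPoly h0₁, natDegree_toPoly h0₂, hdeg]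
  · obtain ⟨u, hu, hu', hw⟩ := hex
    refine ⟨⟨u, hu, fun h => hu' (h ▸ Submodule.zero_mem _), hw⟩, ?_⟩
    rintro w ⟨u, hu, h0, rfl⟩
    exact hmin u hu h0
  · exact exists_quantumCode (C := c.code b.n) hle (by rw [hcard, ← pow_add, hk]) hmin hex
  · rw [weightDist, if_pos rfl, Set.ncard_eq_zero (Set.toFinite _) |>.2]
    refine Set.eq_empty_iff_forall_notMem.2 ?_
    rintro u ⟨-, hu, h0⟩
    exact hu (sympWeight_eq_zero.1 h0 ▸ Submodule.zero_mem _)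
  · intro j h0 hj
    have := hzero j h0 hj
    have := weightDist_add hle h0.ne'
    change weightDist (c.code b.n) j = 0
    omega

lemma YieldsCode.of_runNat {k d d₀ a₁ a₂ a₃ : ℕ} {W : List (ℕ × ℕ)} {l₁ l₂ l₃ : List (ZMod 2 × ℕ)}
    (h : YieldsCode n k d d₀ (toPoly a₁) (toPoly a₂) (toPoly a₃) W) (h₁ : runNat l₁ = a₁)
    (h₂ : runNat l₂ = a₂) (h₃ : runNat l₃ = a₃) :
    YieldsCode n k d d₀ (runPoly l₁) (runPoly l₂) (runPoly l₃) W := by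
  rwa [runPoly_eq, runPoly_eq, runPoly_eq, h₁, h₂, h₃]

end QuantumQC

namespace QuantumQC

/-! ### Defining sets -/

variable {n : ℕ} {ζ : AlgebraicClosure (ZMod 2)}

/-- Reduction modulo `m` is invisible at a root of `m`. -/
lemma aeval_mulX {t m : ℕ} (hm : aeval ζ (toPoly m) = 0) (x : ℕ) :
    aeval ζ (toPoly (mulX t m x)) = ζ * aeval ζ (toPoly x) := by
  rw [mulX]
  cases bit x (Nat.sub t 1) <;>
    simp [toPoly_xor, toPoly_shiftLeft, hm]

/-- The residue modulo `m`, a polynomial of degree `t`, of `g (x ^ i)`, for `g` of degree less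
than `k`. -/
def evalMod (t m i : ℕ) : ℕ → ℕ → ℕ
  | 0, _ => 0
  | k + 1, g => Nat.xor (cond (bit g 0) 1 0) ((mulX t m)^[i] (evalMod t m i k (Nat.shiftRight g 1)))

lemma aeval_iterate_mulX {t m : ℕ} (hm : aeval ζ (toPoly m) = 0) (i x : ℕ) :
    aeval ζ (toPoly ((mulX t m)^[i] x)) = ζ ^ i * aeval ζ (toPoly x) := by
  induction i with
  | zero => simp
  | succ i ih => rw [Function.iterate_succ_apply', aeval_mulX hm, ih, pow_succ']; ring

lemma aeval_evalMod {t m : ℕ} (hm : aeval ζ (toPoly m) = 0) (i k g : ℕ) (hg : g < 2 ^ k) :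
    aeval ζ (toPoly (evalMod t m i k g)) = aeval (ζ ^ i) (toPoly g) := by
  induction k generalizing g with
  | zero =>
    obtain rfl : g = 0 := by simpa using hg
    simp [evalMod, toPoly_zero]
  | succ k ih =>
    have h2 : g >>> 1 < 2 ^ k := by rw [Nat.shiftRight_eq_div_pow]; omega
    rw [evalMod, xor_eq, shiftRight_eq, toPoly_xor, map_add, aeval_iterate_mulX hm, ih _ h2,
      toPoly_bit g, bit_eq]
    cases g.testBit 0 <;> simp [b2z, toPoly_zero, toPoly_one]

lemma aeval_sq (f : (ZMod 2)[X]) (a : AlgebraicClosure (ZMod 2)) :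
    aeval (a ^ 2) f = aeval a f ^ 2 := by
  rw [← expand_aeval, ZMod.expand_card, map_pow]

lemma mem_definingSet_of_mem_coset [NeZero n] {g : (ZMod 2)[X]} (hζ : ζ ^ n = 1) {i j : ZMod n}
    (hi : i ∈ definingSet n g ζ) (hj : j ∈ cyclotomicCoset n i) : j ∈ definingSet n g ζ := by
  obtain ⟨s, rfl⟩ := hj
  have hval : ζ ^ (i * 2 ^ s).val = (ζ ^ i.val) ^ 2 ^ s := by
    have h1 : i * 2 ^ s = ((i.val * 2 ^ s : ℕ) : ZMod n) := by
      rw [Nat.cast_mul, ZMod.natCast_zmod_val, Nat.cast_pow, Nat.cast_ofNat]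
    rw [h1, ZMod.val_natCast, ← pow_eq_pow_mod _ hζ, pow_mul]
  have key : ∀ s, aeval ((ζ ^ i.val) ^ 2 ^ s) g = 0 := by
    intro s
    induction s with
    | zero => rw [pow_zero, pow_one]; exact hi
    | succ s ih => rw [pow_succ, pow_mul, aeval_sq, ih]; simp
  rw [definingSet, Set.mem_ofPred_eq, hval]
  exact key s

lemma ncard_definingSet_le [NeZero n] {g : (ZMod 2)[X]} (hg : g ≠ 0) (hζ : IsPrimitiveRoot ζ n) :
    (definingSet n g ζ).ncard ≤ g.natDegree := by
  classical
  have h0 : g.map (algebraMap (ZMod 2) (AlgebraicClosure (ZMod 2))) ≠ 0 :=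
    (Polynomial.map_ne_zero_iff (algebraMap (ZMod 2) _).injective).2 hg
  have h1 : (definingSet n g ζ).ncard ≤ (((g.map (algebraMap (ZMod 2)
      (AlgebraicClosure (ZMod 2)))).roots.toFinset : Set (AlgebraicClosure (ZMod 2)))).ncard := by
    refine Set.ncard_le_ncard_of_injOn (fun i => ζ ^ i.val) ?_ ?_ (Finset.finite_toSet _)
    · intro i hi
      rw [Finset.mem_coe, Multiset.mem_toFinset, mem_roots h0, IsRoot, eval_map_algebraMap]
      exact hi
    · intro i _ j _ h
      exact ZMod.val_injective n (hζ.pow_inj (ZMod.val_lt i) (ZMod.val_lt j) h)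
  rw [Set.ncard_coe_finset] at h1
  exact h1.trans ((Multiset.toFinset_card_le _).trans
    ((card_roots' _).trans (natDegree_map_le)))

def cosetFinset (n : ℕ) (i : ZMod n) : Finset (ZMod n) :=
  (Finset.range n).image fun s => i * 2 ^ s

/-- The defining set of a cyclic code is the union of the cosets of some of its elements, if
these have sufficiently many elements. -/
lemma definingSet_eq [NeZero n] {t m g : ℕ} (hg : g ≠ 0) (hζ : IsPrimitiveRoot ζ n)
    (hm : aeval ζ (toPoly m) = 0) (s : Finset (ZMod n))
    (hs : ∀ i ∈ s, evalMod t m i.val (g.log2 + 1) g = 0)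
    (hcard : g.log2 ≤ (s.biUnion (cosetFinset n)).card) :
    definingSet n (toPoly g) ζ = ⋃ i ∈ s, cyclotomicCoset n i := by
  have h0 : toPoly g ≠ 0 := by
    intro h
    have h1 : (toPoly g).coeff g.log2 = 0 := by rw [h, coeff_zero]
    rw [coeff_toPoly, Nat.testBit_log2 hg] at h1
    exact absurd h1 (by decide)
  have hsub : (⋃ i ∈ s, cyclotomicCoset n i) ⊆ definingSet n (toPoly g) ζ := by
    refine Set.iUnion₂_subset fun i hi j hj => mem_definingSet_of_mem_coset hζ.pow_eq_one ?_ hj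
    have h1 := aeval_evalMod (t := t) hm i.val _ g Nat.lt_log2_self
    rw [hs i hi, toPoly_zero, map_zero] at h1
    exact h1.symm
  -- The polynomial has at most deg g roots, and the cosets of the tested roots already account for
  -- that many.
  refine (Set.eq_of_subset_of_ncard_le hsub ?_ (Set.toFinite _)).symm
  refine (ncard_definingSet_le h0 hζ).trans ?_
  rw [natDegree_toPoly hg]
  refine hcard.trans ?_
  rw [← Set.ncard_coe_finset]
  refine Set.ncard_le_ncard ?_ (Set.toFinite _)
  intro j hj
  obtain ⟨i, hi, hj⟩ := Finset.mem_biUnion.1 (Finset.mem_coe.1 hj)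
  obtain ⟨k, _, rfl⟩ := Finset.mem_image.1 hj
  exact Set.mem_iUnion₂.2 ⟨i, hi, k, rfl⟩

/-- A Bézout identity for x^r - 1 and `m` shows that they have no common root. -/
lemma pow_ne_one_of_clmul {m r a b k l : ℕ} (hm : aeval ζ (toPoly m) = 0) (hr : 2 ^ r ^^^ 1 < 2 ^ k)
    (hl : m < 2 ^ l) (h : clmul k (2 ^ r ^^^ 1) a ^^^ clmul l m b = 1) : ζ ^ r ≠ 1 := by
  intro h1
  have h2 := congrArg (fun u => aeval ζ (toPoly u)) h
  simp only [toPoly_xor, toPoly_clmul _ _ _ hr, toPoly_clmul _ _ _ hl] at h2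
  rw [← toPoly_xor, toPoly_two_pow_xor_one, map_add, map_mul, map_mul, hm] at h2
  simp [h1, toPoly_one] at h2

lemma exists_aeval_toPoly_eq_zero {m : ℕ} (hm : 1 < m) :
    ∃ ζ : AlgebraicClosure (ZMod 2), aeval ζ (toPoly m) = 0 := by
  refine IsAlgClosed.exists_aeval_eq_zero _ _ fun h => ?_
  have h1 := natDegree_toPoly (show m ≠ 0 by omega)
  rw [natDegree_eq_zero_iff_degree_le_zero.2 h.le] at h1
  have h2 : 1 ≤ m.log2 := (Nat.le_log2 (by omega)).2 hm
  omega

lemma isPrimitiveRoot_of_two_primes {p q : ℕ} (hn : 0 < n) (hζ : ζ ^ n = 1)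
    (hpq : ∀ r, r.Prime → r ∣ n → r = p ∨ r = q) (hp : ζ ^ (n / p) ≠ 1) (hq : ζ ^ (n / q) ≠ 1) :
    IsPrimitiveRoot ζ n := by
  rw [IsPrimitiveRoot.iff_orderOf]
  refine orderOf_eq_of_pow_and_pow_div_prime hn hζ fun r hr hrn => ?_
  obtain rfl | rfl := hpq r hr hrn
  · exact hp
  · exact hq

lemma pow_eq_one_of_iterate_mulX {t m : ℕ} (hm : aeval ζ (toPoly m) = 0)
    (h : (mulX t m)^[n] 1 = 1) : ζ ^ n = 1 := by
  have := aeval_iterate_mulX (t := t) hm n 1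
  rw [h, toPoly_one, map_one, mul_one] at this
  exact this.symm


/-- The number 0x1009 stands for x^12 + x^3 + 1, the cofactor of x + 1 in g₁; a root of it makes 1
an element of the defining set of g₁. The powers 15 and 9 exclude all proper orders. -/
lemma exists_root45 : ∃ ζ : AlgebraicClosure (ZMod 2), IsPrimitiveRoot ζ 45 ∧
    aeval ζ (toPoly 0x1009) = 0 := by
  obtain ⟨ζ, hm⟩ := exists_aeval_toPoly_eq_zero (show 1 < 0x1009 by norm_num)
  refine ⟨ζ, isPrimitiveRoot_of_two_primes (p := 3) (q := 5) (by norm_num)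
    (pow_eq_one_of_iterate_mulX (t := 12) hm (by decide +kernel)) (fun r hr h => ?_)
    (pow_ne_one_of_clmul (k := 16) (l := 13) (a := 0x48) (b := 0x241) hm (by decide +kernel)
      (by norm_num) (by decide +kernel))
    (pow_ne_one_of_clmul (k := 10) (l := 13) (a := 0x8) (b := 0x1) hm (by decide +kernel)
      (by norm_num) (by decide +kernel)), hm⟩
  obtain h | h := (Nat.Prime.dvd_mul hr (m := 3 ^ 2) (n := 5)).1 h
  · exact Or.inl ((Nat.prime_dvd_prime_iff_eq hr Nat.prime_three).1 (hr.dvd_of_dvd_pow h))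
  · exact Or.inr ((Nat.prime_dvd_prime_iff_eq hr Nat.prime_five).1 h)

/-- The number 0x1f3 stands for a factor of g₂ of degree 8, the size of the coset of 1. The powers
17 and 3 exclude all proper orders. -/
lemma exists_root51 : ∃ ζ : AlgebraicClosure (ZMod 2), IsPrimitiveRoot ζ 51 ∧
    aeval ζ (toPoly 0x1f3) = 0 := by
  obtain ⟨ζ, hm⟩ := exists_aeval_toPoly_eq_zero (show 1 < 0x1f3 by norm_num)
  refine ⟨ζ, isPrimitiveRoot_of_two_primes (p := 3) (q := 17) (by norm_num)
    (pow_eq_one_of_iterate_mulX (t := 8) hm (by decide +kernel)) (fun r hr h => ?_)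
    (pow_ne_one_of_clmul (k := 18) (l := 9) (a := 0x71) (b := 0x96d0) hm (by decide +kernel)
      (by norm_num) (by decide +kernel))
    (pow_ne_one_of_clmul (k := 4) (l := 9) (a := 0xe5) (b := 0x4) hm (by decide +kernel)
      (by norm_num) (by decide +kernel)), hm⟩
  obtain h | h := (Nat.Prime.dvd_mul hr (m := 3) (n := 17)).1 h
  · exact Or.inl ((Nat.prime_dvd_prime_iff_eq hr Nat.prime_three).1 h)
  · exact Or.inr ((Nat.prime_dvd_prime_iff_eq hr (by norm_num)).1 h)

theorem exists_definingSets45 {l₁ l₂ : List (ZMod 2 × ℕ)} (h₁ : runNat l₁ = 0x301b)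
    (h₂ : runNat l₂ = 0x1614f) : ∃ ζ : AlgebraicClosure (ZMod 2), IsPrimitiveRoot ζ 45 ∧
      definingSet 45 (runPoly l₁) ζ = cyclotomicCoset 45 0 ∪ cyclotomicCoset 45 1 ∧
      definingSet 45 (runPoly l₂) ζ = cyclotomicCoset 45 3 ∪ cyclotomicCoset 45 5 ∪
        cyclotomicCoset 45 9 ∪ cyclotomicCoset 45 15 := by
  obtain ⟨ζ, hζ, hm⟩ := exists_root45
  refine ⟨ζ, hζ, ?_, ?_⟩
  · rw [runPoly_eq, h₁, definingSet_eq (t := 12) (by decide) hζ hm {0, 1} (by decide +kernel)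
      (by decide +kernel)]
    simp
  · rw [runPoly_eq, h₂, definingSet_eq (t := 12) (by decide) hζ hm {3, 5, 9, 15}
      (by decide +kernel) (by decide +kernel)]
    simp [Set.union_assoc]

theorem exists_definingSets51 {l₁ l₂ : List (ZMod 2 × ℕ)} (h₁ : runNat l₁ = 0x3)
    (h₂ : runNat l₂ = 0x172b323) : ∃ ζ : AlgebraicClosure (ZMod 2), IsPrimitiveRoot ζ 51 ∧
      definingSet 51 (runPoly l₁) ζ = cyclotomicCoset 51 0 ∧
      definingSet 51 (runPoly l₂) ζ = cyclotomicCoset 51 1 ∪ cyclotomicCoset 51 3 ∪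
        cyclotomicCoset 51 5 := by
  obtain ⟨ζ, hζ, hm⟩ := exists_root51
  refine ⟨ζ, hζ, ?_, ?_⟩
  · rw [runPoly_eq, h₁, definingSet_eq (t := 8) (by decide) hζ hm {0} (by decide +kernel)
      (by decide +kernel)]
    simp
  · rw [runPoly_eq, h₂, definingSet_eq (t := 8) (by decide) hζ hm {1, 3, 5}
      (by decide +kernel) (by decide +kernel)]
    simp [Set.union_assoc]

end QuantumQC

namespace QuantumQC

/-! ### The code of length 45 -/

def polyCert45 : PolyCert where
  g₁ := 0x301b
  g₂ := 0x1614f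
  v := 0x1b0000000036
  h₁ := 0x1ff1f81c7
  h₂ := 0x2e776773
  a₁ := 0xa105
  a₂ := 0x1bba
  b₁ := 0x9b2a1e15365
  b₂ := 0x6634799e2ca
  r := 0x1c703f1ff
  s := 0x190d1

/-- The dual has dimension 29 = 17 + 12, against 61 for the code. The second module has 4095 = 45 ·
91 nonzero elements, in 91 orbits. -/
def dualCert45 : DualCert where
  n := 45
  t := 17
  f := 0x1bd025a94fd0d332abe394a
  p := 0x22f17
  m := 12
  g := 0x492082402e00fff1c7e0
  q := 0x1201
  a₁ := 0x4a5e9198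
  a₂ := 0x1a2d22d1
  b₁ := 0x0
  b₂ := 0xcb49220

/-- The first module alone, including the zero word. -/
def zeroWeights45 : List (ℕ × ℕ) :=
  [(0, 1), (15, 9), (20, 18), (21, 30), (23, 45), (24, 165), (25, 225), (26, 720), (27, 1495),
  (28, 2160), (29, 4320), (30, 7515), (31, 10440), (32, 15165), (33, 18585), (34, 17775),
  (35, 16281), (36, 13830), (37, 9855), (38, 6345), (39, 3570), (40, 1557), (41, 630), (42, 285),
  (45, 51)]

def group45_1 : List ℕ × List (ℕ × ℕ) :=
  ([1, 3, 5, 7, 11, 13, 15, 17, 19, 21, 23, 25, 29, 31, 33, 35, 37, 39, 41, 43, 47, 49, 51, 53,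
  55, 57, 59, 61, 67, 69, 71, 79, 81, 85, 87, 89, 91, 93, 95, 99, 103, 107, 111, 113, 115, 117],
    [(18, 4), (19, 16), (20, 65), (21, 182), (22, 657), (23, 1999), (24, 5237), (25, 13194),
    (26, 30293), (27, 63443), (28, 122300), (29, 215839), (30, 345737), (31, 501415),
    (32, 659763), (33, 780593), (34, 824113), (35, 776991), (36, 648310), (37, 472025),
    (38, 297954), (39, 160598), (40, 72252), (41, 26761), (42, 7738), (43, 1586), (44, 233),
    (45, 14)])

def group45_2 : List ℕ × List (ℕ × ℕ) :=
  ([121, 123, 125, 127, 133, 135, 141, 143, 149, 151, 157, 159, 163, 165, 167, 169, 171, 173, 177,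
  179, 183, 185, 187, 197, 205, 207, 213, 229, 239, 241, 247, 249, 273, 275, 277, 281, 285, 309,
  311, 313, 317, 335, 345, 355, 397],
    [(18, 3), (19, 6), (20, 48), (21, 169), (22, 570), (23, 1843), (24, 4996), (25, 12697),
    (26, 29647), (27, 62536), (28, 120343), (29, 211424), (30, 338918), (31, 491884),
    (32, 643799), (33, 760818), (34, 806067), (35, 759462), (36, 633917), (37, 463623),
    (38, 292608), (39, 157589), (40, 70793), (41, 25521), (42, 7195), (43, 1528), (44, 216),
    (45, 20)])

set_option maxRecDepth 100000 in
theorem yieldsCode45 : YieldsCode 45 16 8 7 (toPoly polyCert45.g₁)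
    (toPoly polyCert45.g₂) (toPoly polyCert45.v)
    [(8, 2970), (9, 32580), (10, 352620), (45, 5502836658465)] :=
  yieldsCode_of_certificate (b := dualCert45) (c := polyCert45) (e := 45)
    (l₀ := zeroWeights45)
    (Gs := [group45_1, group45_2])
    (A := 2970) (by decide +kernel) (by decide +kernel) (by decide +kernel) (by decide +kernel)
    (by decide +kernel)
    (List.forall_mem_cons.2 ⟨⟨by decide, by decide +kernel⟩,
      List.forall_mem_cons.2 ⟨⟨by decide, by decide +kernel⟩,
      List.forall_mem_nil _⟩⟩)
    (by decide +kernel) (by decide +kernel) (by decide +kernel) (List.mem_cons_self ..)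
    (by decide) (by decide)

end QuantumQC

namespace QuantumQC

/-! ### The code of length 51 -/

def polyCert51 : PolyCert where
  g₁ := 0x3
  g₂ := 0x172b323
  v := 0xd5b1a958dab0
  h₁ := 0x7ffffffffffff
  h₂ := 0xb02965f
  a₁ := 0xd1911e
  a₂ := 0x1
  b₁ := 0x232d80f01b4c5
  b₂ := 0x37ae2b1e30b4
  r := 0x7ffffffffffff
  s := 0x6fe7235

/-- The 255 nonzero elements of the second module form 5 orbits of length 51. -/
def dualCert51 : DualCert where
  n := 51
  t := 17
  f := 0x18f34769bfd596fc06524358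
  p := 0x32f49
  m := 8
  g := 0x79d482da5f1cd6ab2c42a38b
  q := 0x19f
  a₁ := 0x10a27a4ed56
  a₂ := 0x6fe7235
  b₁ := 0x5167036c6a1
  b₂ := 0x0

def zeroWeights51 : List (ℕ × ℕ) :=
  [(0, 1), (27, 51), (28, 51), (29, 357), (30, 901), (31, 1275), (32, 1734), (33, 4284),
  (34, 6936), (35, 7956), (36, 12495), (37, 15453), (38, 15912), (39, 17748), (40, 15453),
  (41, 11985), (42, 8772), (43, 4947), (44, 2550), (45, 1054), (46, 663), (47, 357), (48, 68),
  (49, 51), (51, 18)]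

def group51_1 : List ℕ × List (ℕ × ℕ) :=
  ([1, 3, 5, 15, 17],
    [(23, 2), (24, 5), (25, 22), (26, 86), (27, 211), (28, 586), (29, 1426), (30, 3095),
    (31, 6221), (32, 11499), (33, 20119), (34, 31750), (35, 45906), (36, 62257), (37, 75731),
    (38, 82700), (39, 83146), (40, 75202), (41, 60073), (42, 42750), (43, 26983), (44, 14829),
    (45, 6971), (46, 2721), (47, 827), (48, 198), (49, 42), (50, 2)])

set_option maxRecDepth 100000 in
theorem yieldsCode51 : YieldsCode 51 26 7 6 (toPoly polyCert51.g₁)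
    (toPoly polyCert51.g₂) (toPoly polyCert51.v)
    [(7, 7854), (8, 126021), (9, 1783827), (51, 64185081779884617)] :=
  yieldsCode_of_certificate (b := dualCert51) (c := polyCert51) (e := 51)
    (l₀ := zeroWeights51)
    (Gs := [group51_1])
    (A := 7854) (by decide +kernel) (by decide +kernel) (by decide +kernel) (by decide +kernel)
    (by decide +kernel)
    (List.forall_mem_cons.2 ⟨⟨by decide, by decide +kernel⟩,
      List.forall_mem_nil _⟩)
    (by decide +kernel) (by decide +kernel) (by decide +kernel) (List.mem_cons_self ..)
    (by decide) (by decide)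

end QuantumQC

namespace QuantumQC

/-! ### The code of length 47 -/

def polyCert47 : PolyCert where
  g₁ := 0xf76e31
  g₂ := 0x3
  v := 0x3ee30000c77c
  h₁ := 0x1949b31
  h₂ := 0x7fffffffffff
  a₁ := 0x1
  a₂ := 0x52da10
  b₁ := 0x1784dbdb21e9
  b₂ := 0x692031baff4
  r := 0x119b253
  s := 0xf76e31

/-- Here q = x + 1, so the second module has a single nonzero element, fixed by the shift: there is
one orbit, of length 1. -/
def dualCert47 : DualCert where
  n := 47
  t := 23
  f := 0x8cd9299213f9b8d6f0
  p := 0x8c76ef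
  m := 1
  g := 0x3fffffffffff800000000000
  q := 0x3
  a₁ := 0x0
  a₂ := 0xe0ea897b250
  b₁ := 0x8c76ef
  b₂ := 0x0

def zeroWeights47 : List (ℕ × ℕ) :=
  [(0, 1), (22, 235), (24, 3713), (26, 27213), (28, 138791), (30, 472021), (32, 1180217),
  (34, 1990074), (36, 2214170), (38, 1559789), (40, 644981), (42, 143585), (44, 13583), (46, 235)]

def group47_1 : List ℕ × List (ℕ × ℕ) :=
  ([1],
    [(23, 987), (25, 11891), (27, 63450), (29, 264516), (31, 781751), (33, 1612758),
    (35, 2221408), (37, 1966856), (39, 1078509), (41, 334687), (43, 49350), (45, 2444), (47, 1)])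

set_option maxRecDepth 100000 in
theorem yieldsCode47 : YieldsCode 47 23 7 6 (toPoly polyCert47.g₁)
    (toPoly polyCert47.g₂) (toPoly polyCert47.v)
    [(7, 8131), (8, 124221), (9, 1609280), (47, 1584816838311358)] :=
  yieldsCode_of_certificate (b := dualCert47) (c := polyCert47) (e := 1)
    (l₀ := zeroWeights47)
    (Gs := [group47_1])
    (A := 8131) (by decide +kernel) (by decide +kernel) (by decide +kernel) (by decide +kernel)
    (by decide +kernel)
    (List.forall_mem_cons.2 ⟨⟨by decide, by decide +kernel⟩,
      List.forall_mem_nil _⟩)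
    (by decide +kernel) (by decide +kernel) (by decide +kernel) (List.mem_cons_self ..)
    (by decide) (by decide)

end QuantumQC

namespace QuantumQC

/-! ### The code of length 55 -/

def polyCert55 : PolyCert where
  g₁ := 0x1ce96d
  g₂ := 0x7ff
  v := 0x57a400000025ea
  h₁ := 0xddd946dfd
  h₂ := 0x300600c01803
  a₁ := 0x28b
  a₂ := 0xb34e2
  b₁ := 0x64af4a4252f527
  b₂ := 0x3cc274647c93f0
  r := 0xbfb629bbb
  s := 0x381c4cd

/-- Here q = 1 + x + ... + x^10 divides x^11 - 1, so the orbits have length 11 instead of 55; there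
are 93 of them. -/
def dualCert55 : DualCert where
  n := 55
  t := 20
  f := 0x5fdb14ddd9a346499796ed9
  p := 0x16d2e7
  m := 10
  g := 0x180300600c01fbcf79ef3de7bc
  q := 0x7ff
  a₁ := 0x0
  a₂ := 0x5cb2cd0eb6b
  b₁ := 0x2cc8e07
  b₂ := 0x0

def zeroWeights55 : List (ℕ × ℕ) :=
  [(0, 1), (26, 55), (28, 330), (30, 1265), (32, 4895), (34, 22385), (36, 68200), (38, 146080),
  (40, 239470), (42, 257015), (44, 186780), (46, 90255), (48, 27610), (50, 3905), (52, 330)]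

def group55_1 : List ℕ × List (ℕ × ℕ) :=
  ([1, 3, 5, 7, 9, 11, 13, 15, 17, 19, 21, 23],
    [(20, 1), (22, 5), (24, 5), (26, 125), (28, 1580), (30, 12179), (32, 67045), (34, 273145),
    (36, 816290), (38, 1789225), (40, 2801511), (42, 3075695), (44, 2288180), (46, 1093785),
    (48, 312495), (50, 48251), (52, 3325), (54, 70)])

def group55_2 : List ℕ × List (ℕ × ℕ) :=
  ([25, 27, 29, 31, 33, 35, 37, 39, 41, 43, 45, 47],
    [(20, 1), (24, 15), (26, 195), (28, 1825), (30, 12402), (32, 67705), (34, 272380),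
    (36, 813275), (38, 1782970), (40, 2814041), (42, 3079535), (44, 2282115), (46, 1089810),
    (48, 313775), (50, 49338), (52, 3440), (54, 90)])

def group55_3 : List ℕ × List (ℕ × ℕ) :=
  ([49, 51, 53, 55, 57, 59, 61, 67, 69, 71, 73, 75],
    [(24, 20), (26, 180), (28, 1770), (30, 12623), (32, 67285), (34, 270300), (36, 815140),
    (38, 1791120), (40, 2806320), (42, 3075510), (44, 2283660), (46, 1092385), (48, 315575),
    (50, 47594), (52, 3350), (54, 80)])

def group55_4 : List ℕ × List (ℕ × ℕ) :=
  ([77, 79, 81, 83, 85, 87, 89, 91, 93, 99, 101, 103],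
    [(24, 15), (26, 125), (28, 1665), (30, 11966), (32, 67095), (34, 271780), (36, 817810),
    (38, 1791445), (40, 2802519), (42, 3069235), (44, 2289135), (46, 1095870), (48, 313555),
    (50, 47652), (52, 2990), (54, 55)])

def group55_5 : List ℕ × List (ℕ × ℕ) :=
  ([105, 107, 109, 111, 113, 115, 117, 119, 137, 139, 141, 147],
    [(24, 5), (26, 140), (28, 1845), (30, 13171), (32, 66635), (34, 270805), (36, 814905),
    (38, 1788340), (40, 2806471), (42, 3082330), (44, 2280035), (46, 1091695), (48, 314345),
    (50, 48725), (52, 3375), (54, 90)])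

def group55_6 : List ℕ × List (ℕ × ℕ) :=
  ([149, 151, 153, 155, 157, 163, 165, 167, 169, 171, 173, 179],
    [(24, 10), (26, 170), (28, 1670), (30, 12646), (32, 67735), (34, 270500), (36, 815930),
    (38, 1787290), (40, 2806374), (42, 3079980), (44, 2283760), (46, 1089900), (48, 314825),
    (50, 48862), (52, 3200), (54, 60)])

def group55_7 : List ℕ × List (ℕ × ℕ) :=
  ([181, 183, 185, 199, 201, 203, 205, 211, 213, 215, 217, 219],
    [(24, 5), (26, 125), (28, 1635), (30, 12000), (32, 66695), (34, 273330), (36, 817855),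
    (38, 1790065), (40, 2797407), (42, 3075565), (44, 2291885), (46, 1092030), (48, 312885),
    (50, 48020), (52, 3345), (54, 65)])

def group55_8 : List ℕ × List (ℕ × ℕ) :=
  ([293, 299, 301, 307, 309, 331, 333, 339, 341],
    [(24, 10), (26, 110), (28, 1240), (30, 9230), (32, 50575), (34, 203175), (36, 613940),
    (38, 1339540), (40, 2104768), (42, 2306900), (44, 1712120), (46, 822990), (48, 233695),
    (50, 36351), (52, 2500), (54, 40)])

set_option maxRecDepth 100000 in
theorem yieldsCode55 : YieldsCode 55 25 8 7 (toPoly polyCert55.g₁)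
    (toPoly polyCert55.g₂) (toPoly polyCert55.v)
    [(8, 7810), (9, 120285), (10, 1625580), (55, 162468493708434387)] :=
  yieldsCode_of_certificate (b := dualCert55) (c := polyCert55) (e := 11)
    (l₀ := zeroWeights55)
    (Gs := [group55_1, group55_2, group55_3, group55_4, group55_5, group55_6, group55_7,
    group55_8])
    (A := 7810) (by decide +kernel) (by decide +kernel) (by decide +kernel) (by decide +kernel)
    (by decide +kernel)
    (List.forall_mem_cons.2 ⟨⟨by decide, by decide +kernel⟩,
      List.forall_mem_cons.2 ⟨⟨by decide, by decide +kernel⟩,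
      List.forall_mem_cons.2 ⟨⟨by decide, by decide +kernel⟩,
      List.forall_mem_cons.2 ⟨⟨by decide, by decide +kernel⟩,
      List.forall_mem_cons.2 ⟨⟨by decide, by decide +kernel⟩,
      List.forall_mem_cons.2 ⟨⟨by decide, by decide +kernel⟩,
      List.forall_mem_cons.2 ⟨⟨by decide, by decide +kernel⟩,
      List.forall_mem_cons.2 ⟨⟨by decide, by decide +kernel⟩,
      List.forall_mem_nil _⟩⟩⟩⟩⟩⟩⟩⟩)
    (by decide +kernel) (by decide +kernel) (by decide +kernel) (List.mem_cons_self ..)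
    (by decide) (by decide)

end QuantumQC

namespace QuantumQC

/-! ### The code of length 73 -/

def polyCert73 : PolyCert where
  g₁ := 0x77277
  g₂ := 0x7ab
  v := 0x14c00000000000000ca
  h₁ := 0xd6512cff348a6b
  h₂ := 0xc8cda8f31743a4b7
  a₁ := 0x2c5
  a₂ := 0x28576
  b₁ := 0x1e25c6a28305158e91f
  b₂ := 0xc928712dee8360bb98
  r := 0xd6512cff348a6b
  s := 0x2c2ad13f2541

/-- The 511 nonzero elements of the second module form 7 orbits of length 73. -/
def dualCert73 : DualCert where
  n := 73
  t := 19
  f := 0x3fed6ea88639225dad67e4debefaea9c31b2e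
  p := 0x875cf
  m := 9
  g := 0x2178f2f9bbcfc9f17e6ef3f27c58042f1e5
  q := 0x217
  a₁ := 0x4daee0eb8b06ce
  a₂ := 0x5216d63049bec1aa
  b₁ := 0x0
  b₂ := 0x42bc37f701a3b1cb

def zeroWeights73 : List (ℕ × ℕ) :=
  [(0, 1), (41, 146), (42, 292), (43, 438), (44, 1314), (45, 2336), (46, 3577), (47, 6205),
  (48, 10220), (49, 16790), (50, 24674), (51, 33653), (52, 42413), (53, 48180), (54, 53509),
  (55, 56502), (56, 53801), (57, 47815), (58, 40515), (59, 30076), (60, 21389), (61, 15476),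
  (62, 8030), (63, 3869), (64, 2190), (65, 584), (66, 219), (67, 73), (73, 1)]

def group73_1 : List ℕ × List (ℕ × ℕ) :=
  ([1, 3, 5, 7, 9, 13, 15],
    [(34, 2), (36, 2), (37, 14), (38, 31), (39, 116), (40, 334), (41, 748), (42, 1753),
    (43, 3871), (44, 7679), (45, 14886), (46, 27214), (47, 46894), (48, 76443), (49, 116377),
    (50, 167446), (51, 226881), (52, 288419), (53, 343556), (54, 380977), (55, 394532),
    (56, 380851), (57, 340562), (58, 281482), (59, 214405), (60, 150596), (61, 96482),
    (62, 55761), (63, 29370), (64, 13776), (65, 5617), (66, 2065), (67, 667), (68, 172), (69, 30),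
    (70, 5)])

set_option maxRecDepth 100000 in
theorem yieldsCode73 : YieldsCode 73 45 7 6 (toPoly polyCert73.g₁)
    (toPoly polyCert73.g₂) (toPoly polyCert73.v)
    [(7, 13067), (8, 330252), (9, 7138451), (73, 251774484793909182856047064)] :=
  yieldsCode_of_certificate (b := dualCert73) (c := polyCert73) (e := 73)
    (l₀ := zeroWeights73)
    (Gs := [group73_1])
    (A := 13067) (by decide +kernel) (by decide +kernel) (by decide +kernel) (by decide +kernel)
    (by decide +kernel)
    (List.forall_mem_cons.2 ⟨⟨by decide, by decide +kernel⟩,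
      List.forall_mem_nil _⟩)
    (by decide +kernel) (by decide +kernel) (by decide +kernel) (List.mem_cons_self ..)
    (by decide) (by decide)

end QuantumQC

namespace QuantumQC

/-! ### The code of length 91 -/

def polyCert91 : PolyCert where
  g₁ := 0x1179
  g₂ := 0xb1783
  v := 0x64000000000000000000026
  h₁ := 0x8b4979dbcfc8ecb4d239
  h₂ := 0x17036531a826e9e6e7f
  a₁ := 0x9bf6
  a₂ := 0x15d
  b₁ := 0x11ec37892a0605491ec3789
  b₂ := 0xc02779a96d2b3dc802779e
  r := 0x9c4b2d3713f3db9e92d1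
  s := 0x1421a343855aa7cf

/-- The 4095 nonzero elements of the second module form 45 orbits of length 91. -/
def dualCert91 : DualCert where
  n := 91
  t := 19
  f := 0x3af21783037bd3a92a2d63404f93fee7a34bee05f1f422
  p := 0xc1e8d
  m := 12
  g := 0x4e25969b89f9edcf4968c42e985c082e4a32b382d03
  q := 0x13d1
  a₁ := 0x73bb5c4cced9b117d4a8
  a₂ := 0x0
  b₁ := 0x0
  b₂ := 0xb3de9d36c2a8212981

def zeroWeights91 : List (ℕ × ℕ) :=
  [(0, 1), (39, 7), (52, 21), (53, 273), (54, 273), (55, 273), (56, 728), (57, 1274), (58, 2457),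
  (59, 3731), (60, 7371), (61, 12649), (62, 17108), (63, 21931), (64, 26845), (65, 35532),
  (66, 41860), (67, 45864), (68, 51870), (69, 50505), (70, 47320), (71, 43680), (72, 35035),
  (73, 25844), (74, 19292), (75, 14014), (76, 8190), (77, 5005), (78, 2863), (79, 1365),
  (80, 819), (81, 182), (82, 91), (91, 15)]

def group91_1 : List ℕ × List (ℕ × ℕ) :=
  ([1, 3, 5, 7, 9, 11, 13, 15, 17, 19, 23, 25],
    [(45, 1), (47, 4), (48, 14), (49, 39), (50, 102), (51, 243), (52, 503), (53, 1154),
    (54, 2561), (55, 5146), (56, 9885), (57, 18344), (58, 31847), (59, 53635), (60, 86330),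
    (61, 130822), (62, 190231), (63, 263065), (64, 345293), (65, 429689), (66, 507111),
    (67, 568866), (68, 601868), (69, 601339), (70, 567528), (71, 503556), (72, 419795),
    (73, 327852), (74, 239517), (75, 162921), (76, 102490), (77, 59757), (78, 32291), (79, 15995),
    (80, 7237), (81, 2948), (82, 1031), (83, 327), (84, 89), (85, 23), (86, 5), (87, 2)])

def group91_2 : List ℕ × List (ℕ × ℕ) :=
  ([27, 29, 31, 33, 35, 39, 41, 45, 47, 49, 53, 55],
    [(47, 4), (48, 13), (49, 47), (50, 99), (51, 202), (52, 564), (53, 1243), (54, 2533),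
    (55, 5085), (56, 9856), (57, 18304), (58, 31940), (59, 53768), (60, 86080), (61, 130932),
    (62, 190841), (63, 262284), (64, 344128), (65, 431091), (66, 507316), (67, 567095),
    (68, 602219), (69, 602404), (70, 568782), (71, 503805), (72, 418962), (73, 327710),
    (74, 238998), (75, 162518), (76, 102612), (77, 59892), (78, 32431), (79, 16086), (80, 7169),
    (81, 2872), (82, 1071), (83, 353), (84, 109), (85, 33), (86, 5)])

def group91_3 : List ℕ × List (ℕ × ℕ) :=
  ([57, 59, 71, 75, 77, 83, 89, 99, 101, 103, 107, 117],
    [(46, 3), (47, 5), (48, 14), (49, 35), (50, 110), (51, 244), (52, 514), (53, 1226),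
    (54, 2595), (55, 5122), (56, 9867), (57, 18391), (58, 32033), (59, 53515), (60, 86157),
    (61, 130752), (62, 189904), (63, 262833), (64, 344483), (65, 429779), (66, 508534),
    (67, 569420), (68, 601265), (69, 600937), (70, 568598), (71, 503926), (72, 419940),
    (73, 328010), (74, 237996), (75, 162144), (76, 102878), (77, 59999), (78, 32428), (79, 16109),
    (80, 7212), (81, 2885), (82, 1107), (83, 377), (84, 86), (85, 18), (86, 4), (87, 1)])

def group91_4 : List ℕ × List (ℕ × ℕ) :=
  ([119, 127, 129, 139, 151, 179, 187, 203, 235],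
    [(46, 2), (47, 2), (48, 8), (49, 21), (50, 80), (51, 189), (52, 386), (53, 918), (54, 1987),
    (55, 3873), (56, 7373), (57, 13546), (58, 24002), (59, 40359), (60, 64372), (61, 98055),
    (62, 142641), (63, 197525), (64, 258688), (65, 322285), (66, 381132), (67, 426212),
    (68, 451589), (69, 451596), (70, 425865), (71, 377152), (72, 313699), (73, 246047),
    (74, 179892), (75, 122136), (76, 77100), (77, 44998), (78, 24263), (79, 11932), (80, 5344),
    (81, 2169), (82, 806), (83, 268), (84, 65), (85, 13), (86, 2)])

set_option maxRecDepth 100000 in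
theorem yieldsCode91 : YieldsCode 91 60 7 6 (toPoly polyCert91.g₁)
    (toPoly polyCert91.g₂) (toPoly polyCert91.v)
    [(7, 7930), (8, 252070), (9, 7192367), (91, 12192824252072319962279913005679504)] :=
  yieldsCode_of_certificate (b := dualCert91) (c := polyCert91) (e := 91)
    (l₀ := zeroWeights91)
    (Gs := [group91_1, group91_2, group91_3, group91_4])
    (A := 7930) (by decide +kernel) (by decide +kernel) (by decide +kernel) (by decide +kernel)
    (by decide +kernel)
    (List.forall_mem_cons.2 ⟨⟨by decide, by decide +kernel⟩,
      List.forall_mem_cons.2 ⟨⟨by decide, by decide +kernel⟩,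
      List.forall_mem_cons.2 ⟨⟨by decide, by decide +kernel⟩,
      List.forall_mem_cons.2 ⟨⟨by decide, by decide +kernel⟩,
      List.forall_mem_nil _⟩⟩⟩⟩)
    (by decide +kernel) (by decide +kernel) (by decide +kernel) (List.mem_cons_self ..)
    (by decide) (by decide)

end QuantumQC

namespace QuantumQC

/-! ### The code of length 93 -/

def polyCert93 : PolyCert where
  g₁ := 0x2d55c37
  g₂ := 0x37
  v := 0x5255ed402cffcd00adea928
  h₁ := 0x1789e1c43e2020fd2b
  h₂ := 0x1cdf44ac39be8958737d12b
  a₁ := 0xf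
  a₂ := 0x8e6d24
  b₁ := 0x10292576f65ede9bdba92503
  b₂ := 0x296efec5b18247d5c8a567a
  r := 0x1a97e0808f8470f23d
  s := 0x8ea730e1928bed0f

/-- The 1023 nonzero elements of the second module form 11 orbits of length 93. All weights in this
dual are even, so the odd ones are missing from the lists. -/
def dualCert93 : DualCert where
  n := 93
  t := 20
  f := 0x1f2df0efb22502af62b1e7311548da4aca433f1eaf7fef
  p := 0x1166fd
  m := 10
  g := 0x157bef17817d492f57152e43c74f22b0bbfa6c6e6ac85
  q := 0x50b
  a₁ := 0xf0b7d149870ce571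
  a₂ := 0x7ffa604b8783ecc82b292a
  b₁ := 0x0
  b₂ := 0x38ddc86e0e082dd5a71407

def zeroWeights93 : List (ℕ × ℕ) :=
  [(0, 1), (54, 310), (56, 1302), (58, 3720), (60, 15841), (62, 35991), (64, 81096), (66, 122047),
  (68, 181536), (70, 193254), (72, 186062), (74, 123504), (76, 66495), (78, 27125), (80, 8091),
  (82, 1953), (84, 248)]

def group93_1 : List ℕ × List (ℕ × ℕ) :=
  ([1, 3, 5, 7, 13, 15],
    [(44, 1), (48, 7), (50, 54), (52, 351), (54, 1823), (56, 7923), (58, 28720), (60, 87569),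
    (62, 218517), (64, 453378), (66, 774445), (68, 1073159), (70, 1200135), (72, 1067657),
    (74, 747730), (76, 404262), (78, 164343), (80, 49453), (82, 10355), (84, 1450), (86, 118),
    (88, 6)])

def group93_2 : List ℕ × List (ℕ × ℕ) :=
  ([17, 21, 23, 35, 41],
    [(48, 4), (50, 40), (52, 302), (54, 1516), (56, 6651), (58, 24075), (60, 72748), (62, 181509),
    (64, 379470), (66, 644005), (68, 893896), (70, 1000362), (72, 890845), (74, 623363),
    (76, 335774), (78, 136863), (80, 41522), (82, 8581), (84, 1248), (86, 102), (88, 4)])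

set_option maxRecDepth 100000 in
theorem yieldsCode93 : YieldsCode 93 63 7 6 (toPoly polyCert93.g₁)
    (toPoly polyCert93.g₂) (toPoly polyCert93.v)
    [(7, 20274), (8, 619752), (9, 17662002), (93, 219470836537301759730706283742251295)] :=
  yieldsCode_of_certificate (b := dualCert93) (c := polyCert93) (e := 93)
    (l₀ := zeroWeights93)
    (Gs := [group93_1, group93_2])
    (A := 20274) (by decide +kernel) (by decide +kernel) (by decide +kernel) (by decide +kernel)
    (by decide +kernel)
    (List.forall_mem_cons.2 ⟨⟨by decide, by decide +kernel⟩,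
      List.forall_mem_cons.2 ⟨⟨by decide, by decide +kernel⟩,
      List.forall_mem_nil _⟩⟩)
    (by decide +kernel) (by decide +kernel) (by decide +kernel) (List.mem_cons_self ..)
    (by decide) (by decide)

end QuantumQC

namespace QuantumQC

/-! ### The code of length 105 -/

def polyCert105 : PolyCert where
  g₁ := 0x123b
  g₂ := 0xff70b
  v := 0xa1000000000000000000000214
  h₁ := 0x24e52a56e3958e72dce12567
  h₂ := 0x6056362393bbda39fa9097
  a₁ := 0x35141
  a₂ := 0x546
  b₁ := 0x1f083361840eafd5c0861b3043f
  b₂ := 0x63d0bf7c981465fc6c9a472932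
  r := 0x39a921ced39c6a71da9529c9
  s := 0x4a906adf2a43fffb56f

/-- The 4095 nonzero elements of the second module form 39 orbits of length 105. -/
def dualCert105 : DualCert where
  n := 105
  t := 19
  f := 0x3eb3c495eb4f1836766cc55ee7e8e17228f4b78fa843999b1d732
  p := 0xd0eff
  m := 12
  g := 0x7352439da738d4e3b52a53938c168498754c8a2d3099cb57c7
  q := 0x1b89
  a₁ := 0x1ced5b165c4a74cc5664ce9d
  a₂ := 0x0
  b₁ := 0x0
  b₂ := 0x297cd8a9b152294297c8a5

def zeroWeights105 : List (ℕ × ℕ) :=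
  [(0, 1), (60, 350), (61, 105), (62, 105), (63, 140), (64, 525), (65, 651), (66, 1120),
  (67, 525), (68, 3990), (69, 4235), (70, 6300), (71, 9765), (72, 14770), (73, 23205),
  (74, 22365), (75, 32340), (76, 35070), (77, 41160), (78, 45745), (79, 45255), (80, 47838),
  (81, 45360), (82, 38010), (83, 29400), (84, 30590), (85, 18207), (86, 11130), (87, 7455),
  (88, 3570), (89, 3150), (90, 665), (91, 420), (93, 525), (95, 105), (97, 105), (99, 35),
  (105, 1)]

def group105_1 : List ℕ × List (ℕ × ℕ) :=
  ([1, 3, 5, 7, 9, 11, 13, 15, 17, 19],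
    [(56, 4), (57, 11), (58, 26), (59, 63), (60, 131), (61, 316), (62, 659), (63, 1375),
    (64, 2794), (65, 5324), (66, 9577), (67, 16694), (68, 28083), (69, 44962), (70, 69740),
    (71, 102881), (72, 145899), (73, 198557), (74, 256581), (75, 318543), (76, 377765),
    (77, 426344), (78, 459190), (79, 470648), (80, 458637), (81, 424522), (82, 372482),
    (83, 309420), (84, 243357), (85, 180634), (86, 125812), (87, 82521), (88, 51085), (89, 29226),
    (90, 15483), (91, 7728), (92, 3560), (93, 1448), (94, 527), (95, 207), (96, 45), (97, 16),
    (98, 3)])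

def group105_2 : List ℕ × List (ℕ × ℕ) :=
  ([21, 23, 25, 29, 35, 37, 39, 41, 43, 47],
    [(55, 1), (56, 8), (57, 14), (58, 23), (59, 44), (60, 160), (61, 325), (62, 741), (63, 1526),
    (64, 2764), (65, 5187), (66, 9765), (67, 16687), (68, 28191), (69, 45048), (70, 69248),
    (71, 103077), (72, 146185), (73, 197975), (74, 256357), (75, 318662), (76, 376933),
    (77, 426583), (78, 459215), (79, 470040), (80, 459007), (81, 424939), (82, 373027),
    (83, 309955), (84, 243697), (85, 180254), (86, 126262), (87, 82656), (88, 50311), (89, 29055),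
    (90, 15424), (91, 7756), (92, 3531), (93, 1446), (94, 526), (95, 188), (96, 61), (97, 22),
    (98, 4)])

def group105_3 : List ℕ × List (ℕ × ℕ) :=
  ([49, 51, 53, 57, 61, 63, 71, 75, 83, 95],
    [(55, 5), (56, 4), (57, 12), (58, 20), (59, 63), (60, 141), (61, 276), (62, 687), (63, 1369),
    (64, 2894), (65, 5285), (66, 9596), (67, 16792), (68, 28194), (69, 45003), (70, 69687),
    (71, 103330), (72, 145181), (73, 198300), (74, 257432), (75, 317574), (76, 377153),
    (77, 426403), (78, 459060), (79, 471854), (80, 457622), (81, 423640), (82, 374138),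
    (83, 310360), (84, 244032), (85, 180001), (86, 125096), (87, 82537), (88, 50981), (89, 29212),
    (90, 15464), (91, 7659), (92, 3440), (93, 1549), (94, 557), (95, 201), (96, 54), (97, 15),
    (98, 6), (102, 1)])

def group105_4 : List ℕ × List (ℕ × ℕ) :=
  ([105, 109, 113, 123, 127, 131, 141, 151, 183],
    [(56, 5), (57, 10), (58, 12), (59, 67), (60, 113), (61, 293), (62, 613), (63, 1341),
    (64, 2443), (65, 4876), (66, 8676), (67, 15216), (68, 25260), (69, 40529), (70, 62612),
    (71, 92907), (72, 131480), (73, 177912), (74, 231300), (75, 286033), (76, 339746),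
    (77, 383240), (78, 413137), (79, 422954), (80, 412568), (81, 382872), (82, 335505),
    (83, 280046), (84, 218924), (85, 162625), (86, 113518), (87, 74475), (88, 45627), (89, 25778),
    (90, 14006), (91, 6702), (92, 3157), (93, 1241), (94, 520), (95, 163), (96, 69), (97, 16),
    (98, 5)])

set_option maxRecDepth 100000 in
theorem yieldsCode105 : YieldsCode 105 74 7 6 (toPoly polyCert105.g₁)
    (toPoly polyCert105.g₂) (toPoly polyCert105.v)
    [(7, 21855), (8, 854385), (9, 27543740), (105, 58317900420110092238457799326599725172775)] :=
  yieldsCode_of_certificate (b := dualCert105) (c := polyCert105) (e := 105)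
    (l₀ := zeroWeights105)
    (Gs := [group105_1, group105_2, group105_3, group105_4])
    (A := 21855) (by decide +kernel) (by decide +kernel) (by decide +kernel) (by decide +kernel)
    (by decide +kernel)
    (List.forall_mem_cons.2 ⟨⟨by decide, by decide +kernel⟩,
      List.forall_mem_cons.2 ⟨⟨by decide, by decide +kernel⟩,
      List.forall_mem_cons.2 ⟨⟨by decide, by decide +kernel⟩,
      List.forall_mem_cons.2 ⟨⟨by decide, by decide +kernel⟩,
      List.forall_mem_nil _⟩⟩⟩⟩)
    (by decide +kernel) (by decide +kernel) (by decide +kernel) (List.mem_cons_self ..)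
    (by decide) (by decide)

end QuantumQC

/-! ### The eight codes and the defining sets for lengths 45 and 51. -/

theorem mainTheorem5 :
    YieldsCode 45 16 8 7
      (runPoly [(1, 2), (0, 1), (1, 2), (0, 7), (1, 2)])
      (runPoly [(1, 4), (0, 2), (1, 1), (0, 1), (1, 1), (0, 4), (1, 2), (0, 1), (1, 1)])
      (runPoly [(0, 1), (1, 2), (0, 1), (1, 2), (0, 34), (1, 2), (0, 1), (1, 2)])
      [(8, 2970), (9, 32580), (10, 352620), (45, 5502836658465)] ∧
    (∃ ζ : AlgebraicClosure (ZMod 2), IsPrimitiveRoot ζ 45 ∧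
      definingSet 45 (runPoly [(1, 2), (0, 1), (1, 2), (0, 7), (1, 2)]) ζ = cyclotomicCoset 45 0 ∪
        cyclotomicCoset 45 1 ∧
      definingSet 45 (runPoly [(1, 4), (0, 2), (1, 1), (0, 1), (1, 1), (0, 4), (1, 2), (0, 1),
        (1, 1)]) ζ = cyclotomicCoset 45 3 ∪ cyclotomicCoset 45 5 ∪ cyclotomicCoset 45 9 ∪
        cyclotomicCoset 45 15) ∧
    YieldsCode 51 26 7 6
      (runPoly [(1, 2)])
      (runPoly [(1, 2), (0, 3), (1, 1), (0, 2), (1, 2), (0, 2), (1, 2), (0, 1), (1, 1), (0, 1),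
        (1, 1), (0, 2), (1, 3), (0, 1), (1, 1)])
      (runPoly [(0, 4), (1, 2), (0, 1), (1, 1), (0, 1), (1, 1), (0, 1), (1, 2), (0, 1), (1, 2),
        (0, 3), (1, 2), (0, 1), (1, 1), (0, 1), (1, 1), (0, 2), (1, 1), (0, 1), (1, 1), (0, 1),
        (1, 2), (0, 3), (1, 2), (0, 1), (1, 2), (0, 1), (1, 1), (0, 1), (1, 1), (0, 1), (1, 2)])
      [(7, 7854), (8, 126021), (9, 1783827), (51, 64185081779884617)] ∧
    (∃ ζ : AlgebraicClosure (ZMod 2), IsPrimitiveRoot ζ 51 ∧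
      definingSet 51 (runPoly [(1, 2)]) ζ = cyclotomicCoset 51 0 ∧
      definingSet 51 (runPoly [(1, 2), (0, 3), (1, 1), (0, 2), (1, 2), (0, 2), (1, 2), (0, 1),
        (1, 1), (0, 1), (1, 1), (0, 2), (1, 3), (0, 1), (1, 1)]) ζ = cyclotomicCoset 51 1 ∪
        cyclotomicCoset 51 3 ∪ cyclotomicCoset 51 5) ∧
    YieldsCode 47 23 7 6
      (runPoly [(1, 1), (0, 3), (1, 2), (0, 3), (1, 3), (0, 1), (1, 2), (0, 1), (1, 3), (0, 1),
        (1, 4)])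
      (runPoly [(1, 2)])
      (runPoly [(0, 2), (1, 5), (0, 1), (1, 3), (0, 3), (1, 2), (0, 16), (1, 2), (0, 3), (1, 3),
        (0, 1), (1, 5)])
      [(7, 8131), (8, 124221), (9, 1609280), (47, 1584816838311358)] ∧
    YieldsCode 55 25 8 7
      (runPoly [(1, 1), (0, 1), (1, 2), (0, 1), (1, 2), (0, 1), (1, 1), (0, 2), (1, 1), (0, 1),
        (1, 3), (0, 2), (1, 3)])
      (runPoly [(1, 11)])
      (runPoly [(0, 1), (1, 1), (0, 1), (1, 1), (0, 1), (1, 4), (0, 1), (1, 1), (0, 2), (1, 1),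
        (0, 28), (1, 1), (0, 2), (1, 1), (0, 1), (1, 4), (0, 1), (1, 1), (0, 1), (1, 1)])
      [(8, 7810), (9, 120285), (10, 1625580), (55, 162468493708434387)] ∧
    YieldsCode 73 45 7 6
      (runPoly [(1, 3), (0, 1), (1, 3), (0, 2), (1, 1), (0, 2), (1, 3), (0, 1), (1, 3)])
      (runPoly [(1, 2), (0, 1), (1, 1), (0, 1), (1, 1), (0, 1), (1, 4)])
      (runPoly [(0, 1), (1, 1), (0, 1), (1, 1), (0, 2), (1, 2), (0, 58), (1, 2), (0, 2), (1, 1),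
        (0, 1), (1, 1)])
      [(7, 13067), (8, 330252), (9, 7138451), (73, 251774484793909182856047064)] ∧
    YieldsCode 91 60 7 6
      (runPoly [(1, 1), (0, 2), (1, 4), (0, 1), (1, 1), (0, 3), (1, 1)])
      (runPoly [(1, 2), (0, 5), (1, 4), (0, 1), (1, 1), (0, 3), (1, 2), (0, 1), (1, 1)])
      (runPoly [(0, 1), (1, 2), (0, 2), (1, 1), (0, 80), (1, 1), (0, 2), (1, 2)])
      [(7, 7930), (8, 252070), (9, 7192367), (91, 12192824252072319962279913005679504)] ∧
    YieldsCode 93 63 7 6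
      (runPoly [(1, 3), (0, 1), (1, 2), (0, 4), (1, 3), (0, 1), (1, 1), (0, 1), (1, 1), (0, 1),
        (1, 1), (0, 1), (1, 1), (0, 1), (1, 2), (0, 1), (1, 1)])
      (runPoly [(1, 3), (0, 1), (1, 2)])
      (runPoly ([(0, 3), (1, 1), (0, 1), (1, 1), (0, 2), (1, 1), (0, 2), (1, 1), (0, 1), (1, 1),
        (0, 1), (1, 1), (0, 1), (1, 4), (0, 1), (1, 2), (0, 1), (1, 1), (0, 1), (1, 1), (0, 8),
        (1, 1), (0, 1), (1, 2), (0, 2), (1, 10), (0, 2), (1, 2), (0, 1), (1, 1)] ++ [(0, 8),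
        (1, 1), (0, 1), (1, 1), (0, 1), (1, 2), (0, 1), (1, 4), (0, 1), (1, 1), (0, 1), (1, 1),
        (0, 1), (1, 1), (0, 2), (1, 1), (0, 2), (1, 1), (0, 1), (1, 1)]))
      [(7, 20274), (8, 619752), (9, 17662002), (93, 219470836537301759730706283742251295)] ∧
    YieldsCode 105 74 7 6
      (runPoly [(1, 2), (0, 1), (1, 3), (0, 3), (1, 1), (0, 2), (1, 1)])
      (runPoly [(1, 2), (0, 1), (1, 1), (0, 4), (1, 3), (0, 1), (1, 8)])
      (runPoly [(0, 2), (1, 1), (0, 1), (1, 1), (0, 4), (1, 1), (0, 86), (1, 1), (0, 4), (1, 1),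
        (0, 1), (1, 1)])
      [(7, 21855), (8, 854385), (9, 27543740), (105, 58317900420110092238457799326599725172775)] := by
  refine ⟨?_, ?_, ?_, ?_, ?_, ?_, ?_, ?_, ?_, ?_⟩
  · exact yieldsCode45.of_runNat (by decide +kernel) (by decide +kernel)
      (by decide +kernel)
  · exact exists_definingSets45 (by decide +kernel) (by decide +kernel)
  · exact yieldsCode51.of_runNat (by decide +kernel) (by decide +kernel)
      (by decide +kernel)
  · exact exists_definingSets51 (by decide +kernel) (by decide +kernel)
  · exact yieldsCode47.of_runNat (by decide +kernel) (by decide +kernel)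
      (by decide +kernel)
  · exact yieldsCode55.of_runNat (by decide +kernel) (by decide +kernel)
      (by decide +kernel)
  · exact yieldsCode73.of_runNat (by decide +kernel) (by decide +kernel)
      (by decide +kernel)
  · exact yieldsCode91.of_runNat (by decide +kernel) (by decide +kernel)
      (by decide +kernel)
  · exact yieldsCode93.of_runNat (by decide +kernel) (by decide +kernel)
      (by decide +kernel)
  · exact yieldsCode105.of_runNat (by decide +kernel) (by decide +kernel)
      (by decide +kernel)
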